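/- **Conventions.** For a finite set $V$, a magic unitary over $V$ is a $V\times V$ matrix with entries in a unital C*-algebra, all of whose entries are projections and all of whose rows and columns consist of pairwise orthogonal projections with sum $1$. $A_s(n)$ is the universal C*-algebra generated by the entries $u_{ij}$ of an $n\times n$ magic unitary, with the Hopf C*-algebra structure $\Delta(u_{ij})=\sum_k u_{ik}\otimes u_{kj}$, $\varepsilon(u_{ij})=\delta_{ij}$, $S(u_{ij})=u_{ji}$. For a finite simple graph $X$ with adjacency matrix $d$, $A(X)=A_s(|X|)/\langle du=ud\rangle$ with the induced Hopf C*-algebra structure. For a finite group $G$, $C(G)$ is the Hopf C*-algebra of complex functions on $G$, with $\Delta(f)(g,h)=f(gh)$, $\varepsilon(f)=f(1)$, $S(f)(g)=f(g^{-1})$. The tensor product of Hopf C*-algebras is the maximal (universal) C*-tensor product, with its usual Hopf C*-algebra structure, and $=$ means isomorphism of Hopf C*-algebras (a *-isomorphism compatible with $\Delta,\varepsilon,S$). $K_n$ is the complete graph on $n$ vertices, $C_n$ the $n$-cycle. The direct product $X\times Y$ has vertex set $X\times Y$ and $(i,\alpha)\sim(j,\beta)$ if and only if $i\sim j$ and $\alpha\sim\beta$;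 the prism $\mathrm{Pr}(X)=K_2\,\square\,X$ is the Cartesian product, in which $(i,\alpha)\sim(j,\beta)$ if and only if ($i=j$ and $\alpha\sim\beta$) or ($i\sim j$ and $\alpha=\beta$). $D_{2n}$ is the dihedral group of order $4n$. **Corollary 4.1.** 1. $A(K_m\times K_n)=A(K_m)\otimes A(K_n)$ for all integers $m,n\ge 1$ with $m\ne n$. 2. $A(\mathrm{Pr}(K_n))=C(\mathbb Z_2)\otimes A_s(n)$ for all integers $n\ge 1$ with $n\ne 2$. 3. $A(\mathrm{Pr}(C_n))=C(D_{2n})$ for all odd integers $n\ge 3$. 4. $A(\mathrm{Pr}(C_4))=C(\mathbb Z_2)\otimes A_s(4)$ (the graph $\mathrm{Pr}(C_4)$ is the cube). -/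

import Mathlib

open scoped TensorProduct ComplexConjugate

noncomputable section

namespace QSym

universe u v w

/-! ### C*-completions of *-algebras -/

section Completion

variable {F : Type u} [Ring F] [StarRing F] [Algebra ℂ F]

/-- A C*-seminorm on a unital complex *-algebra. -/
structure CStarSeminorm (F : Type u) [Ring F] [StarRing F] [Algebra ℂ F] extends
    Seminorm ℂ F where
  mul_le' : ∀ x y, toFun (x * y) ≤ toFun x * toFun y
  star_mul_self' : ∀ x, toFun (star x * x) = toFun x * toFun x

instance : CoeFun (CStarSeminorm F) (fun _ => F → ℝ) := ⟨fun p => p.toSeminorm⟩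

namespace CStarSeminorm

theorem mul_le (p : CStarSeminorm F) (x y : F) : p (x * y) ≤ p x * p y := p.mul_le' x y

theorem star_mul_self (p : CStarSeminorm F) (x : F) : p (star x * x) = p x * p x :=
  p.star_mul_self' x

theorem nonneg (p : CStarSeminorm F) (x : F) : 0 ≤ p x := apply_nonneg p.toSeminorm x

theorem le_star (p : CStarSeminorm F) (x : F) : p x ≤ p (star x) := by
  rcases (p.nonneg x).eq_or_lt with h | h
  · rw [← h]; exact p.nonneg _
  · have := p.mul_le (star x) x
    rw [p.star_mul_self] at this
    exact le_of_mul_le_mul_right this h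

theorem star_eq (p : CStarSeminorm F) (x : F) : p (star x) = p x :=
  le_antisymm (by simpa using p.le_star (star x)) (p.le_star x)

/-- The C*-seminorm `x ↦ ‖φ x‖` of a *-homomorphism into a C*-algebra. -/
def ofHom {D : Type v} [CStarAlgebra D] (φ : F →⋆ₐ[ℂ] D) : CStarSeminorm F where
  toFun x := ‖φ x‖
  map_zero' := by simp
  add_le' x y := by rw [map_add]; exact norm_add_le _ _
  neg' x := by rw [map_neg, norm_neg]
  smul' c x := by rw [map_smul, norm_smul]
  mul_le' x y := by rw [map_mul]; exact norm_mul_le _ _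
  star_mul_self' x := by rw [map_mul, map_star]; exact CStarRing.norm_star_mul_self

/-- The *-algebra `F`, seen as a seminormed ring with respect to a C*-seminorm `p`. -/
def Carrier (_p : CStarSeminorm F) : Type u := F

variable (p : CStarSeminorm F)

instance : Ring p.Carrier := inferInstanceAs (Ring F)

instance : SeminormedRing p.Carrier where
  toRing := inferInstance
  __ := @AddGroupSeminorm.toSeminormedAddCommGroup p.Carrier _ p.toSeminorm.toAddGroupSeminorm
  norm_mul_le := p.mul_le

instance : StarRing p.Carrier := inferInstanceAs (StarRing F)

instance : Algebra ℂ p.Carrier := inferInstanceAs (Algebra ℂ F)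

instance : NormedAlgebra ℂ p.Carrier :=
  { (inferInstance : Algebra ℂ p.Carrier) with
    norm_smul_le := fun c x => (map_smul_eq_mul p.toSeminorm c x).le }

instance : NormedStarGroup p.Carrier := ⟨fun x => (p.star_eq x).le⟩

/-- The Hausdorff completion of `F` with respect to the C*-seminorm `p`. -/
def Completion : Type u := UniformSpace.Completion p.Carrier

instance : NormedRing p.Completion := inferInstanceAs (NormedRing (UniformSpace.Completion p.Carrier))

instance : CompleteSpace p.Completion :=
  inferInstanceAs (CompleteSpace (UniformSpace.Completion p.Carrier))

instance : Algebra ℂ p.Completion :=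
  inferInstanceAs (Algebra ℂ (UniformSpace.Completion p.Carrier))

instance : NormedAlgebra ℂ p.Completion :=
  { (inferInstance : Algebra ℂ p.Completion) with
    norm_smul_le := fun c x =>
      norm_smul_le (α := ℂ) (β := UniformSpace.Completion p.Carrier) c x }

/-- The canonical map from the *-algebra to its completion. -/
def coe (x : F) : p.Completion := ((show p.Carrier from x : p.Carrier) :
  UniformSpace.Completion p.Carrier)

theorem induction {P : p.Completion → Prop} (hc : IsClosed {x | P x}) (h : ∀ x, P (p.coe x))
    (x : p.Completion) : P x :=
  UniformSpace.Completion.induction_on (α := p.Carrier) x hc h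

theorem norm_coe (x : F) : ‖p.coe x‖ = p x :=
  UniformSpace.Completion.norm_coe (E := p.Carrier) x

instance : Star p.Completion := ⟨UniformSpace.Completion.map (star : p.Carrier → p.Carrier)⟩

theorem coe_star (x : F) : p.coe (star x) = star (p.coe x) :=
  (UniformSpace.Completion.map_coe (α := p.Carrier) (β := p.Carrier)
    (starNormedAddGroupHom (E := p.Carrier)).uniformContinuous x).symm

theorem coe_add (x y : F) : p.coe (x + y) = p.coe x + p.coe y :=
  UniformSpace.Completion.coe_add (α := p.Carrier) x y

theorem coe_mul (x y : F) : p.coe (x * y) = p.coe x * p.coe y :=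
  UniformSpace.Completion.coe_mul (α := p.Carrier) x y

theorem coe_smul (c : ℂ) (x : F) : p.coe (c • x) = c • p.coe x :=
  UniformSpace.Completion.coe_smul (X := p.Carrier) c x

theorem coe_one : p.coe (1 : F) = 1 := UniformSpace.Completion.coe_one (α := p.Carrier)

theorem continuous_star' : Continuous (star : p.Completion → p.Completion) :=
  UniformSpace.Completion.continuous_map (α := p.Carrier) (β := p.Carrier)

instance : StarRing p.Completion where
  star_involutive x := by
    have := p.continuous_star'
    refine p.induction (P := fun x => star (star x) = x) (isClosed_eq (by fun_prop) (by fun_prop))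
      (fun a => ?_) x
    rw [← coe_star, ← coe_star, star_star]
  star_mul x y := by
    have := p.continuous_star'
    refine p.induction (P := fun x => ∀ y, star (x * y) = star y * star x) ?_ ?_ x y
    · simp only [Set.ofPred_forall]
      exact isClosed_iInter fun y => isClosed_eq (by fun_prop) (by fun_prop)
    · refine fun a y => p.induction (P := fun y => star (p.coe a * y) = star y * star (p.coe a))
        (isClosed_eq (by fun_prop) (by fun_prop)) (fun b => ?_) y
      rw [← coe_mul, ← coe_star, star_mul, coe_mul, coe_star, coe_star]
  star_add x y := by
    have := p.continuous_star'
    refine p.induction (P := fun x => ∀ y, star (x + y) = star x + star y) ?_ ?_ x y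
    · simp only [Set.ofPred_forall]
      exact isClosed_iInter fun y => isClosed_eq (by fun_prop) (by fun_prop)
    · refine fun a y => p.induction (P := fun y => star (p.coe a + y) = star (p.coe a) + star y)
        (isClosed_eq (by fun_prop) (by fun_prop)) (fun b => ?_) y
      rw [← coe_add, ← coe_star, star_add, coe_add, coe_star, coe_star]

theorem isClosed_star_smul (c : ℂ) :
    IsClosed {x : p.Completion | star (c • x) = star c • star x} := by
  have h := p.continuous_star'
  have h1 : Continuous (fun x : p.Completion => star (c • x)) := h.comp (continuous_const_smul c)
  have h2 : Continuous (fun x : p.Completion => star c • star x) := h.const_smul (star c)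
  exact isClosed_eq h1 h2

instance [StarModule ℂ F] : StarModule ℂ p.Completion where
  star_smul c x := by
    refine p.induction (P := fun x => star (c • x) = star c • star x)
      (p.isClosed_star_smul c) (fun a => ?_) x
    have h : star (c • a) = star c • star a := star_smul c a
    rw [← p.coe_smul c a, ← p.coe_star, h, p.coe_smul, p.coe_star]

instance : CStarRing p.Completion where
  norm_mul_self_le x := by
    have := p.continuous_star'
    refine p.induction (P := fun x => ‖x‖ * ‖x‖ ≤ ‖star x * x‖)
      (isClosed_le (by fun_prop) (by fun_prop)) (fun a => ?_) x
    rw [← coe_star, ← coe_mul, norm_coe, norm_coe, star_mul_self]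

instance [StarModule ℂ F] : CStarAlgebra p.Completion where

/-- The canonical *-homomorphism from a *-algebra to its C*-completion. -/
def toCompletion : F →⋆ₐ[ℂ] p.Completion where
  toFun := p.coe
  map_one' := p.coe_one
  map_mul' := p.coe_mul
  map_zero' := UniformSpace.Completion.coe_zero (α := p.Carrier)
  map_add' := p.coe_add
  commutes' c := by
    rw [Algebra.algebraMap_eq_smul_one, Algebra.algebraMap_eq_smul_one, coe_smul, coe_one]
  map_star' := p.coe_star

variable [StarModule ℂ F]

/-- *-homomorphisms into C*-algebras that are dominated by `p` extend to the completion. -/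
def extend {D : Type v} [CStarAlgebra D] (φ : F →⋆ₐ[ℂ] D) (h : ∀ x, ‖φ x‖ ≤ p x) :
    p.Completion →⋆ₐ[ℂ] D :=
  let φ' : p.Carrier →+* D := φ.toAlgHom.toRingHom
  have hφ : Continuous φ' := by
    refine AddMonoidHomClass.continuous_of_bound φ' 1 fun x => ?_
    rw [one_mul]; exact h x
  let ψ : UniformSpace.Completion p.Carrier → D := UniformSpace.Completion.extension φ'
  have hψ : ∀ x : F, ψ (p.coe x) = φ x :=
    fun x => UniformSpace.Completion.extension_coe (α := p.Carrier)
      (uniformContinuous_addMonoidHom_of_continuous (f := (φ' : p.Carrier →+ D)) hφ) x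
  have hc : Continuous (fun x : p.Completion => ψ x) := UniformSpace.Completion.continuous_extension
  have hs := p.continuous_star'
  { toFun := ψ
    map_one' := by rw [← p.coe_one]; exact (hψ 1).trans (map_one φ)
    map_zero' := (hψ 0).trans (map_zero φ)
    map_mul' := fun x y => by
      refine p.induction (P := fun x => ∀ y : p.Completion, ψ (x * y) = ψ x * ψ y) ?_ ?_ x y
      · simp only [Set.ofPred_forall]
        exact isClosed_iInter fun y => isClosed_eq (by fun_prop) (by fun_prop)
      · refine fun a y => p.induction
          (P := fun y => ψ (p.coe a * y : p.Completion) = ψ (p.coe a) * ψ y)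
          (isClosed_eq (by fun_prop) (by fun_prop)) (fun b => ?_) y
        rw [← coe_mul, hψ, hψ, hψ, map_mul]
    map_add' := fun x y => by
      refine p.induction (P := fun x => ∀ y : p.Completion, ψ (x + y : p.Completion) = ψ x + ψ y)
        ?_ ?_ x y
      · simp only [Set.ofPred_forall]
        exact isClosed_iInter fun y => isClosed_eq (by fun_prop) (by fun_prop)
      · refine fun a y => p.induction
          (P := fun y => ψ (p.coe a + y : p.Completion) = ψ (p.coe a) + ψ y)
          (isClosed_eq (by fun_prop) (by fun_prop)) (fun b => ?_) y
        rw [← coe_add, hψ, hψ, hψ, map_add]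
    commutes' := fun c => by
      rw [Algebra.algebraMap_eq_smul_one, Algebra.algebraMap_eq_smul_one, ← coe_one, ← coe_smul]
      exact (hψ _).trans (by rw [map_smul, map_one])
    map_star' := fun x => by
      refine p.induction (P := fun x : p.Completion => ψ (star x : p.Completion) = star (ψ x))
        (isClosed_eq (by fun_prop) (by fun_prop)) (fun a => ?_) x
      rw [← coe_star, hψ, hψ, map_star] }

theorem extend_coe {D : Type v} [CStarAlgebra D] (φ : F →⋆ₐ[ℂ] D) (h : ∀ x, ‖φ x‖ ≤ p x)
    (x : F) : p.extend φ h (p.toCompletion x) = φ x :=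
  let φ' : p.Carrier →+* D := φ.toAlgHom.toRingHom
  have hφ : Continuous φ' := by
    refine AddMonoidHomClass.continuous_of_bound φ' 1 fun x => ?_
    rw [one_mul]; exact h x
  UniformSpace.Completion.extension_coe (α := p.Carrier)
    (uniformContinuous_addMonoidHom_of_continuous (f := (φ' : p.Carrier →+ D)) hφ) x

end CStarSeminorm

end Completion


/-! ### Universal C*-algebras -/

section Universal

variable {F : Type u} [Ring F] [StarRing F] [Algebra ℂ F]

/-- The C*-seminorms on `F` that vanish on a set `R` of relations. -/
def RelSeminorm (R : Set F) : Type u := {p : CStarSeminorm F // ∀ r ∈ R, p r = 0}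

instance (R : Set F) : Nonempty (RelSeminorm R) :=
  ⟨⟨{ toSeminorm := 0, mul_le' := fun _ _ => (mul_zero (0 : ℝ)).ge,
      star_mul_self' := fun _ => (mul_zero (0 : ℝ)).symm }, fun _ _ => rfl⟩⟩

/-- The C*-seminorms on `F` that vanish on `R` are pointwise bounded, i.e. the universal
C*-algebra on `F` with relations `r = 0`, `r ∈ R`, exists. -/
class IsCStarBounded (R : Set F) : Prop where
  bddAbove : ∀ x : F, BddAbove (Set.range fun p : RelSeminorm R => p.1 x)

variable (R : Set F) [IsCStarBounded R]

theorem RelSeminorm.le_iSup (p : RelSeminorm R) (x : F) :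
    p.1 x ≤ ⨆ q : RelSeminorm R, q.1 x :=
  _root_.le_ciSup (IsCStarBounded.bddAbove x) p

/-- The greatest C*-seminorm on `F` that vanishes on `R`. -/
def maxSeminorm : CStarSeminorm F where
  toFun x := ⨆ p : RelSeminorm R, p.1 x
  map_zero' := by simp
  add_le' x y := ciSup_le fun p => (map_add_le_add p.1.toSeminorm x y).trans
    (add_le_add (p.le_iSup R x) (p.le_iSup R y))
  neg' x := by simp
  smul' c x := by
    simp_rw [map_smul_eq_mul]
    exact (Real.mul_iSup_of_nonneg (norm_nonneg c) _).symm
  mul_le' x y := ciSup_le fun p => (p.1.mul_le x y).trans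
    (mul_le_mul (p.le_iSup R x) (p.le_iSup R y) (p.1.nonneg y)
      ((p.1.nonneg x).trans (p.le_iSup R x)))
  star_mul_self' x := by
    have h0 : ∀ y : F, 0 ≤ ⨆ q : RelSeminorm R, q.1 y :=
      fun y => Real.iSup_nonneg fun p => p.1.nonneg y
    refine le_antisymm (ciSup_le fun p => ?_) ?_
    · rw [p.1.star_mul_self]
      exact mul_self_le_mul_self (p.1.nonneg x) (p.le_iSup R x)
    · have h : (⨆ q : RelSeminorm R, q.1 x) ≤ √(⨆ q : RelSeminorm R, q.1 (star x * x)) := by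
        refine ciSup_le fun p => Real.le_sqrt_of_sq_le ?_
        rw [sq, ← p.1.star_mul_self]
        exact p.le_iSup R _
      calc _ ≤ √(⨆ q : RelSeminorm R, q.1 (star x * x)) *
            √(⨆ q : RelSeminorm R, q.1 (star x * x)) := mul_self_le_mul_self (h0 x) h
        _ = _ := Real.mul_self_sqrt (h0 _)

/-- The universal C*-algebra generated by the *-algebra `F` with the relations `r = 0` for
`r ∈ R`: the Hausdorff completion of `F` with respect to the greatest C*-seminorm that vanishes
on `R`. -/
def UnivCStar : Type u := (maxSeminorm R).Completion

variable [StarModule ℂ F]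

instance : CStarAlgebra (UnivCStar R) := inferInstanceAs (CStarAlgebra (maxSeminorm R).Completion)

namespace UnivCStar

/-- The canonical map from `F` to the universal C*-algebra. -/
def of : F →⋆ₐ[ℂ] UnivCStar R := (maxSeminorm R).toCompletion

variable {R}

theorem of_eq_zero {r : F} (hr : r ∈ R) : of R r = 0 := by
  have h : ‖of R r‖ = maxSeminorm R r := (maxSeminorm R).norm_coe r
  have h' : maxSeminorm R r = 0 := by
    change (⨆ p : RelSeminorm R, p.1 r) = 0
    simp [fun p : RelSeminorm R => p.2 r hr]
  rw [← norm_eq_zero, h, h']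

variable {D : Type v} [CStarAlgebra D]

/-- The universal property of the universal C*-algebra. -/
def lift (φ : F →⋆ₐ[ℂ] D) (h : ∀ r ∈ R, φ r = 0) : UnivCStar R →⋆ₐ[ℂ] D :=
  (maxSeminorm R).extend φ fun x =>
    RelSeminorm.le_iSup R ⟨.ofHom φ, fun r hr => (congrArg norm (h r hr)).trans norm_zero⟩ x

@[simp]
theorem lift_of (φ : F →⋆ₐ[ℂ] D) (h : ∀ r ∈ R, φ r = 0) (x : F) : lift φ h (of R x) = φ x :=
  (maxSeminorm R).extend_coe φ _ x

theorem induction {P : UnivCStar R → Prop} (hc : IsClosed {x | P x}) (h : ∀ x, P (of R x))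
    (x : UnivCStar R) : P x :=
  (maxSeminorm R).induction hc h x

end UnivCStar

end Universal

theorem continuous_hom {A : Type u} {B : Type v} [CStarAlgebra A] [CStarAlgebra B]
    (f : A →⋆ₐ[ℂ] B) : Continuous f :=
  AddMonoidHomClass.continuous_of_bound f 1 fun x => by
    rw [one_mul]; exact NonUnitalStarAlgHom.norm_apply_le f x

theorem UnivCStar.hom_ext {F : Type u} [Ring F] [StarRing F] [Algebra ℂ F] [StarModule ℂ F]
    {R : Set F} [IsCStarBounded R] {D : Type v} [CStarAlgebra D] {f g : UnivCStar R →⋆ₐ[ℂ] D}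
    (h : ∀ x, f (of R x) = g (of R x)) : f = g := by
  ext x
  exact induction (isClosed_eq (continuous_hom f) (continuous_hom g)) h x

/-! ### The maximal tensor product of C*-algebras -/

section MaxTensor

variable {A : Type u} {B : Type v} {C : Type w} [CStarAlgebra A] [CStarAlgebra B] [CStarAlgebra C]

/-- The *-homomorphism `a ↦ a ⊗ 1` into the algebraic tensor product. -/
def tmulLeft : A →⋆ₐ[ℂ] A ⊗[ℂ] B :=
  { (Algebra.TensorProduct.includeLeft : A →ₐ[ℂ] A ⊗[ℂ] B) with
    map_star' := fun a => by simp }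

/-- The *-homomorphism `b ↦ 1 ⊗ b` into the algebraic tensor product. -/
def tmulRight : B →⋆ₐ[ℂ] A ⊗[ℂ] B :=
  { (Algebra.TensorProduct.includeRight : B →ₐ[ℂ] A ⊗[ℂ] B) with
    map_star' := fun a => by simp }

theorem tmulLeft_mul_tmulRight (a : A) (b : B) :
    (tmulLeft a * tmulRight b : A ⊗[ℂ] B) = a ⊗ₜ[ℂ] b := by
  change (a ⊗ₜ[ℂ] (1 : B)) * ((1 : A) ⊗ₜ[ℂ] b) = _
  simp

instance : IsCStarBounded (∅ : Set (A ⊗[ℂ] B)) where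
  bddAbove x := by
    induction x with
    | zero => exact ⟨0, by rintro _ ⟨p, rfl⟩; simp⟩
    | tmul a b =>
      refine ⟨‖a‖ * ‖b‖, ?_⟩
      rintro _ ⟨p, rfl⟩
      have h1 := NonUnitalStarAlgHom.norm_apply_le (p.1.toCompletion.comp (tmulLeft (B := B))) a
      have h2 := NonUnitalStarAlgHom.norm_apply_le (p.1.toCompletion.comp (tmulRight (A := A))) b
      have h3 : p.1 (tmulLeft (B := B) a) ≤ ‖a‖ := (p.1.norm_coe _).symm.le.trans h1
      have h4 : p.1 (tmulRight (A := A) b) ≤ ‖b‖ := (p.1.norm_coe _).symm.le.trans h2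
      rw [← tmulLeft_mul_tmulRight]
      exact (p.1.mul_le _ _).trans (mul_le_mul h3 h4 (p.1.nonneg _) (norm_nonneg a))
    | add x y hx hy =>
      obtain ⟨c, hc⟩ := hx
      obtain ⟨d, hd⟩ := hy
      refine ⟨c + d, ?_⟩
      rintro _ ⟨p, rfl⟩
      exact (map_add_le_add p.1.toSeminorm x y).trans (add_le_add (hc ⟨p, rfl⟩) (hd ⟨p, rfl⟩))

variable (A B) in
/-- The (maximal) C*-tensor product: the completion of the algebraic tensor product with respect
to its greatest C*-seminorm. -/
def MaxTensor : Type (max u v) := UnivCStar (∅ : Set (A ⊗[ℂ] B))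

instance : CStarAlgebra (MaxTensor A B) :=
  inferInstanceAs (CStarAlgebra (UnivCStar (∅ : Set (A ⊗[ℂ] B))))

namespace MaxTensor

/-- The canonical map from the algebraic to the maximal tensor product. -/
def of : A ⊗[ℂ] B →⋆ₐ[ℂ] MaxTensor A B := UnivCStar.of ∅

/-- `a ↦ a ⊗ 1`. -/
def inl : A →⋆ₐ[ℂ] MaxTensor A B := of.comp tmulLeft

/-- `b ↦ 1 ⊗ b`. -/
def inr : B →⋆ₐ[ℂ] MaxTensor A B := of.comp tmulRight

theorem of_tmul (a : A) (b : B) : of (a ⊗ₜ[ℂ] b) = inl a * inr b := by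
  rw [← tmulLeft_mul_tmulRight, map_mul]; rfl

theorem commute_inl_inr (a : A) (b : B) :
    Commute (inl a : MaxTensor A B) (inr b) := by
  have h : Commute (tmulLeft a : A ⊗[ℂ] B) (tmulRight b) := by
    change (a ⊗ₜ[ℂ] (1 : B)) * ((1 : A) ⊗ₜ[ℂ] b) = ((1 : A) ⊗ₜ[ℂ] b) * (a ⊗ₜ[ℂ] (1 : B))
    simp
  exact h.map (of : A ⊗[ℂ] B →⋆ₐ[ℂ] MaxTensor A B)

theorem induction {P : MaxTensor A B → Prop} (hc : IsClosed {x | P x})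
    (hmul : ∀ a b, P (inl a * inr b)) (hadd : ∀ x y, P x → P y → P (x + y))
    (x : MaxTensor A B) : P x := by
  have key : ∀ t : A ⊗[ℂ] B, P (of t) := fun t => by
    induction t with
    | zero => simpa using hmul 0 0
    | tmul a b => exact (of_tmul a b).symm ▸ hmul a b
    | add x y hx hy => rw [map_add]; exact hadd _ _ hx hy
  exact UnivCStar.induction hc key x

variable {D : Type*} [CStarAlgebra D]

theorem hom_ext {f g : MaxTensor A B →⋆ₐ[ℂ] D} (hl : ∀ a, f (inl a) = g (inl a))
    (hr : ∀ b, f (inr b) = g (inr b)) : f = g := by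
  ext x
  refine induction (isClosed_eq (continuous_hom f) (continuous_hom g)) (fun a b => ?_)
    (fun x y hx hy => ?_) x
  · rw [map_mul, map_mul, hl, hr]
  · rw [map_add, map_add, hx, hy]

/-- The universal property of the maximal tensor product: a pair of *-homomorphisms with
commuting ranges factors through it. -/
def lift (f : A →⋆ₐ[ℂ] D) (g : B →⋆ₐ[ℂ] D) (h : ∀ a b, Commute (f a) (g b)) :
    MaxTensor A B →⋆ₐ[ℂ] D :=
  UnivCStar.lift
    { Algebra.TensorProduct.lift f.toAlgHom g.toAlgHom h with
      map_star' := fun x => by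
        change Algebra.TensorProduct.lift f.toAlgHom g.toAlgHom h (star x) =
          star (Algebra.TensorProduct.lift f.toAlgHom g.toAlgHom h x)
        induction x with
        | zero => simp
        | tmul a b =>
          rw [TensorProduct.star_tmul, Algebra.TensorProduct.lift_tmul,
            Algebra.TensorProduct.lift_tmul]
          change f (star a) * g (star b) = star (f a * g b)
          rw [star_mul, ← map_star, ← map_star, (h (star a) (star b)).eq]
        | add x y hx hy => rw [star_add, map_add, map_add, star_add, hx, hy] }
    (fun _ hr => hr.elim)

section

variable (f : A →⋆ₐ[ℂ] D) (g : B →⋆ₐ[ℂ] D) (h : ∀ a b, Commute (f a) (g b))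

@[simp]
theorem lift_of_tmul (a : A) (b : B) : lift f g h (of (a ⊗ₜ[ℂ] b)) = f a * g b :=
  (UnivCStar.lift_of _ _ _).trans (Algebra.TensorProduct.lift_tmul _ _ h _ _)

@[simp]
theorem lift_inl (a : A) : lift f g h (inl a) = f a :=
  (lift_of_tmul f g h a 1).trans (by rw [map_one, mul_one])

@[simp]
theorem lift_inr (b : B) : lift f g h (inr b) = g b :=
  (lift_of_tmul f g h 1 b).trans (by rw [map_one, one_mul])

end

/-- Two *-homomorphisms on tensor products have commuting ranges as soon as they commute on
the tensor factors. -/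
theorem commute_hom {A' B' : Type*} [CStarAlgebra A'] [CStarAlgebra B']
    (f : MaxTensor A B →⋆ₐ[ℂ] D) (g : MaxTensor A' B' →⋆ₐ[ℂ] D)
    (h1 : ∀ a a', Commute (f (inl a)) (g (inl a'))) (h2 : ∀ a b', Commute (f (inl a)) (g (inr b')))
    (h3 : ∀ b a', Commute (f (inr b)) (g (inl a'))) (h4 : ∀ b b', Commute (f (inr b)) (g (inr b')))
    (x : MaxTensor A B) (y : MaxTensor A' B') : Commute (f x) (g y) := by
  have hf := continuous_hom f
  have hg := continuous_hom g
  refine induction (P := fun x => Commute (f x) (g y))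
    (isClosed_eq (by fun_prop) (by fun_prop)) (fun a b => ?_) (fun x y hx hy => ?_) x
  · refine induction (P := fun y => Commute (f (inl a * inr b)) (g y))
      (isClosed_eq (by fun_prop) (by fun_prop)) (fun a' b' => ?_) (fun x y hx hy => ?_) y
    · rw [map_mul, map_mul]
      exact ((h1 a a').mul_left (h3 b a')).mul_right ((h2 a b').mul_left (h4 b b'))
    · rw [map_add]; exact hx.add_right hy
  · rw [map_add]; exact hx.add_left hy

/-- The tensor product of two *-homomorphisms. -/
def map {A' B' : Type*} [CStarAlgebra A'] [CStarAlgebra B'] (f : A →⋆ₐ[ℂ] A') (g : B →⋆ₐ[ℂ] B') :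
    MaxTensor A B →⋆ₐ[ℂ] MaxTensor A' B' :=
  lift (inl.comp f) (inr.comp g) fun _ _ => commute_inl_inr _ _

section

variable {A' B' : Type*} [CStarAlgebra A'] [CStarAlgebra B'] (f : A →⋆ₐ[ℂ] A') (g : B →⋆ₐ[ℂ] B')

@[simp]
theorem map_inl (a : A) : map f g (inl a) = inl (f a) := lift_inl _ _ _ _

@[simp]
theorem map_inr (b : B) : map f g (inr b) = inr (g b) := lift_inr _ _ _ _

end

variable (A B C) in
/-- The associativity map `(A ⊗ B) ⊗ C → A ⊗ (B ⊗ C)`. -/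
def assoc : MaxTensor (MaxTensor A B) C →⋆ₐ[ℂ] MaxTensor A (MaxTensor B C) :=
  lift (map (.id ℂ A) inl) (inr.comp inr) fun x c => by
    refine induction (P := fun x => Commute (map (.id ℂ A) inl x) (inr.comp inr c)) ?_ ?_ ?_ x
    · have := continuous_hom (map (.id ℂ A) (inl : B →⋆ₐ[ℂ] MaxTensor B C))
      exact isClosed_eq (by fun_prop) (by fun_prop)
    · intro a b
      rw [map_mul, map_inl, map_inr]
      exact (commute_inl_inr _ _).mul_left ((commute_inl_inr b c).map inr)
    · intro x y hx hy
      rw [map_add]; exact hx.add_left hy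

@[simp]
theorem assoc_inl_inl (a : A) : assoc A B C (inl (inl a)) = inl a :=
  (lift_inl _ _ _ _).trans (map_inl _ _ _)

@[simp]
theorem assoc_inl_inr (b : B) : assoc A B C (inl (inr b)) = inr (inl b) :=
  (lift_inl _ _ _ _).trans (map_inr _ _ _)

@[simp]
theorem assoc_inr (c : C) : assoc A B C (inr c) = inr (inr c) := lift_inr _ _ _ _

end MaxTensor

end MaxTensor

/-! ### Hopf C*-algebras -/

section Hopf

/-- A *-homomorphism, seen as a *-homomorphism of the opposite algebras. -/
def opHom {A : Type u} {B : Type v} [CStarAlgebra A] [CStarAlgebra B] (f : A →⋆ₐ[ℂ] B) :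
    Aᵐᵒᵖ →⋆ₐ[ℂ] Bᵐᵒᵖ where
  toFun x := MulOpposite.op (f x.unop)
  map_one' := by simp
  map_mul' x y := by simp
  map_zero' := by simp
  map_add' x y := by simp
  commutes' c := by simp [MulOpposite.algebraMap_apply, AlgHomClass.commutes]
  map_star' x := by simp [map_star]

variable {A : Type u} [CStarAlgebra A]

/-- The map `x ⊗ y ↦ S(x) y` on the algebraic tensor product. -/
def antipodeMulLeft (S : A →⋆ₐ[ℂ] Aᵐᵒᵖ) : A ⊗[ℂ] A →ₗ[ℂ] A :=
  LinearMap.mul' ℂ A ∘ₗ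
    TensorProduct.map ((MulOpposite.opLinearEquiv ℂ).symm.toLinearMap ∘ₗ S.toAlgHom.toLinearMap)
      LinearMap.id

/-- The map `x ⊗ y ↦ x S(y)` on the algebraic tensor product. -/
def antipodeMulRight (S : A →⋆ₐ[ℂ] Aᵐᵒᵖ) : A ⊗[ℂ] A →ₗ[ℂ] A :=
  LinearMap.mul' ℂ A ∘ₗ
    TensorProduct.map LinearMap.id
      ((MulOpposite.opLinearEquiv ℂ).symm.toLinearMap ∘ₗ S.toAlgHom.toLinearMap)

@[simp]
theorem antipodeMulLeft_tmul (S : A →⋆ₐ[ℂ] Aᵐᵒᵖ) (x y : A) :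
    antipodeMulLeft S (x ⊗ₜ y) = (S x).unop * y := rfl

@[simp]
theorem antipodeMulRight_tmul (S : A →⋆ₐ[ℂ] Aᵐᵒᵖ) (x y : A) :
    antipodeMulRight S (x ⊗ₜ y) = x * (S y).unop := rfl

/-- The algebraic tensor square of a *-subalgebra `𝒜` of `A`, as a *-subalgebra of the algebraic
tensor square of `A`. -/
def tensorSquare (𝒜 : StarSubalgebra ℂ A) : StarSubalgebra ℂ (A ⊗[ℂ] A) :=
  StarAlgebra.adjoin ℂ {t | ∃ x ∈ 𝒜, ∃ y ∈ 𝒜, t = x ⊗ₜ y}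

/-- The antipode axiom at `a`: one has `Δ(a) = ∑ xᵢ ⊗ yᵢ`, a finite sum with `xᵢ, yᵢ ∈ 𝒜`, and
`∑ S(xᵢ) yᵢ = ε(a) 1 = ∑ xᵢ S(yᵢ)`. -/
def AntipodeAxiomAt (Δ : A →⋆ₐ[ℂ] MaxTensor A A) (ε : A →⋆ₐ[ℂ] ℂ) (S : A →⋆ₐ[ℂ] Aᵐᵒᵖ)
    (𝒜 : StarSubalgebra ℂ A) (a : A) : Prop :=
  ∃ t ∈ tensorSquare 𝒜, Δ a = MaxTensor.of t ∧
    antipodeMulLeft S t = algebraMap ℂ A (ε a) ∧ antipodeMulRight S t = algebraMap ℂ A (ε a)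

/-- The map `ε ⊗ id : A ⊗ B → ℂ ⊗ B = B`. -/
def MaxTensor.sliceLeft {A : Type u} {B : Type v} [CStarAlgebra A] [CStarAlgebra B]
    (ε : A →⋆ₐ[ℂ] ℂ) : MaxTensor A B →⋆ₐ[ℂ] B :=
  lift ((StarAlgHom.ofId ℂ B).comp ε) (.id ℂ B) fun x y => Algebra.commutes (ε x) y

/-- The map `id ⊗ ε : A ⊗ B → A ⊗ ℂ = A`. -/
def MaxTensor.sliceRight {A : Type u} {B : Type v} [CStarAlgebra A] [CStarAlgebra B]
    (ε : B →⋆ₐ[ℂ] ℂ) : MaxTensor A B →⋆ₐ[ℂ] A :=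
  lift (.id ℂ A) ((StarAlgHom.ofId ℂ A).comp ε) fun x y => (Algebra.commutes (ε y) x).symm

section

variable {A : Type u} {B : Type v} [CStarAlgebra A] [CStarAlgebra B]

@[simp]
theorem MaxTensor.sliceLeft_inl (ε : A →⋆ₐ[ℂ] ℂ) (a : A) :
    sliceLeft ε (inl a : MaxTensor A B) = algebraMap ℂ B (ε a) := lift_inl _ _ _ _

@[simp]
theorem MaxTensor.sliceLeft_inr (ε : A →⋆ₐ[ℂ] ℂ) (b : B) :
    sliceLeft ε (inr b : MaxTensor A B) = b := lift_inr _ _ _ _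

@[simp]
theorem MaxTensor.sliceRight_inl (ε : B →⋆ₐ[ℂ] ℂ) (a : A) :
    sliceRight ε (inl a : MaxTensor A B) = a := lift_inl _ _ _ _

@[simp]
theorem MaxTensor.sliceRight_inr (ε : B →⋆ₐ[ℂ] ℂ) (b : B) :
    sliceRight ε (inr b : MaxTensor A B) = algebraMap ℂ A (ε b) := lift_inr _ _ _ _

end

/-- A Hopf C*-algebra structure on a unital C*-algebra `A`: a comultiplication `Δ`, a counit `ε`
and an antipode `S`, all defined on the whole of `A`, with `S² = id`. The antipode axiom
makes sense on a dense *-subalgebra `𝒜` whose image under `Δ` lies in the algebraic tensor square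
of `𝒜`. -/
class HopfCStarAlgebra (A : Type u) [CStarAlgebra A] where
  comul : A →⋆ₐ[ℂ] MaxTensor A A
  counit : A →⋆ₐ[ℂ] ℂ
  antipode : A →⋆ₐ[ℂ] Aᵐᵒᵖ
  coassoc : ∀ a, MaxTensor.assoc A A A (MaxTensor.map comul (.id ℂ A) (comul a)) =
    MaxTensor.map (.id ℂ A) comul (comul a)
  counit_left : ∀ a, MaxTensor.sliceLeft counit (comul a) = a
  counit_right : ∀ a, MaxTensor.sliceRight counit (comul a) = a
  antipode_antipode : ∀ a, (antipode (antipode a).unop).unop = a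
  antipode_axiom : ∃ 𝒜 : StarSubalgebra ℂ A, Dense (𝒜 : Set A) ∧
    ∀ a ∈ 𝒜, AntipodeAxiomAt comul counit antipode 𝒜 a

/-- `A` and `B` are isomorphic as Hopf C*-algebras: some *-isomorphism intertwines the
comultiplications, the counits and the antipodes. -/
def HopfIsomorphic (A : Type u) (B : Type v) [CStarAlgebra A] [HopfCStarAlgebra A]
    [CStarAlgebra B] [HopfCStarAlgebra B] : Prop :=
  ∃ e : A ≃⋆ₐ[ℂ] B,
    (∀ a, HopfCStarAlgebra.comul (e a) =
      MaxTensor.map (e : A →⋆ₐ[ℂ] B) (e : A →⋆ₐ[ℂ] B) (HopfCStarAlgebra.comul a)) ∧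
    (∀ a, HopfCStarAlgebra.counit (e a) = HopfCStarAlgebra.counit a) ∧
    (∀ a, (HopfCStarAlgebra.antipode (e a)).unop = e (HopfCStarAlgebra.antipode a).unop)

theorem antipodeMulLeft_mul (S : A →⋆ₐ[ℂ] Aᵐᵒᵖ) {t : A ⊗[ℂ] A} {c : ℂ}
    (ht : antipodeMulLeft S t = algebraMap ℂ A c) (s : A ⊗[ℂ] A) :
    antipodeMulLeft S (t * s) = algebraMap ℂ A c * antipodeMulLeft S s := by
  induction s with
  | zero => simp
  | tmul x y =>
    have h : ∀ t : A ⊗[ℂ] A, antipodeMulLeft S (t * x ⊗ₜ y) =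
        (S x).unop * antipodeMulLeft S t * y := by
      intro t
      induction t with
      | zero => simp
      | tmul a b => simp [map_mul, mul_assoc]
      | add t s ht hs => simp only [add_mul, map_add, ht, hs, mul_add]
    rw [h, ht, ← Algebra.commutes, antipodeMulLeft_tmul, mul_assoc]
  | add s s' hs hs' => rw [mul_add, map_add, map_add, hs, hs', mul_add]

theorem antipodeMulRight_mul (S : A →⋆ₐ[ℂ] Aᵐᵒᵖ) {s : A ⊗[ℂ] A} {c : ℂ}
    (hs : antipodeMulRight S s = algebraMap ℂ A c) (t : A ⊗[ℂ] A) :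
    antipodeMulRight S (t * s) = antipodeMulRight S t * algebraMap ℂ A c := by
  induction t with
  | zero => simp
  | tmul x y =>
    have h : ∀ t : A ⊗[ℂ] A, antipodeMulRight S (x ⊗ₜ y * t) =
        x * antipodeMulRight S t * (S y).unop := by
      intro t
      induction t with
      | zero => simp
      | tmul a b => simp [map_mul, mul_assoc]
      | add t s ht hs => simp only [mul_add, map_add, ht, hs, add_mul]
    rw [h, hs, antipodeMulRight_tmul, mul_assoc, Algebra.commutes, mul_assoc]
  | add s s' hs hs' => rw [add_mul, map_add, map_add, hs, hs', add_mul]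

theorem antipodeMulLeft_star (S : A →⋆ₐ[ℂ] Aᵐᵒᵖ) (hS : ∀ a, (S (S a).unop).unop = a)
    (t : A ⊗[ℂ] A) : antipodeMulLeft S (star t) = star (S (antipodeMulRight S t)).unop := by
  induction t with
  | zero => simp
  | tmul x y => simp [map_star, map_mul, hS]
  | add s t hs ht => simp only [star_add, map_add, hs, ht, MulOpposite.unop_add]

theorem antipodeMulRight_star (S : A →⋆ₐ[ℂ] Aᵐᵒᵖ) (hS : ∀ a, (S (S a).unop).unop = a)
    (t : A ⊗[ℂ] A) : antipodeMulRight S (star t) = star (S (antipodeMulLeft S t)).unop := by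
  induction t with
  | zero => simp
  | tmul x y => simp [map_star, map_mul, hS]
  | add s t hs ht => simp only [star_add, map_add, hs, ht, MulOpposite.unop_add]

theorem tmul_mem_tensorSquare {𝒜 : StarSubalgebra ℂ A} {x y : A} (hx : x ∈ 𝒜) (hy : y ∈ 𝒜) :
    x ⊗ₜ[ℂ] y ∈ tensorSquare 𝒜 :=
  StarAlgebra.subset_adjoin ℂ _ ⟨x, hx, y, hy, rfl⟩

/-- It suffices to check the antipode axiom on generators. -/
theorem antipodeAxiomAt_adjoin (Δ : A →⋆ₐ[ℂ] MaxTensor A A) (ε : A →⋆ₐ[ℂ] ℂ) (S : A →⋆ₐ[ℂ] Aᵐᵒᵖ)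
    (hS : ∀ a, (S (S a).unop).unop = a) (G : Set A)
    (hG : ∀ a ∈ G, AntipodeAxiomAt Δ ε S (StarAlgebra.adjoin ℂ G) a) :
    ∀ a ∈ StarAlgebra.adjoin ℂ G, AntipodeAxiomAt Δ ε S (StarAlgebra.adjoin ℂ G) a := by
  intro a ha
  induction ha using StarAlgebra.adjoin_induction with
  | mem x hx => exact hG x hx
  | algebraMap c =>
    refine ⟨algebraMap ℂ _ c, algebraMap_mem _ c, ?_, ?_, ?_⟩
    · exact (AlgHomClass.commutes Δ c).trans (AlgHomClass.commutes MaxTensor.of c).symm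
    · rw [Algebra.TensorProduct.algebraMap_apply, antipodeMulLeft_tmul]
      simp [AlgHomClass.commutes]
    · rw [Algebra.TensorProduct.algebraMap_apply, antipodeMulRight_tmul]
      simp [AlgHomClass.commutes]
  | add x y _ _ hx hy =>
    obtain ⟨s, hs, hs1, hs2, hs3⟩ := hx
    obtain ⟨t, ht, ht1, ht2, ht3⟩ := hy
    exact ⟨s + t, add_mem hs ht, by simp [hs1, ht1], by simp [hs2, ht2], by simp [hs3, ht3]⟩
  | mul x y _ _ hx hy =>
    obtain ⟨s, hs, hs1, hs2, hs3⟩ := hx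
    obtain ⟨t, ht, ht1, ht2, ht3⟩ := hy
    refine ⟨s * t, mul_mem hs ht, by simp [hs1, ht1], ?_, ?_⟩
    · rw [antipodeMulLeft_mul S hs2, ht2, map_mul, map_mul]
    · rw [antipodeMulRight_mul S ht3, hs3, map_mul, map_mul]
  | star x _ hx =>
    obtain ⟨s, hs, hs1, hs2, hs3⟩ := hx
    refine ⟨star s, star_mem hs, by simp [hs1, map_star], ?_, ?_⟩
    · rw [antipodeMulLeft_star S hS, hs3, AlgHomClass.commutes, map_star]
      simpa [MulOpposite.algebraMap_apply] using (algebraMap_star_comm (ε x)).symm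
    · rw [antipodeMulRight_star S hS, hs2, AlgHomClass.commutes, map_star]
      simpa [MulOpposite.algebraMap_apply] using (algebraMap_star_comm (ε x)).symm

end Hopf

/-! ### The tensor product of Hopf C*-algebras -/

section HopfTensor

open HopfCStarAlgebra

variable {A : Type u} {B : Type v} [CStarAlgebra A] [CStarAlgebra B]

theorem isClosed_eqOn_hom {D : Type w} [CStarAlgebra D] (f g : A →⋆ₐ[ℂ] D) :
    IsClosed {x | f x = g x} :=
  isClosed_eq (continuous_hom f) (continuous_hom g)

theorem tensorSquare_map (f : A →⋆ₐ[ℂ] B) {𝒜 : StarSubalgebra ℂ A} {ℬ : StarSubalgebra ℂ B}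
    (h : ∀ a ∈ 𝒜, f a ∈ ℬ) (Δ : B →⋆ₐ[ℂ] MaxTensor B B) (ε : B →⋆ₐ[ℂ] ℂ) (S : B →⋆ₐ[ℂ] Bᵐᵒᵖ)
    (Δ' : A →⋆ₐ[ℂ] MaxTensor A A) (ε' : A →⋆ₐ[ℂ] ℂ) (S' : A →⋆ₐ[ℂ] Aᵐᵒᵖ)
    (hΔ : ∀ a, Δ (f a) = MaxTensor.map f f (Δ' a)) (hε : ∀ a, ε (f a) = ε' a)
    (hS : ∀ a, (S (f a)).unop = f (S' a).unop) {a : A} (ha : AntipodeAxiomAt Δ' ε' S' 𝒜 a) :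
    AntipodeAxiomAt Δ ε S ℬ (f a) := by
  obtain ⟨t, ht, h1, h2, h3⟩ := ha
  let F : A ⊗[ℂ] A →ₐ[ℂ] B ⊗[ℂ] B := Algebra.TensorProduct.map f.toAlgHom f.toAlgHom
  have hFt : ∀ x y, F (x ⊗ₜ y) = f x ⊗ₜ f y := fun x y => rfl
  have hFstar : ∀ t, F (star t) = star (F t) := fun t => by
    induction t with
    | zero => simp
    | tmul x y => simp [hFt, map_star]
    | add s t hs ht => simp only [star_add, map_add, hs, ht]
  have hof : ∀ t, MaxTensor.of (F t) = MaxTensor.map f f (MaxTensor.of t) := fun t => by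
    induction t with
    | zero => simp
    | tmul x y => simp [hFt, MaxTensor.of_tmul]
    | add s t hs ht => simp only [map_add, hs, ht]
  have hL : ∀ t, antipodeMulLeft S (F t) = f (antipodeMulLeft S' t) := fun t => by
    induction t with
    | zero => simp
    | tmul x y => simp [hFt, hS]
    | add s t hs ht => simp only [map_add, hs, ht]
  have hR : ∀ t, antipodeMulRight S (F t) = f (antipodeMulRight S' t) := fun t => by
    induction t with
    | zero => simp
    | tmul x y => simp [hFt, hS]
    | add s t hs ht => simp only [map_add, hs, ht]
  refine ⟨F t, ?_, ?_, ?_, ?_⟩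
  · let F' : A ⊗[ℂ] A →⋆ₐ[ℂ] B ⊗[ℂ] B := { F with map_star' := hFstar }
    have hle : tensorSquare 𝒜 ≤ (tensorSquare ℬ).comap F' := by
      refine StarAlgebra.adjoin_le ?_
      rintro _ ⟨x, hx, y, hy, rfl⟩
      exact tmul_mem_tensorSquare (h x hx) (h y hy)
    exact hle ht
  · rw [hΔ, h1, hof]
  · rw [hL, h2, hε, AlgHomClass.commutes]
  · rw [hR, h3, hε, AlgHomClass.commutes]

namespace MaxTensor

theorem eq_of_inl_inr {D : Type*} [CStarAlgebra D] (f g : MaxTensor A B →⋆ₐ[ℂ] D)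
    (hl : ∀ a, f (inl a) = g (inl a)) (hr : ∀ b, f (inr b) = g (inr b)) (x : MaxTensor A B) :
    f x = g x := DFunLike.congr_fun (hom_ext hl hr) x

variable [HopfCStarAlgebra A] [HopfCStarAlgebra B]

variable (A B) in
/-- The comultiplication `a ⊗ b ↦ ∑ (a₁ ⊗ b₁) ⊗ (a₂ ⊗ b₂)`. -/
def comul' : MaxTensor A B →⋆ₐ[ℂ] MaxTensor (MaxTensor A B) (MaxTensor A B) :=
  lift ((map inl inl).comp comul) ((map inr inr).comp comul) fun a b =>
    commute_hom (map inl inl) (map inr inr)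
      (fun x y => by simpa using (commute_inl_inr x y).map inl)
      (fun x y => by simpa using commute_inl_inr _ _)
      (fun x y => by simpa using (commute_inl_inr _ _).symm)
      (fun x y => by simpa using (commute_inl_inr x y).map inr) (comul a) (comul b)

variable (A B) in
/-- The counit of the tensor product. -/
def counit' : MaxTensor A B →⋆ₐ[ℂ] ℂ := lift counit counit fun _ _ => mul_comm _ _

variable (A B) in
/-- The antipode of the tensor product. -/
def antipode' : MaxTensor A B →⋆ₐ[ℂ] (MaxTensor A B)ᵐᵒᵖ :=
  lift ((opHom inl).comp antipode) ((opHom inr).comp antipode) fun _ _ =>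
    MulOpposite.unop_injective (commute_inl_inr _ _).symm.eq

theorem comul'_inl (a : A) : comul' A B (inl a) = map inl inl (comul a) := lift_inl _ _ _ _

theorem comul'_inr (b : B) : comul' A B (inr b) = map inr inr (comul b) := lift_inr _ _ _ _

theorem counit'_inl (a : A) : counit' A B (inl a) = counit a := lift_inl _ _ _ _

theorem counit'_inr (b : B) : counit' A B (inr b) = counit b := lift_inr _ _ _ _

theorem antipode'_inl (a : A) : (antipode' A B (inl a)).unop = inl (antipode a).unop :=
  congrArg MulOpposite.unop (lift_inl _ _ _ _)

theorem antipode'_inr (b : B) : (antipode' A B (inr b)).unop = inr (antipode b).unop :=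
  congrArg MulOpposite.unop (lift_inr _ _ _ _)

section Transport

variable {A₀ : Type*} [CStarAlgebra A₀] [HopfCStarAlgebra A₀] {E : Type*} [CStarAlgebra E]
  (f : A₀ →⋆ₐ[ℂ] E) (Δ : E →⋆ₐ[ℂ] MaxTensor E E) (ε : E →⋆ₐ[ℂ] ℂ)

theorem coassoc_transport (hΔ : ∀ a, Δ (f a) = map f f (comul a)) (a : A₀) :
    assoc E E E (map Δ (.id ℂ E) (Δ (f a))) = map (.id ℂ E) Δ (Δ (f a)) := by
  have h1 : (assoc E E E).comp ((map Δ (.id ℂ E)).comp (map f f)) =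
      (map f (map f f)).comp ((assoc A₀ A₀ A₀).comp (map comul (.id ℂ A₀))) := by
    have h0 : (assoc E E E).comp (inl.comp (map f f)) =
        (map f (map f f)).comp ((assoc A₀ A₀ A₀).comp inl) := by
      refine hom_ext (fun x => ?_) (fun x => ?_) <;> simp
    refine hom_ext (fun x => ?_) (fun x => ?_)
    · simpa [hΔ] using DFunLike.congr_fun h0 (comul x)
    · simp
  have h2 : (map (.id ℂ E) Δ).comp (map f f) =
      (map f (map f f)).comp (map (.id ℂ A₀) comul) := by
    refine hom_ext (fun x => ?_) (fun x => ?_) <;> simp [hΔ]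
  have h1' := DFunLike.congr_fun h1 (comul a)
  have h2' := DFunLike.congr_fun h2 (comul a)
  simp only [StarAlgHom.comp_apply] at h1' h2'
  rw [hΔ, h1', h2', coassoc]

theorem counit_left_transport (hΔ : ∀ a, Δ (f a) = map f f (comul a))
    (hε : ∀ a, ε (f a) = counit a) (a : A₀) : sliceLeft ε (Δ (f a)) = f a := by
  have h1 : (sliceLeft ε).comp (map f f) = f.comp (sliceLeft counit) := by
    refine hom_ext (fun x => ?_) (fun x => ?_)
    · simp [hε, AlgHomClass.commutes]
    · simp
  have h1' := DFunLike.congr_fun h1 (comul a)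
  simp only [StarAlgHom.comp_apply] at h1'
  rw [hΔ, h1', counit_left]

theorem counit_right_transport (hΔ : ∀ a, Δ (f a) = map f f (comul a))
    (hε : ∀ a, ε (f a) = counit a) (a : A₀) : sliceRight ε (Δ (f a)) = f a := by
  have h1 : (sliceRight ε).comp (map f f) = f.comp (sliceRight counit) := by
    refine hom_ext (fun x => ?_) (fun x => ?_)
    · simp
    · simp [hε, AlgHomClass.commutes]
  have h1' := DFunLike.congr_fun h1 (comul a)
  simp only [StarAlgHom.comp_apply] at h1'
  rw [hΔ, h1', counit_right]

end Transport

theorem antipode'_antipode' (x : MaxTensor A B) :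
    (antipode' A B (antipode' A B x).unop).unop = x := by
  have hc := continuous_hom (antipode' A B)
  refine induction (P := fun x => (antipode' A B (antipode' A B x).unop).unop = x)
    (isClosed_eq (by fun_prop) (by fun_prop)) (fun a b => ?_) (fun x y hx hy => ?_) x
  · rw [map_mul, MulOpposite.unop_mul, map_mul, MulOpposite.unop_mul, antipode'_inl, antipode'_inl,
      antipode'_inr, antipode'_inr, antipode_antipode, antipode_antipode]
  · rw [map_add, MulOpposite.unop_add, map_add, MulOpposite.unop_add, hx, hy]

theorem antipode_axiom' : ∃ 𝒜 : StarSubalgebra ℂ (MaxTensor A B), Dense (𝒜 : Set (MaxTensor A B)) ∧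
    ∀ x ∈ 𝒜, AntipodeAxiomAt (comul' A B) (counit' A B) (antipode' A B) 𝒜 x := by
  obtain ⟨𝒜, hd, h𝒜⟩ := antipode_axiom (A := A)
  obtain ⟨ℬ, hd', hℬ⟩ := antipode_axiom (A := B)
  let G : Set (MaxTensor A B) := inl '' (𝒜 : Set A) ∪ inr '' (ℬ : Set B)
  have hl : ∀ a ∈ 𝒜, (inl a : MaxTensor A B) ∈ StarAlgebra.adjoin ℂ G := fun a ha =>
    StarAlgebra.subset_adjoin ℂ _ (Or.inl ⟨a, ha, rfl⟩)
  have hr : ∀ b ∈ ℬ, (inr b : MaxTensor A B) ∈ StarAlgebra.adjoin ℂ G := fun b hb =>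
    StarAlgebra.subset_adjoin ℂ _ (Or.inr ⟨b, hb, rfl⟩)
  refine ⟨StarAlgebra.adjoin ℂ G, fun x => ?_, ?_⟩
  · have hl' : ∀ a : A, (inl a : MaxTensor A B) ∈ (StarAlgebra.adjoin ℂ G).topologicalClosure :=
      fun a => by
        refine map_mem_closure (continuous_hom inl) (hd a) hl
    have hr' : ∀ b : B, (inr b : MaxTensor A B) ∈ (StarAlgebra.adjoin ℂ G).topologicalClosure :=
      fun b => by
        refine map_mem_closure (continuous_hom inr) (hd' b) hr
    exact induction (P := fun x => x ∈ (StarAlgebra.adjoin ℂ G).topologicalClosure)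
      (StarSubalgebra.isClosed_topologicalClosure _) (fun a b => mul_mem (hl' a) (hr' b))
      (fun x y hx hy => add_mem hx hy) x
  · refine antipodeAxiomAt_adjoin _ _ _ antipode'_antipode' _ ?_
    rintro _ (⟨a, ha, rfl⟩ | ⟨b, hb, rfl⟩)
    · exact tensorSquare_map inl hl _ _ _ comul counit antipode comul'_inl counit'_inl
        antipode'_inl (h𝒜 a ha)
    · exact tensorSquare_map inr hr _ _ _ comul counit antipode comul'_inr counit'_inr
        antipode'_inr (hℬ b hb)

/-- The tensor product of two Hopf C*-algebras. -/
instance : HopfCStarAlgebra (MaxTensor A B) where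
  comul := comul' A B
  counit := counit' A B
  antipode := antipode' A B
  coassoc := eq_of_inl_inr ((assoc _ _ _).comp ((map (comul' A B) (.id ℂ _)).comp (comul' A B)))
    ((map (.id ℂ _) (comul' A B)).comp (comul' A B))
    (coassoc_transport inl _ comul'_inl) (coassoc_transport inr _ comul'_inr)
  counit_left := eq_of_inl_inr ((sliceLeft _).comp (comul' A B)) (.id ℂ _)
    (counit_left_transport inl _ _ comul'_inl counit'_inl)
    (counit_left_transport inr _ _ comul'_inr counit'_inr)
  counit_right := eq_of_inl_inr ((sliceRight _).comp (comul' A B)) (.id ℂ _)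
    (counit_right_transport inl _ _ comul'_inl counit'_inl)
    (counit_right_transport inr _ _ comul'_inr counit'_inr)
  antipode_antipode := antipode'_antipode'
  antipode_axiom := antipode_axiom'

end MaxTensor

end HopfTensor

/-! ### The Hopf C*-algebra of functions on a finite group -/

section FiniteGroup

open Classical in
/-- The Dirac mass at `g`. -/
def dirac {X : Type u} (g : X) : X → ℂ := fun h => if h = g then 1 else 0

@[simp]
theorem dirac_self {X : Type u} (g : X) : dirac g g = 1 := if_pos rfl

theorem dirac_ne {X : Type u} {g h : X} (H : h ≠ g) : dirac g h = 0 := if_neg H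

theorem dirac_mul_self {X : Type u} (g : X) : dirac g * dirac g = dirac g := by
  ext k
  by_cases hk : k = g <;> simp [dirac, hk]

theorem dirac_mul_of_ne {X : Type u} {g h : X} (H : g ≠ h) : dirac g * dirac h = 0 := by
  ext k
  by_cases hk : k = g
  · subst hk; simp [dirac, H]
  · simp [dirac, hk]

theorem star_dirac {X : Type u} (g : X) : star (dirac g) = dirac g := by
  ext k
  by_cases hk : k = g <;> simp [dirac, hk]

theorem sum_dirac {X : Type u} [Fintype X] (f : X → ℂ) : ∑ g, f g • dirac g = f := by
  ext k
  simp only [Finset.sum_apply, Pi.smul_apply]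
  rw [Finset.sum_eq_single k] <;> simp +contextual [dirac_ne, eq_comm]

theorem sum_dirac_one {X : Type u} [Fintype X] : ∑ g : X, dirac g = 1 := by
  simpa using sum_dirac (1 : X → ℂ)

/-- A finite partition of unity by projections defines a *-homomorphism. -/
def partitionHom {X : Type u} [Fintype X] {D : Type v} [CStarAlgebra D] (e : X → D)
    (hs : ∀ x, star (e x) = e x) (hm : ∀ x, e x * e x = e x)
    (ho : ∀ x y, x ≠ y → e x * e y = 0)
    (h1 : ∑ x, e x = 1) : (X → ℂ) →⋆ₐ[ℂ] D where
  toFun f := ∑ x, f x • e x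
  map_one' := by simpa using h1
  map_mul' f g := by
    simp_rw [Finset.sum_mul_sum, smul_mul_smul_comm]
    refine Finset.sum_congr rfl fun x _ => ?_
    rw [Finset.sum_eq_single x]
    · rw [hm, Pi.mul_apply]
    · intro y _ hy
      rw [ho x y hy.symm, smul_zero]
    · simp
  map_zero' := by simp
  map_add' f g := by simp [add_smul, Finset.sum_add_distrib]
  commutes' c := by
    simp only [Pi.algebraMap_apply, ← Finset.smul_sum, h1]
    rw [Algebra.algebraMap_eq_smul_one, Algebra.algebraMap_eq_smul_one, smul_assoc, one_smul]
  map_star' f := by simp [hs]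

theorem partitionHom_apply {X : Type u} [Fintype X] {D : Type v} [CStarAlgebra D] (e : X → D)
    (hs : ∀ x, star (e x) = e x) (hm : ∀ x, e x * e x = e x)
    (ho : ∀ x y, x ≠ y → e x * e y = 0)
    (h1 : ∑ x, e x = 1) (f : X → ℂ) : partitionHom e hs hm ho h1 f = ∑ x, f x • e x := rfl

open MaxTensor

variable (G : Type u) [Group G] [Fintype G]

/-- The identification `C(G × G) = C(G) ⊗ C(G)`. -/
def prodFunctions : (G × G → ℂ) →⋆ₐ[ℂ] MaxTensor (G → ℂ) (G → ℂ) :=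
  partitionHom (fun p => inl (dirac p.1) * inr (dirac p.2))
    (fun p => by
      rw [star_mul, ← map_star, ← map_star, star_dirac, star_dirac, (commute_inl_inr _ _).eq])
    (fun p => by
      rw [(commute_inl_inr _ _).symm.mul_mul_mul_comm, ← map_mul, ← map_mul, dirac_mul_self,
        dirac_mul_self])
    (fun p q hpq => by
      rw [(commute_inl_inr _ _).symm.mul_mul_mul_comm, ← map_mul, ← map_mul]
      by_cases h1 : p.1 = q.1
      · have h2 : p.2 ≠ q.2 := fun h2 => hpq (Prod.ext h1 h2)
        rw [dirac_mul_of_ne h2, map_zero, mul_zero]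
      · rw [dirac_mul_of_ne h1, map_zero, zero_mul])
    (by
      rw [Fintype.sum_prod_type]
      simp_rw [← Finset.mul_sum, ← Finset.sum_mul, ← map_sum, sum_dirac_one, map_one, mul_one])

/-- The comultiplication `Δ(f)(g, h) = f(gh)`. -/
def groupComul : (G → ℂ) →⋆ₐ[ℂ] MaxTensor (G → ℂ) (G → ℂ) :=
  (prodFunctions G).comp
    { toFun := fun f p => f (p.1 * p.2)
      map_one' := rfl
      map_mul' := fun _ _ => rfl
      map_zero' := rfl
      map_add' := fun _ _ => rfl
      commutes' := fun _ => rfl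
      map_star' := fun _ => rfl }

/-- The counit `ε(f) = f(1)`. -/
def groupCounit : (G → ℂ) →⋆ₐ[ℂ] ℂ where
  toFun f := f 1
  map_one' := rfl
  map_mul' _ _ := rfl
  map_zero' := rfl
  map_add' _ _ := rfl
  commutes' _ := rfl
  map_star' _ := rfl

/-- The antipode `S(f)(g) = f(g⁻¹)`. -/
def groupAntipode : (G → ℂ) →⋆ₐ[ℂ] (G → ℂ)ᵐᵒᵖ where
  toFun f := MulOpposite.op fun g => f g⁻¹
  map_one' := rfl
  map_mul' _ _ := MulOpposite.unop_injective (funext fun _ => mul_comm _ _)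
  map_zero' := rfl
  map_add' _ _ := rfl
  commutes' _ := rfl
  map_star' _ := rfl

theorem groupCounit_apply (f : G → ℂ) : groupCounit G f = f 1 := rfl

theorem groupAntipode_apply (f : G → ℂ) (g : G) : (groupAntipode G f).unop g = f g⁻¹ := rfl

theorem groupComul_apply (f : G → ℂ) :
    groupComul G f = ∑ g, ∑ h, f (g * h) • (inl (dirac g) * inr (dirac h)) := by
  rw [← Fintype.sum_prod_type' (f := fun g h => f (g * h) • (inl (dirac g) * inr (dirac h)))]
  rfl

theorem groupComul_dirac (x : G) :
    groupComul G (dirac x) = ∑ g, inl (dirac g) * inr (dirac (g⁻¹ * x)) := by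
  rw [groupComul_apply]
  refine Finset.sum_congr rfl fun g _ => ?_
  rw [Finset.sum_eq_single (g⁻¹ * x)]
  · simp [dirac]
  · intro h _ hh
    have : g * h ≠ x := fun e => hh (by rw [← e]; group)
    simp [dirac, this]
  · simp

theorem functions_hom_ext {X : Type u} [Fintype X] {D : Type v} [CStarAlgebra D]
    (f g : (X → ℂ) →⋆ₐ[ℂ] D) (h : ∀ x, f (dirac x) = g (dirac x)) (a : X → ℂ) : f a = g a := by
  rw [← sum_dirac a]
  simp [map_sum, map_smul, h]

/-- The Hopf C*-algebra `C(G)` of functions on a finite group `G`. -/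
instance : HopfCStarAlgebra (G → ℂ) where
  comul := groupComul G
  counit := groupCounit G
  antipode := groupAntipode G
  coassoc := by
    refine functions_hom_ext ((assoc _ _ _).comp ((map (groupComul G) (.id ℂ _)).comp
      (groupComul G))) ((map (.id ℂ _) (groupComul G)).comp (groupComul G)) fun x => ?_
    simp only [StarAlgHom.comp_apply, groupComul_dirac, map_sum, map_mul, map_inl, map_inr,
      assoc_inl_inl, assoc_inl_inr, assoc_inr, StarAlgHom.coe_id, id_eq, Finset.sum_mul,
      Finset.mul_sum]
    rw [Finset.sum_comm]
    refine Finset.sum_congr rfl fun g _ => ?_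
    refine Fintype.sum_equiv (Equiv.mulLeft g⁻¹) _ _ fun h => ?_
    simp [mul_assoc]
  counit_left := by
    refine functions_hom_ext ((sliceLeft _).comp (groupComul G)) (.id ℂ _) fun x => ?_
    simp only [StarAlgHom.comp_apply, groupComul_dirac, map_sum, map_mul, sliceLeft_inl,
      sliceLeft_inr]
    rw [Finset.sum_eq_single 1]
    · simp [groupCounit_apply]
    · intro g _ hg
      simp [groupCounit_apply, dirac_ne hg.symm]
    · simp
  counit_right := by
    refine functions_hom_ext ((sliceRight _).comp (groupComul G)) (.id ℂ _) fun x => ?_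
    simp only [StarAlgHom.comp_apply, groupComul_dirac, map_sum, map_mul, sliceRight_inl,
      sliceRight_inr]
    rw [Finset.sum_eq_single x]
    · simp [groupCounit_apply]
    · intro g _ hg
      have : (1 : G) ≠ g⁻¹ * x := fun e => hg (by rw [eq_comm, inv_mul_eq_one] at e; exact e)
      simp [groupCounit_apply, dirac_ne this]
    · simp
  antipode_antipode f := by
    ext g
    rw [groupAntipode_apply, groupAntipode_apply, inv_inv]
  antipode_axiom := by
    refine ⟨⊤, by simp, fun f _ => ⟨∑ g, ∑ h, f (g * h) • (dirac g ⊗ₜ[ℂ] dirac h), ?_, ?_, ?_, ?_⟩⟩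
    · exact sum_mem fun g _ => sum_mem fun h _ =>
        SMulMemClass.smul_mem _ (tmul_mem_tensorSquare trivial trivial)
    · simp only [groupComul_apply, map_sum, map_smul, of_tmul]
    · ext k
      simp only [map_sum, map_smul, antipodeMulLeft_tmul, Finset.sum_apply, Pi.smul_apply,
        Pi.mul_apply]
      rw [Finset.sum_eq_single k⁻¹, Finset.sum_eq_single k]
      · simp [groupAntipode_apply, groupCounit_apply]
      · intro h _ hh; simp [dirac_ne hh.symm]
      · simp
      · intro g _ hg
        refine Finset.sum_eq_zero fun h _ => ?_
        have : k⁻¹ ≠ g := hg.symm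
        simp [groupAntipode_apply, dirac_ne this]
      · simp
    · ext k
      simp only [map_sum, map_smul, antipodeMulRight_tmul, Finset.sum_apply, Pi.smul_apply,
        Pi.mul_apply]
      rw [Finset.sum_eq_single k, Finset.sum_eq_single k⁻¹]
      · simp [groupAntipode_apply, groupCounit_apply]
      · intro h _ hh; simp [groupAntipode_apply, dirac_ne (show k⁻¹ ≠ h from hh.symm)]
      · simp
      · intro g _ hg
        refine Finset.sum_eq_zero fun h _ => ?_
        simp [dirac_ne hg.symm]
      · simp

end FiniteGroup

/-! ### Magic unitaries and quantum automorphism groups of graphs -/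

section FreeStar

variable {X : Type u}

/-- The free *-algebra on self-adjoint generators `x ∈ X`: noncommutative polynomials, with the
involution that reverses words and conjugates coefficients. -/
abbrev FreeStarAlgebra (X : Type u) : Type u := MonoidAlgebra ℂ (FreeMonoid X)

instance : Star (FreeStarAlgebra X) where
  star f := MonoidAlgebra.map (starRingEnd ℂ).toAddMonoidHom (MonoidAlgebra.mapDomain star f)

theorem FreeStarAlgebra.star_single (m : FreeMonoid X) (c : ℂ) :
    star (MonoidAlgebra.single m c : FreeStarAlgebra X) =
      MonoidAlgebra.single (star m) (star c) := by
  change MonoidAlgebra.map _ (MonoidAlgebra.mapDomain _ _) = _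
  rw [MonoidAlgebra.mapDomain_single, MonoidAlgebra.map_single]
  rfl

theorem FreeStarAlgebra.star_add' (f g : FreeStarAlgebra X) : star (f + g) = star f + star g := by
  change MonoidAlgebra.map _ (MonoidAlgebra.mapDomain _ _) = _
  rw [MonoidAlgebra.mapDomain_add, MonoidAlgebra.map_add]
  rfl

theorem FreeStarAlgebra.star_zero' : star (0 : FreeStarAlgebra X) = 0 := by
  change MonoidAlgebra.map _ (MonoidAlgebra.mapDomain _ _) = _
  rw [MonoidAlgebra.mapDomain_zero, MonoidAlgebra.map_zero]

open FreeStarAlgebra in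
instance : StarRing (FreeStarAlgebra X) where
  star_involutive f := by
    induction f using MonoidAlgebra.induction_linear with
    | zero => rw [star_zero', star_zero']
    | add f g hf hg => rw [star_add', star_add', hf, hg]
    | single m c => rw [star_single, star_single, star_star, star_star]
  star_mul f g := by
    induction f using MonoidAlgebra.induction_linear with
    | zero => rw [zero_mul, star_zero', mul_zero]
    | add f f' hf hf' => rw [add_mul, star_add', star_add', hf, hf', mul_add]
    | single m c =>
      induction g using MonoidAlgebra.induction_linear with
      | zero => rw [mul_zero, star_zero', zero_mul]
      | add f f' hf hf' => rw [mul_add, star_add', star_add', hf, hf', add_mul]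
      | single n d =>
        rw [MonoidAlgebra.single_mul_single, star_single, star_single, star_single,
          MonoidAlgebra.single_mul_single, star_mul, star_mul]
  star_add := star_add'

open FreeStarAlgebra in
instance : StarModule ℂ (FreeStarAlgebra X) where
  star_smul c f := by
    induction f using MonoidAlgebra.induction_linear with
    | zero => rw [smul_zero, star_zero', smul_zero]
    | add f g hf hg => rw [smul_add, star_add', star_add', hf, hg, smul_add]
    | single m d =>
      rw [MonoidAlgebra.smul_single, star_single, star_single, MonoidAlgebra.smul_single,
        star_smul]

namespace FreeStarAlgebra

/-- The generators. -/
def ι (x : X) : FreeStarAlgebra X := MonoidAlgebra.of ℂ _ (FreeMonoid.of x)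

theorem star_ι (x : X) : star (ι x) = ι x := by
  change star (MonoidAlgebra.single _ _) = MonoidAlgebra.single _ _
  rw [star_single, FreeMonoid.star_of, star_one]

theorem induction {P : FreeStarAlgebra X → Prop} (h1 : P 1) (hι : ∀ x f, P f → P (ι x * f))
    (hadd : ∀ f g, P f → P g → P (f + g)) (hsmul : ∀ (c : ℂ) f, P f → P (c • f))
    (f : FreeStarAlgebra X) : P f := by
  induction f using MonoidAlgebra.induction_on with
  | of m =>
    induction m using FreeMonoid.inductionOn' with
    | one => rw [map_one]; exact h1
    | of_mul x m h => rw [map_mul]; exact hι x _ h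
  | add f g hf hg => exact hadd f g hf hg
  | smul c f hf => exact hsmul c f hf

/-- The universal property of the free *-algebra on self-adjoint generators. -/
def lift {D : Type v} [CStarAlgebra D] (φ : X → D) (hφ : ∀ x, star (φ x) = φ x) :
    FreeStarAlgebra X →⋆ₐ[ℂ] D :=
  { MonoidAlgebra.lift ℂ D (FreeMonoid X) (FreeMonoid.lift φ) with
    map_star' := fun f => by
      change MonoidAlgebra.lift ℂ D (FreeMonoid X) (FreeMonoid.lift φ) (star f) =
        star (MonoidAlgebra.lift ℂ D (FreeMonoid X) (FreeMonoid.lift φ) f)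
      induction f using FreeStarAlgebra.induction with
      | h1 => rw [star_one, map_one, star_one]
      | hι x f hf =>
        have h : MonoidAlgebra.lift ℂ D (FreeMonoid X) (FreeMonoid.lift φ) (ι x) = φ x := by
          rw [ι, MonoidAlgebra.lift_of, FreeMonoid.lift_eval_of]
        rw [star_mul, map_mul, map_mul, star_mul, hf, star_ι, h, hφ]
      | hadd f g hf hg => rw [star_add, map_add, map_add, star_add, hf, hg]
      | hsmul c f hf => rw [star_smul, map_smul, map_smul, star_smul, hf] }

theorem lift_ι {D : Type v} [CStarAlgebra D] (φ : X → D) (hφ : ∀ x, star (φ x) = φ x) (x : X) :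
    lift φ hφ (ι x) = φ x := by
  change MonoidAlgebra.lift ℂ D (FreeMonoid X) (FreeMonoid.lift φ) (ι x) = φ x
  rw [ι, MonoidAlgebra.lift_of, FreeMonoid.lift_eval_of]

end FreeStarAlgebra

end FreeStar

section Magic

variable {V : Type u} [Fintype V]

/-- A magic unitary matrix: all entries are projections, and all rows and columns are partitions
of unity, i.e. consist of pairwise orthogonal projections with sum `1`. -/
structure IsMagicUnitary {A : Type v} [Ring A] [StarRing A] (u : Matrix V V A) : Prop where
  isStarProjection : ∀ i j, IsStarProjection (u i j)
  row_orthogonal : ∀ i j k, j ≠ k → u i j * u i k = 0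
  col_orthogonal : ∀ i j k, j ≠ k → u j i * u k i = 0
  row_sum : ∀ i, ∑ j, u i j = 1
  col_sum : ∀ j, ∑ i, u i j = 1

/-- The generic matrix of self-adjoint generators. -/
def genericMatrix (V : Type u) : Matrix V V (FreeStarAlgebra (V × V)) :=
  Matrix.of fun i j => FreeStarAlgebra.ι (i, j)

open Classical in
/-- The adjacency matrix of a graph, with entries in a ring. -/
def adjacency (A : Type v) [Ring A] (X : SimpleGraph V) : Matrix V V A :=
  Matrix.of fun i j => if X.Adj i j then 1 else 0

/-- The relations (elements to be set equal to zero) which express that the generic matrix `u` of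
self-adjoint generators is a magic unitary that commutes with the adjacency matrices of the
graphs in `𝒳`. -/
inductive MagicRelation (𝒳 : Set (SimpleGraph V)) : FreeStarAlgebra (V × V) → Prop
  | idempotent (i j : V) :
      MagicRelation 𝒳 (genericMatrix V i j * genericMatrix V i j - genericMatrix V i j)
  | row_orthogonal (i j k : V) (h : j ≠ k) :
      MagicRelation 𝒳 (genericMatrix V i j * genericMatrix V i k)
  | col_orthogonal (i j k : V) (h : j ≠ k) :
      MagicRelation 𝒳 (genericMatrix V j i * genericMatrix V k i)
  | row_sum (i : V) : MagicRelation 𝒳 (∑ j, genericMatrix V i j - 1)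
  | col_sum (j : V) : MagicRelation 𝒳 (∑ i, genericMatrix V i j - 1)
  | commute (X : SimpleGraph V) (hX : X ∈ 𝒳) (i j : V) :
      MagicRelation 𝒳 ((adjacency (FreeStarAlgebra (V × V)) X * genericMatrix V -
        genericMatrix V * adjacency (FreeStarAlgebra (V × V)) X : Matrix V V _) i j)

/-- The set of relations of `MagicRelation`. -/
def magicRelations (𝒳 : Set (SimpleGraph V)) : Set (FreeStarAlgebra (V × V)) :=
  {r | MagicRelation 𝒳 r}

instance (𝒳 : Set (SimpleGraph V)) : IsCStarBounded (magicRelations 𝒳) where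
  bddAbove f := by
    induction f using FreeStarAlgebra.induction with
    | h1 =>
      refine ⟨1, ?_⟩
      rintro _ ⟨p, rfl⟩
      have h := p.1.star_mul_self 1
      rw [star_one, mul_one] at h
      change p.1 1 ≤ 1
      nlinarith [p.1.nonneg 1]
    | hι x f hf =>
      obtain ⟨c, hc⟩ := hf
      refine ⟨c, ?_⟩
      rintro _ ⟨p, rfl⟩
      have h0 := p.2 _ (MagicRelation.idempotent (𝒳 := 𝒳) x.1 x.2)
      have h1 : p.1 (FreeStarAlgebra.ι x * FreeStarAlgebra.ι x - FreeStarAlgebra.ι x) = 0 := h0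
      have h2 := p.1.star_mul_self (FreeStarAlgebra.ι x)
      rw [FreeStarAlgebra.star_ι] at h2
      have h3 : p.1 (FreeStarAlgebra.ι x * FreeStarAlgebra.ι x) ≤
          p.1 (FreeStarAlgebra.ι x * FreeStarAlgebra.ι x - FreeStarAlgebra.ι x) +
            p.1 (FreeStarAlgebra.ι x) := by
        simpa using map_add_le_add p.1.toSeminorm
          (FreeStarAlgebra.ι x * FreeStarAlgebra.ι x - FreeStarAlgebra.ι x) (FreeStarAlgebra.ι x)
      have h4 : p.1 (FreeStarAlgebra.ι x) ≤ 1 := by nlinarith [p.1.nonneg (FreeStarAlgebra.ι x)]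
      have h5 : p.1 f ≤ c := hc ⟨p, rfl⟩
      have h6 := p.1.mul_le (FreeStarAlgebra.ι x) f
      change p.1 (FreeStarAlgebra.ι x * f) ≤ c
      nlinarith [p.1.nonneg f]
    | hadd f g hf hg =>
      obtain ⟨c, hc⟩ := hf
      obtain ⟨d, hd⟩ := hg
      refine ⟨c + d, ?_⟩
      rintro _ ⟨p, rfl⟩
      exact (map_add_le_add p.1.toSeminorm f g).trans (add_le_add (hc ⟨p, rfl⟩) (hd ⟨p, rfl⟩))
    | hsmul a f hf =>
      obtain ⟨c, hc⟩ := hf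
      refine ⟨‖a‖ * c, ?_⟩
      rintro _ ⟨p, rfl⟩
      refine (map_smul_eq_mul p.1.toSeminorm a f).le.trans ?_
      exact mul_le_mul_of_nonneg_left (hc ⟨p, rfl⟩) (norm_nonneg a)

/-- The universal C*-algebra generated by the entries of a magic unitary matrix `u` with rows and
columns indexed by `V`, with the relations that `u` commutes with the adjacency matrices of all
graphs in `𝒳`. -/
def MagicAlgebra (𝒳 : Set (SimpleGraph V)) : Type u := UnivCStar (magicRelations 𝒳)

instance (𝒳 : Set (SimpleGraph V)) : CStarAlgebra (MagicAlgebra 𝒳) :=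
  inferInstanceAs (CStarAlgebra (UnivCStar (magicRelations 𝒳)))

namespace MagicAlgebra

variable (𝒳 : Set (SimpleGraph V))

/-- The canonical *-homomorphism from the free *-algebra. -/
def of : FreeStarAlgebra (V × V) →⋆ₐ[ℂ] MagicAlgebra 𝒳 := UnivCStar.of (magicRelations 𝒳)

/-- The universal magic unitary. -/
def u : Matrix V V (MagicAlgebra 𝒳) := Matrix.of fun i j => of 𝒳 (genericMatrix V i j)

variable {𝒳}

theorem of_eq_zero {r : FreeStarAlgebra (V × V)} (hr : MagicRelation 𝒳 r) : of 𝒳 r = 0 :=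
  UnivCStar.of_eq_zero hr

end MagicAlgebra

theorem adjacency_map {A : Type v} {B : Type w} [Ring A] [Ring B] {F : Type*} [FunLike F A B]
    [RingHomClass F A B] (f : F) (X : SimpleGraph V) (i j : V) :
    f (adjacency A X i j) = adjacency B X i j := by
  by_cases h : X.Adj i j <;> simp [adjacency, h]

namespace MagicAlgebra

variable {𝒳 : Set (SimpleGraph V)}

theorem isMagicUnitary_u : IsMagicUnitary (u 𝒳) where
  isStarProjection i j :=
    { isIdempotentElem := by
        have := of_eq_zero (MagicRelation.idempotent (𝒳 := 𝒳) i j)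
        rw [map_sub, map_mul, sub_eq_zero] at this
        exact this
      isSelfAdjoint := by
        change star (of 𝒳 (FreeStarAlgebra.ι (i, j))) = of 𝒳 (FreeStarAlgebra.ι (i, j))
        rw [← map_star, FreeStarAlgebra.star_ι] }
  row_orthogonal i j k h :=
    (map_mul (of 𝒳) _ _).symm.trans (of_eq_zero (.row_orthogonal i j k h))
  col_orthogonal i j k h :=
    (map_mul (of 𝒳) _ _).symm.trans (of_eq_zero (.col_orthogonal i j k h))
  row_sum i := by
    have := of_eq_zero (MagicRelation.row_sum (𝒳 := 𝒳) i)
    rw [map_sub, map_one, map_sum, sub_eq_zero] at this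
    exact this
  col_sum j := by
    have := of_eq_zero (MagicRelation.col_sum (𝒳 := 𝒳) j)
    rw [map_sub, map_one, map_sum, sub_eq_zero] at this
    exact this

theorem commute_u {X : SimpleGraph V} (hX : X ∈ 𝒳) : Commute (adjacency _ X) (u 𝒳) := by
  ext i j
  have := of_eq_zero (MagicRelation.commute (𝒳 := 𝒳) X hX i j)
  rw [Matrix.sub_apply, map_sub, sub_eq_zero] at this
  simpa only [Matrix.mul_apply, map_sum, map_mul, adjacency_map, u, Matrix.of_apply] using this

variable {D : Type v} [CStarAlgebra D]

/-- The universal property: a magic unitary that commutes with the adjacency matrices of the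
graphs in `𝒳` defines a *-homomorphism. -/
def lift (U : Matrix V V D) (hU : IsMagicUnitary U)
    (hc : ∀ X ∈ 𝒳, Commute (adjacency D X) U) : MagicAlgebra 𝒳 →⋆ₐ[ℂ] D :=
  UnivCStar.lift
    (FreeStarAlgebra.lift (fun x : V × V => U x.1 x.2)
      fun x => (hU.isStarProjection x.1 x.2).isSelfAdjoint) (by
    let φ := FreeStarAlgebra.lift (fun x : V × V => U x.1 x.2)
      fun x => (hU.isStarProjection x.1 x.2).isSelfAdjoint
    have hφ : ∀ i j, φ (genericMatrix V i j) = U i j := fun i j => FreeStarAlgebra.lift_ι _ _ (i, j)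
    change ∀ r ∈ magicRelations 𝒳, φ r = 0
    rintro _ (⟨i, j⟩ | ⟨i, j, k, h⟩ | ⟨i, j, k, h⟩ | i | j | ⟨X, hX, i, j⟩)
    · rw [map_sub, map_mul, hφ, sub_eq_zero]
      exact (hU.isStarProjection i j).isIdempotentElem
    · rw [map_mul, hφ, hφ, hU.row_orthogonal i j k h]
    · rw [map_mul, hφ, hφ, hU.col_orthogonal i j k h]
    · rw [map_sub, map_one, map_sum, sub_eq_zero, ← hU.row_sum i]
      exact Finset.sum_congr rfl fun j _ => hφ i j
    · rw [map_sub, map_one, map_sum, sub_eq_zero, ← hU.col_sum j]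
      exact Finset.sum_congr rfl fun i _ => hφ i j
    · have h2 := congrFun₂ (hc X hX).eq i j
      rw [Matrix.sub_apply, map_sub, sub_eq_zero]
      simpa only [Matrix.mul_apply, map_sum, map_mul, hφ, adjacency_map] using h2)

theorem lift_u (U : Matrix V V D) (hU : IsMagicUnitary U)
    (hc : ∀ X ∈ 𝒳, Commute (adjacency D X) U) (i j : V) : lift U hU hc (u 𝒳 i j) = U i j :=
  (UnivCStar.lift_of _ _ _).trans (FreeStarAlgebra.lift_ι _ _ (i, j))

theorem induction {P : MagicAlgebra 𝒳 → Prop} (hc : IsClosed {x | P x}) (h : ∀ f, P (of 𝒳 f))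
    (x : MagicAlgebra 𝒳) : P x :=
  UnivCStar.induction hc h x

theorem closure_u : (StarAlgebra.adjoin ℂ {x | ∃ i j, x = u 𝒳 i j}).topologicalClosure = ⊤ := by
  refine top_le_iff.mp fun x _ => ?_
  have key : ∀ f, of 𝒳 f ∈ StarAlgebra.adjoin ℂ {x | ∃ i j, x = u 𝒳 i j} := fun f => by
    induction f using FreeStarAlgebra.induction with
    | h1 => rw [map_one]; exact one_mem _
    | hι y f hf =>
      rw [map_mul]
      exact mul_mem (StarAlgebra.subset_adjoin ℂ _ ⟨y.1, y.2, rfl⟩) hf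
    | hadd f g hf hg => rw [map_add]; exact add_mem hf hg
    | hsmul c f hf => rw [map_smul]; exact SMulMemClass.smul_mem c hf
  exact induction
    (P := fun x => x ∈ (StarAlgebra.adjoin ℂ {x | ∃ i j, x = u 𝒳 i j}).topologicalClosure)
    (StarSubalgebra.isClosed_topologicalClosure _)
    (fun f => StarSubalgebra.le_topologicalClosure _ (key f)) x

theorem hom_ext {f g : MagicAlgebra 𝒳 →⋆ₐ[ℂ] D} (h : ∀ i j, f (u 𝒳 i j) = g (u 𝒳 i j)) : f = g := by
  have h1 : StarAlgebra.adjoin ℂ {x | ∃ i j, x = u 𝒳 i j} ≤ StarAlgHom.equalizer f g := by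
    refine StarAlgebra.adjoin_le ?_
    rintro _ ⟨i, j, rfl⟩
    exact h i j
  ext x
  have hx : x ∈ (StarAlgebra.adjoin ℂ {x | ∃ i j, x = u 𝒳 i j}).topologicalClosure := by
    rw [closure_u]; trivial
  exact closure_minimal h1 (isClosed_eqOn_hom f g) hx

end MagicAlgebra

theorem IsMagicUnitary.mul {D : Type v} [Ring D] [StarRing D] {U W : Matrix V V D}
    (hU : IsMagicUnitary U) (hW : IsMagicUnitary W) (h : ∀ i j k l, Commute (U i j) (W k l)) :
    IsMagicUnitary (U * W) := by
  have hrow : ∀ i j k, (U * W) i j * (U * W) i k = ∑ l, U i l * (W l j * W l k) := fun i j k => by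
    rw [Matrix.mul_apply, Matrix.mul_apply, Finset.sum_mul_sum]
    refine Finset.sum_congr rfl fun l _ => ?_
    rw [Finset.sum_eq_single l]
    · rw [(h i l l j).symm.mul_mul_mul_comm, (hU.isStarProjection i l).isIdempotentElem.eq]
    · intro m _ hm
      rw [(h i m l j).symm.mul_mul_mul_comm, hU.row_orthogonal i l m hm.symm, zero_mul]
    · simp
  have hcol : ∀ i j k, (U * W) j i * (U * W) k i = ∑ l, U j l * U k l * W l i := fun i j k => by
    rw [Matrix.mul_apply, Matrix.mul_apply, Finset.sum_mul_sum]
    refine Finset.sum_congr rfl fun l _ => ?_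
    rw [Finset.sum_eq_single l]
    · rw [(h k l l i).symm.mul_mul_mul_comm, (hW.isStarProjection l i).isIdempotentElem.eq]
    · intro m _ hm
      rw [(h k m l i).symm.mul_mul_mul_comm, hW.col_orthogonal i l m hm.symm, mul_zero]
    · simp
  refine ⟨fun i j => ⟨?_, ?_⟩, fun i j k hjk => ?_, fun i j k hjk => ?_, fun i => ?_, fun j => ?_⟩
  · change (U * W) i j * (U * W) i j = (U * W) i j
    rw [hrow, Matrix.mul_apply]
    exact Finset.sum_congr rfl fun l _ => by rw [(hW.isStarProjection l j).isIdempotentElem.eq]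
  · change star ((U * W) i j) = (U * W) i j
    rw [Matrix.mul_apply, star_sum]
    refine Finset.sum_congr rfl fun l _ => ?_
    rw [star_mul, (hU.isStarProjection i l).isSelfAdjoint.star_eq,
      (hW.isStarProjection l j).isSelfAdjoint.star_eq, (h i l l j).eq]
  · rw [hrow]
    exact Finset.sum_eq_zero fun l _ => by rw [hW.row_orthogonal l j k hjk, mul_zero]
  · rw [hcol]
    exact Finset.sum_eq_zero fun l _ => by rw [hU.col_orthogonal l j k hjk, zero_mul]
  · simp_rw [Matrix.mul_apply]
    rw [Finset.sum_comm]
    simp_rw [← Finset.mul_sum, hW.row_sum, mul_one, hU.row_sum]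
  · simp_rw [Matrix.mul_apply]
    rw [Finset.sum_comm]
    simp_rw [← Finset.sum_mul, hU.col_sum, one_mul, hW.col_sum]

theorem IsMagicUnitary.map {A : Type v} {B : Type w} [CStarAlgebra A] [CStarAlgebra B]
    {U : Matrix V V A} (hU : IsMagicUnitary U) (f : A →⋆ₐ[ℂ] B) : IsMagicUnitary (U.map f) where
  isStarProjection i j := (hU.isStarProjection i j).map f
  row_orthogonal i j k h := by
    rw [Matrix.map_apply, Matrix.map_apply, ← map_mul, hU.row_orthogonal i j k h, map_zero]
  col_orthogonal i j k h := by
    rw [Matrix.map_apply, Matrix.map_apply, ← map_mul, hU.col_orthogonal i j k h, map_zero]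
  row_sum i := by simp only [Matrix.map_apply, ← map_sum, hU.row_sum, map_one]
  col_sum j := by simp only [Matrix.map_apply, ← map_sum, hU.col_sum, map_one]

theorem commute_adjacency_map {A : Type v} {B : Type w} [CStarAlgebra A] [CStarAlgebra B]
    {U : Matrix V V A} {X : SimpleGraph V} (h : Commute (adjacency A X) U) (f : A →⋆ₐ[ℂ] B) :
    Commute (adjacency B X) (U.map f) := by
  ext i j
  have h2 := congrArg f (congrFun₂ h.eq i j)
  simpa only [Matrix.mul_apply, map_sum, map_mul, adjacency_map, Matrix.map_apply] using h2

open Classical in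
theorem isMagicUnitary_one : IsMagicUnitary (1 : Matrix V V ℂ) where
  isStarProjection i j := by
    by_cases h : i = j
    · subst h; simp
    · simp [Matrix.one_apply_ne h]
  row_orthogonal i j k h := by
    by_cases hij : i = j
    · subst hij; simp [Matrix.one_apply_ne h]
    · simp [Matrix.one_apply_ne hij]
  col_orthogonal i j k h := by
    by_cases hij : j = i
    · subst hij; simp [Matrix.one_apply_ne h.symm]
    · simp [Matrix.one_apply_ne hij]
  row_sum i := by simp [Matrix.one_apply]
  col_sum j := by simp [Matrix.one_apply]

theorem IsMagicUnitary.op_transpose {D : Type v} [CStarAlgebra D] {U : Matrix V V D}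
    (hU : IsMagicUnitary U) :
    IsMagicUnitary (Matrix.of fun i j => MulOpposite.op (U j i)) where
  isStarProjection i j :=
    { isIdempotentElem :=
        MulOpposite.unop_injective (hU.isStarProjection j i).isIdempotentElem.eq
      isSelfAdjoint := MulOpposite.unop_injective (hU.isStarProjection j i).isSelfAdjoint.star_eq }
  row_orthogonal i j k h := MulOpposite.unop_injective (hU.col_orthogonal i k j h.symm)
  col_orthogonal i j k h := MulOpposite.unop_injective (hU.row_orthogonal i k j h.symm)
  row_sum i := MulOpposite.unop_injective (by simpa using hU.col_sum i)
  col_sum j := MulOpposite.unop_injective (by simpa using hU.row_sum j)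

theorem commute_adjacency_op {D : Type v} [CStarAlgebra D] {U : Matrix V V D} {X : SimpleGraph V}
    (h : Commute (adjacency D X) U) :
    Commute (adjacency Dᵐᵒᵖ X) (Matrix.of fun i j => MulOpposite.op (U j i)) := by
  have h1 : ∀ i j, MulOpposite.unop (adjacency Dᵐᵒᵖ X i j) = adjacency D X j i := fun i j => by
    by_cases h : X.Adj i j <;> simp [adjacency, h, X.adj_comm j i]
  ext i j
  refine MulOpposite.unop_injective ?_
  have h2 := congrFun₂ h.eq j i
  simp only [Matrix.mul_apply] at h2 ⊢
  simpa [h1] using h2.symm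

namespace MagicAlgebra

open MaxTensor

variable (𝒳 : Set (SimpleGraph V))

/-- The comultiplication `u i j ↦ ∑ k, u i k ⊗ u k j`. -/
def comul : MagicAlgebra 𝒳 →⋆ₐ[ℂ] MaxTensor (MagicAlgebra 𝒳) (MagicAlgebra 𝒳) :=
  lift ((u 𝒳).map inl * (u 𝒳).map inr)
    ((isMagicUnitary_u.map inl).mul (isMagicUnitary_u.map inr)
      fun _ _ _ _ => commute_inl_inr _ _)
    fun _ hX => (commute_adjacency_map (commute_u hX) inl).mul_right
      (commute_adjacency_map (commute_u hX) inr)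

open Classical in
/-- The counit `u i j ↦ δ i j`. -/
def counit : MagicAlgebra 𝒳 →⋆ₐ[ℂ] ℂ :=
  lift 1 isMagicUnitary_one fun _ _ => Commute.one_right _

/-- The antipode `u i j ↦ u j i`. -/
def antipode : MagicAlgebra 𝒳 →⋆ₐ[ℂ] (MagicAlgebra 𝒳)ᵐᵒᵖ :=
  lift (Matrix.of fun i j => MulOpposite.op (u 𝒳 j i)) isMagicUnitary_u.op_transpose
    fun _ hX => commute_adjacency_op (commute_u hX)

theorem comul_u (i j : V) : comul 𝒳 (u 𝒳 i j) = ∑ k, inl (u 𝒳 i k) * inr (u 𝒳 k j) :=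
  lift_u _ _ _ i j

open Classical in
theorem counit_u (i j : V) : counit 𝒳 (u 𝒳 i j) = if i = j then 1 else 0 :=
  (lift_u _ _ _ i j).trans Matrix.one_apply

theorem antipode_u (i j : V) : (antipode 𝒳 (u 𝒳 i j)).unop = u 𝒳 j i :=
  congrArg MulOpposite.unop (lift_u _ _ _ i j)

theorem antipode_antipode' (x : MagicAlgebra 𝒳) :
    (antipode 𝒳 (antipode 𝒳 x).unop).unop = x := by
  let f : MagicAlgebra 𝒳 →⋆ₐ[ℂ] MagicAlgebra 𝒳 :=
    { toFun := fun x => (antipode 𝒳 (antipode 𝒳 x).unop).unop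
      map_one' := by simp
      map_mul' := fun x y => by simp
      map_zero' := by simp
      map_add' := fun x y => by simp
      commutes' := fun c => by
        rw [AlgHomClass.commutes, MulOpposite.algebraMap_apply, MulOpposite.unop_op,
          AlgHomClass.commutes, MulOpposite.algebraMap_apply, MulOpposite.unop_op]
      map_star' := fun x => by
        rw [map_star, MulOpposite.unop_star, map_star, MulOpposite.unop_star] }
  have hf : f = .id ℂ _ := hom_ext fun i j => by
    change (antipode 𝒳 (antipode 𝒳 (u 𝒳 i j)).unop).unop = u 𝒳 i j
    rw [antipode_u, antipode_u]
  exact DFunLike.congr_fun hf x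

/-- The Hopf C*-algebra structure, with `Δ(u i j) = ∑ k, u i k ⊗ u k j`, `ε(u i j) = δ i j` and
`S(u i j) = u j i`. -/
instance : HopfCStarAlgebra (MagicAlgebra 𝒳) where
  comul := comul 𝒳
  counit := counit 𝒳
  antipode := antipode 𝒳
  coassoc x := by
    have h : (assoc _ _ _).comp ((map (comul 𝒳) (.id ℂ _)).comp (comul 𝒳)) =
        (map (.id ℂ _) (comul 𝒳)).comp (comul 𝒳) := hom_ext fun i j => by
      simp only [StarAlgHom.comp_apply, comul_u, map_sum, map_mul, map_inl, map_inr,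
        assoc_inl_inl, assoc_inl_inr, assoc_inr, StarAlgHom.coe_id, id_eq, Finset.sum_mul,
        Finset.mul_sum, mul_assoc]
      exact Finset.sum_comm
    exact DFunLike.congr_fun h x
  counit_left x := by
    classical
    have h : (sliceLeft (counit 𝒳)).comp (comul 𝒳) = .id ℂ _ := hom_ext fun i j => by
      simp [comul_u, counit_u]
    exact DFunLike.congr_fun h x
  counit_right x := by
    classical
    have h : (sliceRight (counit 𝒳)).comp (comul 𝒳) = .id ℂ _ := hom_ext fun i j => by
      simp [comul_u, counit_u]
    exact DFunLike.congr_fun h x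
  antipode_antipode := antipode_antipode' 𝒳
  antipode_axiom := by
    refine ⟨StarAlgebra.adjoin ℂ {x | ∃ i j, x = u 𝒳 i j}, fun x => ?_, ?_⟩
    · have hx : x ∈ (StarAlgebra.adjoin ℂ {x | ∃ i j, x = u 𝒳 i j}).topologicalClosure := by
        rw [closure_u]; trivial
      exact hx
    · refine antipodeAxiomAt_adjoin _ _ _ (antipode_antipode' 𝒳) _ ?_
      rintro _ ⟨i, j, rfl⟩
      have hu : ∀ i j, u 𝒳 i j ∈ StarAlgebra.adjoin ℂ {x | ∃ i j, x = u 𝒳 i j} := fun i j =>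
        StarAlgebra.subset_adjoin ℂ _ ⟨i, j, rfl⟩
      have hm := isMagicUnitary_u (𝒳 := 𝒳)
      refine ⟨∑ k, u 𝒳 i k ⊗ₜ[ℂ] u 𝒳 k j,
        sum_mem fun k _ => tmul_mem_tensorSquare (hu i k) (hu k j), ?_, ?_, ?_⟩
      · simp only [comul_u, map_sum, of_tmul]
      · simp only [map_sum, antipodeMulLeft_tmul, antipode_u, counit_u]
        by_cases h : i = j
        · subst h
          simp [(hm.isStarProjection _ _).isIdempotentElem.eq, hm.col_sum]
        · simp [h, hm.row_orthogonal _ i j h]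
      · simp only [map_sum, antipodeMulRight_tmul, antipode_u, counit_u]
        by_cases h : i = j
        · subst h
          simp [(hm.isStarProjection _ _).isIdempotentElem.eq, hm.row_sum]
        · simp [h, hm.col_orthogonal _ i j h]

end MagicAlgebra

/-- The Hopf C*-algebra `A_s(n)` of the quantum permutation group: the universal C*-algebra
generated by the entries of an `n × n` magic unitary. -/
abbrev QuantumPerm (n : ℕ) : Type := MagicAlgebra (∅ : Set (SimpleGraph (Fin n)))

/-- The Hopf C*-algebra `A(X)` of the quantum automorphism group of a finite graph `X`: the
quotient of the universal C*-algebra generated by the entries of a magic unitary `u` indexed by the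
vertices by the relation `du = ud`, where `d` is the adjacency matrix. -/
abbrev QuantumAut (X : SimpleGraph V) : Type u := MagicAlgebra ({X} : Set (SimpleGraph V))

end Magic

/-- The direct product of graphs: `(i, α) ∼ (j, β)` if and only if `i ∼ j` and `α ∼ β`. -/
def directProd {V : Type u} {W : Type v} (X : SimpleGraph V) (Y : SimpleGraph W) :
    SimpleGraph (V × W) where
  Adj p q := X.Adj p.1 q.1 ∧ Y.Adj p.2 q.2
  symm := ⟨fun _ _ h => ⟨h.1.symm, h.2.symm⟩⟩
  loopless := ⟨fun _ h => h.1.ne rfl⟩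

/-- The prism with basis `X`: the Cartesian product of the segment `K₂` with `X`. -/
def prism {V : Type u} (X : SimpleGraph V) : SimpleGraph (Fin 2 × V) :=
  (⊤ : SimpleGraph (Fin 2)) □ X

end QSym

end

open QSym

open scoped TensorProduct ComplexConjugate

noncomputable section

namespace QSym

universe u v w

/-! ### Relations preserved by a magic unitary -/

/-! Let z be the universal magic unitary of a graph. A matrix M with natural number entries commutes
with z exactly when z i j * z k l = 0 whenever M i k ≠ M j l (`IsMagicUnitary.preserves_iff`).
Commutation is stable under matrix products, while the vanishing condition is stable under taking
joint values and under applying any function to the values. So z respects every relation that can be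
obtained from equality and adjacency by counting walks and selecting level sets, and the theorem
becomes a matter of finding the right counts.

For K_m × K_n and for the prism over K_n, equality and adjacency together amount to the number R of
coordinates in which two vertices agree. The square of R weights agreement in the first and in the
second coordinate by the sizes of the opposite factors. When the sizes differ, R and its square
separate the two coordinates (`IsMagicUnitary.preserves_fst_snd`). A magic unitary over V × W that
preserves equality in each coordinate is the product of a magic unitary over V and a commuting one
over W, obtained as partial sums of its entries; this gives the tensor decomposition
(`hopfIsomorphic_maxTensor`). The prism over K_n has K_2 as a factor, and A_s(2) = C(ℤ₂) because a 2
× 2 magic unitary has only the entries p and 1 - p. The cube is isomorphic to K_2 × K_4, so it falls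
under the same result.

For the prism over C_n with n odd, rungs and cycle edges are told apart by the number of squares
through them, two against one (`preserves_prism_relations`). Preserving the rungs makes the entries
of z invariant under the exchange of the two cycles in both indices. Along a cycle of length other
than 4, entries in adjacent rows commute, and each row is a polynomial in the two preceding ones, so
all the entries commute (`commute_rows`, `commute_of_preserves_prism`). A commutative quantum
automorphism group is the algebra of functions on the classical one (`hopfIsomorphic_functions`).
The latter consists of the translations and reflections of ℤ₂ × ℤ_n, which is ℤ_{2n} for n odd,
hence it is dihedral. -/

section Preserves

variable {V : Type u} {A : Type v}

/-- The matrix `u` preserves the `S`-valued relation `M` if `u i j * u k l` vanishes unless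
`M i k = M j l`. -/
def Preserves [Ring A] (u : Matrix V V A) {S : Type w} (M : V → V → S) : Prop :=
  ∀ i j k l, M i k ≠ M j l → u i j * u k l = 0

/-- Any function of the values of a preserved relation is preserved. This is what extracts level
sets from counting matrices. -/
theorem Preserves.of_imp [Ring A] {u : Matrix V V A} {S : Type*} {T : Type*} {M : V → V → S}
    {N : V → V → T} (hM : Preserves u M) (h : ∀ i j k l, M i k = M j l → N i k = N j l) :
    Preserves u N :=
  fun i j k l hN => hM i j k l fun hM => hN (h i j k l hM)

theorem Preserves.prod [Ring A] {u : Matrix V V A} {S : Type*} {T : Type*} {M : V → V → S}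
    {N : V → V → T} (hM : Preserves u M) (hN : Preserves u N) :
    Preserves u fun i k => (M i k, N i k) := by
  intro i j k l h
  by_cases h1 : M i k = M j l
  · exact hN i j k l fun h2 => h (Prod.ext h1 h2)
  · exact hM i j k l h1

theorem Preserves.pi [Ring A] {u : Matrix V V A} {ι : Type*} {S : Type*} {M : ι → V → V → S}
    (hM : ∀ a, Preserves u (M a)) : Preserves u fun i k a => M a i k := by
  intro i j k l h
  obtain ⟨a, ha⟩ := Function.ne_iff.mp h
  exact hM a i j k l ha

/-- Row and column orthogonality in a single statement. -/
theorem IsMagicUnitary.preserves_eq [Fintype V] [Ring A] [StarRing A] {u : Matrix V V A}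
    (hu : IsMagicUnitary u) : Preserves u fun i k : V => i = k := by
  intro i j k l h
  by_cases hik : i = k
  · subst hik
    exact hu.row_orthogonal _ _ _ fun hjl => h (by simp [hjl])
  · by_cases hjl : j = l
    · subst hjl
      exact hu.col_orthogonal _ _ _ hik
    · simp [hik, hjl] at h

open Classical in
theorem preserves_adj_iff_ite [Ring A] {u : Matrix V V A} (X : SimpleGraph V) :
    Preserves u X.Adj ↔ Preserves u fun i k => if X.Adj i k then 1 else 0 := by
  refine ⟨fun h => h.of_imp fun i j k l h => by simp [h], fun h => h.of_imp fun i j k l h => ?_⟩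
  by_cases h1 : X.Adj i k <;> by_cases h2 : X.Adj j l <;> simp_all

variable [Fintype V] [CStarAlgebra A] {u : Matrix V V A}

/-- A magic unitary preserves a numerical matrix if and only if it commutes with it. -/
theorem IsMagicUnitary.preserves_iff (hu : IsMagicUnitary u) (M : V → V → ℕ) :
    Preserves u M ↔ ∀ i l, ∑ k, M i k • u k l = ∑ j, M j l • u i j := by
  classical
  constructor
  · intro h i l
    calc ∑ k, M i k • u k l = ∑ k, ∑ j, M i k • (u i j * u k l) := by
          refine Finset.sum_congr rfl fun k _ => ?_
          rw [← Finset.smul_sum, ← Finset.sum_mul, hu.row_sum, one_mul]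
      _ = ∑ k, ∑ j, M j l • (u i j * u k l) := by
          refine Finset.sum_congr rfl fun k _ => Finset.sum_congr rfl fun j _ => ?_
          by_cases hM : M i k = M j l
          · rw [hM]
          · rw [h i j k l hM, smul_zero, smul_zero]
      _ = ∑ j, M j l • u i j := by
          rw [Finset.sum_comm]
          refine Finset.sum_congr rfl fun j _ => ?_
          rw [← Finset.smul_sum, ← Finset.mul_sum, hu.col_sum, mul_one]
  · intro h i j k l hM
    -- Sandwiched between these projections, the left sum keeps only its term at k, by column
    -- orthogonality, and the right sum only its term at j, by row orthogonality. What remains is M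
    -- i k and M j l times the same product.
    have h1 := congrArg (fun x => u i j * x * u k l) (h i l)
    simp only [Finset.mul_sum, Finset.sum_mul] at h1
    rw [Finset.sum_eq_single k, Finset.sum_eq_single j] at h1
    · rw [mul_smul_comm, smul_mul_assoc, mul_assoc, (hu.isStarProjection k l).isIdempotentElem.eq,
        mul_smul_comm, smul_mul_assoc, (hu.isStarProjection i j).isIdempotentElem.eq,
        ← Nat.cast_smul_eq_nsmul ℂ, ← Nat.cast_smul_eq_nsmul ℂ, ← sub_eq_zero, ← sub_smul,
        smul_eq_zero, sub_eq_zero] at h1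
      exact h1.resolve_left fun h => hM (Nat.cast_injective h)
    · intro b _ hb
      rw [mul_smul_comm, hu.row_orthogonal i j b hb.symm, smul_zero, zero_mul]
    · simp
    · intro b _ hb
      rw [mul_assoc, smul_mul_assoc, hu.col_orthogonal l b k hb, smul_zero, mul_zero]
    · simp

/-- In terms of `IsMagicUnitary.preserves_iff`, matrices that commute with u are closed under
products. Counting two-step walks in this way is the source of all the new relations below. -/
theorem IsMagicUnitary.preserves_mul (hu : IsMagicUnitary u) {M N : V → V → ℕ}
    (hM : Preserves u M) (hN : Preserves u N) :
    Preserves u fun i k => ∑ m, M i m * N m k := by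
  rw [hu.preserves_iff] at hM hN ⊢
  intro i l
  calc ∑ k, (∑ m, M i m * N m k) • u k l = ∑ m, M i m • ∑ k, N m k • u k l := by
        simp_rw [Finset.sum_smul, Finset.smul_sum, smul_smul]
        exact Finset.sum_comm
    _ = ∑ j, N j l • ∑ m, M i m • u m j := by
        simp_rw [hN, Finset.smul_sum]
        rw [Finset.sum_comm]
        simp_rw [smul_comm (N _ l)]
    _ = ∑ j, (∑ m, M j m * N m l) • u i j := by
        simp_rw [hM, Finset.smul_sum, Finset.sum_smul, smul_smul]
        rw [Finset.sum_comm]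
        simp_rw [mul_comm]

/-- Translates the defining relation du = ud into the vanishing of products of entries; the case of
a 0-1 matrix in `IsMagicUnitary.preserves_iff`. -/
theorem IsMagicUnitary.commute_adjacency_iff (hu : IsMagicUnitary u) (X : SimpleGraph V) :
    Commute (adjacency A X) u ↔ Preserves u X.Adj := by
  classical
  rw [preserves_adj_iff_ite, hu.preserves_iff, commute_iff_eq, ← Matrix.ext_iff]
  simp [Matrix.mul_apply, adjacency]

theorem preserves_u {𝒳 : Set (SimpleGraph V)} {X : SimpleGraph V} (hX : X ∈ 𝒳) :
    Preserves (MagicAlgebra.u 𝒳) X.Adj :=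
  (MagicAlgebra.isMagicUnitary_u.commute_adjacency_iff X).mp (MagicAlgebra.commute_u hX)

end Preserves

theorem unop_opHom {A : Type u} {B : Type v} [CStarAlgebra A] [CStarAlgebra B] (f : A →⋆ₐ[ℂ] B)
    (x : Aᵐᵒᵖ) : (opHom f x).unop = f x.unop := rfl

/-! ### Isomorphisms of Hopf C*-algebras -/

section HopfIso

open HopfCStarAlgebra MaxTensor

variable {A : Type u} {B : Type v} {C : Type w} [CStarAlgebra A] [CStarAlgebra B] [CStarAlgebra C]
  [HopfCStarAlgebra A] [HopfCStarAlgebra B] [HopfCStarAlgebra C]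

theorem HopfIsomorphic.of_homs (f : A →⋆ₐ[ℂ] B) (g : B →⋆ₐ[ℂ] A) (hgf : g.comp f = .id ℂ A)
    (hfg : f.comp g = .id ℂ B) (hΔ : ∀ a, comul (f a) = map f f (comul a))
    (hε : ∀ a, counit (f a) = counit a)
    (hS : ∀ a, (antipode (f a)).unop = f (antipode a).unop) : HopfIsomorphic A B :=
  ⟨StarAlgEquiv.ofStarAlgHom f g hgf hfg, hΔ, hε, hS⟩

theorem HopfIsomorphic.trans (h : HopfIsomorphic A B) (h' : HopfIsomorphic B C) :
    HopfIsomorphic A C := by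
  obtain ⟨e, h1, h2, h3⟩ := h
  obtain ⟨e', h1', h2', h3'⟩ := h'
  refine ⟨e.trans e', fun a => ?_, fun a => (h2' _).trans (h2 a), fun a => ?_⟩
  · refine (h1' (e a)).trans ?_
    rw [h1]
    exact eq_of_inl_inr ((map (e' : B →⋆ₐ[ℂ] C) (e' : B →⋆ₐ[ℂ] C)).comp
      (map (e : A →⋆ₐ[ℂ] B) (e : A →⋆ₐ[ℂ] B)))
      (map ((e.trans e' : A ≃⋆ₐ[ℂ] C) : A →⋆ₐ[ℂ] C) ((e.trans e' : A ≃⋆ₐ[ℂ] C) : A →⋆ₐ[ℂ] C))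
      (fun x => by simp) (fun x => by simp) (comul a)
  · refine (h3' (e a)).trans ?_
    rw [h3]
    rfl

/-- Serves to replace A_s(2) by C(ℤ₂) inside a tensor product. Everything is checked on the two
tensor factors. -/
theorem HopfIsomorphic.maxTensor_left (h : HopfIsomorphic A B) :
    HopfIsomorphic (MaxTensor A C) (MaxTensor B C) := by
  obtain ⟨e, h1, h2, h3⟩ := h
  let f : MaxTensor A C →⋆ₐ[ℂ] MaxTensor B C := map (e : A →⋆ₐ[ℂ] B) (.id ℂ C)
  let g : MaxTensor B C →⋆ₐ[ℂ] MaxTensor A C := map (e.symm : B →⋆ₐ[ℂ] A) (.id ℂ C)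
  have fl : ∀ a, f (inl a) = inl (e a) := fun a => map_inl _ _ _
  have fr : ∀ c, f (inr c) = inr c := fun c => map_inr _ _ _
  have gl : ∀ b, g (inl b) = inl (e.symm b) := fun a => map_inl _ _ _
  have gr : ∀ c, g (inr c) = inr c := fun c => map_inr _ _ _
  refine .of_homs f g (hom_ext (fun a => ?_) fun c => ?_) (hom_ext (fun a => ?_) fun c => ?_)
    (fun x => ?_) (fun x => ?_) (fun x => MulOpposite.op_injective ?_)
  · simp [fl, gl]
  · simp [fr, gr]
  · simp [fl, gl]
  · simp [fr, gr]
  · refine eq_of_inl_inr ((comul' B C).comp f) ((map f f).comp (comul' A C)) (fun a => ?_)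
      (fun c => ?_) x
    · simp only [StarAlgHom.comp_apply, fl, comul'_inl, h1]
      exact eq_of_inl_inr ((map inl inl).comp (map (e : A →⋆ₐ[ℂ] B) (e : A →⋆ₐ[ℂ] B)))
        ((map f f).comp (map inl inl)) (fun x => by simp [fl]) (fun x => by simp [fl]) (comul a)
    · simp only [StarAlgHom.comp_apply, fr, comul'_inr]
      exact eq_of_inl_inr (map inr inr)
        ((map f f).comp (map inr inr)) (fun x => by simp [fr]) (fun x => by simp [fr]) (comul c)
  · exact eq_of_inl_inr ((counit' B C).comp f) (counit' A C)
      (fun a => by simp [fl, counit'_inl, h2]) (fun c => by simp [fr, counit'_inr]) x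
  · exact eq_of_inl_inr ((antipode' B C).comp f) ((opHom f).comp (antipode' A C))
      (fun a => MulOpposite.unop_injective <| by
        simp [fl, antipode'_inl, h3, unop_opHom])
      (fun c => MulOpposite.unop_injective <| by
        simp [fr, antipode'_inr, unop_opHom]) x

variable {V : Type u} [Fintype V] {𝒳 : Set (SimpleGraph V)}

open MagicAlgebra in
open Classical in
/-- A *-isomorphism from the algebra of a magic unitary is an isomorphism of Hopf C*-algebras if
it sends the magic unitary to a corepresentation matrix. -/
theorem hopfIsomorphic_of_magic (f : MagicAlgebra 𝒳 →⋆ₐ[ℂ] B) (g : B →⋆ₐ[ℂ] MagicAlgebra 𝒳)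
    (hgf : ∀ i j, g (f (u 𝒳 i j)) = u 𝒳 i j) (hfg : ∀ b, f (g b) = b)
    (hΔ : ∀ i j, comul (f (u 𝒳 i j)) = ∑ k, inl (f (u 𝒳 i k)) * inr (f (u 𝒳 k j)))
    (hε : ∀ i j, counit (f (u 𝒳 i j)) = if i = j then 1 else 0)
    (hS : ∀ i j, (antipode (f (u 𝒳 i j))).unop = f (u 𝒳 j i)) :
    HopfIsomorphic (MagicAlgebra 𝒳) B := by
  refine .of_homs f g (hom_ext hgf) (StarAlgHom.ext hfg)
    (DFunLike.congr_fun (f := comul.comp f) (g := (map f f).comp (comul 𝒳)) (hom_ext fun i j => ?_))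
    (DFunLike.congr_fun (f := counit.comp f) (g := counit 𝒳) (hom_ext fun i j => ?_))
    (fun a => MulOpposite.op_injective <|
      DFunLike.congr_fun (f := antipode.comp f) (g := (opHom f).comp (antipode 𝒳))
        (hom_ext fun i j => MulOpposite.unop_injective ?_) a)
  · simp [comul_u, hΔ]
  · simp [counit_u, hε]
  · simp [unop_opHom, antipode_u, hS]

end HopfIso

theorem IsMagicUnitary.submatrix {V : Type u} {W : Type v} [Fintype V] [Fintype W] {A : Type w}
    [Ring A] [StarRing A] {u : Matrix W W A} (hu : IsMagicUnitary u) (σ : V ≃ W) :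
    IsMagicUnitary (u.submatrix σ σ) where
  isStarProjection _ _ := hu.isStarProjection _ _
  row_orthogonal _ _ _ h := hu.row_orthogonal _ _ _ (σ.injective.ne h)
  col_orthogonal _ _ _ h := hu.col_orthogonal _ _ _ (σ.injective.ne h)
  row_sum i := (Equiv.sum_comp σ (u (σ i))).trans (hu.row_sum _)
  col_sum j := (Equiv.sum_comp σ (u · (σ j))).trans (hu.col_sum _)

open MagicAlgebra in
/-- Isomorphic graphs have isomorphic quantum automorphism groups. -/
theorem hopfIsomorphic_of_iso {V : Type u} {W : Type v} [Fintype V] [Fintype W] {X : SimpleGraph V}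
    {Y : SimpleGraph W} (σ : X ≃g Y) : HopfIsomorphic (QuantumAut X) (QuantumAut Y) := by
  classical
  have h1 : IsMagicUnitary ((u {Y}).submatrix σ.toEquiv σ.toEquiv) := isMagicUnitary_u.submatrix _
  have h2 : IsMagicUnitary ((u {X}).submatrix σ.symm.toEquiv σ.symm.toEquiv) :=
    isMagicUnitary_u.submatrix _
  let f : QuantumAut X →⋆ₐ[ℂ] QuantumAut Y := lift (𝒳 := {X}) _ h1 fun Z hZ => by
    obtain rfl : Z = X := hZ
    refine (h1.commute_adjacency_iff _).mpr fun i j k l h => ?_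
    refine preserves_u (Set.mem_singleton _) _ _ _ _ ?_
    simpa [σ.map_adj_iff] using h
  let g : QuantumAut Y →⋆ₐ[ℂ] QuantumAut X := lift (𝒳 := {Y}) _ h2 fun Z hZ => by
    obtain rfl : Z = Y := hZ
    refine (h2.commute_adjacency_iff _).mpr fun i j k l h => ?_
    refine preserves_u (Set.mem_singleton _) _ _ _ _ ?_
    simpa [σ.symm.map_adj_iff] using h
  have hf : ∀ i j, f (u {X} i j) = u {Y} (σ i) (σ j) := lift_u _ h1 _
  have hg : ∀ i j, g (u {Y} i j) = u {X} (σ.symm i) (σ.symm j) := lift_u _ h2 _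
  refine hopfIsomorphic_of_magic f g (fun i j => ?_) (DFunLike.congr_fun (f := f.comp g) (g := .id ℂ _)
    (hom_ext fun i j => ?_)) (fun i j => ?_) (fun i j => ?_) (fun i j => ?_)
  · simp [hf, hg]
  · simp [hf, hg]
  · rw [hf]
    refine (comul_u {Y} _ _).trans ?_
    simp_rw [hf]
    exact (Equiv.sum_comp σ.toEquiv _).symm
  · rw [hf]
    refine (counit_u {Y} _ _).trans ?_
    simp
  · rw [hf, hf]
    exact antipode_u {Y} _ _

/-! ### Tensor product decompositions -/

/-! ### Magic unitaries over a product built from two commuting ones. -/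

section Kronecker

variable {V : Type u} {W : Type v} [Fintype V] [Fintype W] {D : Type w} [Ring D] [StarRing D]

/-- The matrix `(u i j * w k l)`, indexed by pairs. -/
def kron (u : Matrix V V D) (w : Matrix W W D) : Matrix (V × W) (V × W) D :=
  Matrix.of fun p q => u p.1 q.1 * w p.2 q.2

omit [Fintype V] [Fintype W] [StarRing D] in
theorem kron_apply (u : Matrix V V D) (w : Matrix W W D) (p q : V × W) :
    kron u w p q = u p.1 q.1 * w p.2 q.2 := rfl

variable {u : Matrix V V D} {w : Matrix W W D}

omit [Fintype V] [Fintype W] [StarRing D] in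
theorem kron_mul_kron (hc : ∀ i j k l, Commute (u i j) (w k l)) (p q r s : V × W) :
    kron u w p q * kron u w r s = (u p.1 q.1 * u r.1 s.1) * (w p.2 q.2 * w r.2 s.2) :=
  (hc _ _ _ _).symm.mul_mul_mul_comm _ _

theorem IsMagicUnitary.kron (hu : IsMagicUnitary u) (hw : IsMagicUnitary w)
    (hc : ∀ i j k l, Commute (u i j) (w k l)) : IsMagicUnitary (kron u w) where
  isStarProjection p q :=
    { isIdempotentElem := by
        change QSym.kron u w p q * QSym.kron u w p q = QSym.kron u w p q
        rw [kron_mul_kron hc, (hu.isStarProjection _ _).isIdempotentElem.eq,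
          (hw.isStarProjection _ _).isIdempotentElem.eq]
        rfl
      isSelfAdjoint := by
        change star (QSym.kron u w p q) = QSym.kron u w p q
        rw [kron_apply, star_mul, (hu.isStarProjection _ _).isSelfAdjoint.star_eq,
          (hw.isStarProjection _ _).isSelfAdjoint.star_eq, (hc _ _ _ _).eq] }
  row_orthogonal i j k h := by
    rw [kron_mul_kron hc]
    by_cases h1 : j.1 = k.1
    · rw [hw.row_orthogonal _ _ _ fun h2 => h (Prod.ext h1 h2), mul_zero]
    · rw [hu.row_orthogonal _ _ _ h1, zero_mul]
  col_orthogonal i j k h := by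
    rw [kron_mul_kron hc]
    by_cases h1 : j.1 = k.1
    · rw [hw.col_orthogonal _ _ _ fun h2 => h (Prod.ext h1 h2), mul_zero]
    · rw [hu.col_orthogonal _ _ _ h1, zero_mul]
  row_sum i := by
    simp_rw [Fintype.sum_prod_type, kron_apply, ← Finset.mul_sum, hw.row_sum, mul_one, hu.row_sum]
  col_sum i := by
    simp_rw [Fintype.sum_prod_type, kron_apply, ← Finset.mul_sum, hw.col_sum, mul_one, hu.col_sum]

theorem Preserves.kron_left {S : Type*} {M : V → V → S} (hM : Preserves u M)
    (hc : ∀ i j k l, Commute (u i j) (w k l)) :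
    Preserves (kron u w) fun p q => M p.1 q.1 := by
  intro p q r s h
  rw [kron_mul_kron hc, hM _ _ _ _ h, zero_mul]

theorem Preserves.kron_right {S : Type*} {M : W → W → S} (hM : Preserves w M)
    (hc : ∀ i j k l, Commute (u i j) (w k l)) :
    Preserves (kron u w) fun p q => M p.2 q.2 := by
  intro p q r s h
  rw [kron_mul_kron hc, hM _ _ _ _ h, mul_zero]

end Kronecker

/-! ### Splitting a magic unitary over a product into its two factors. -/

section Factors

variable {V : Type u} {W : Type v} [Fintype W] {D : Type w} [CStarAlgebra D]

/-- The matrix over `V` obtained by summing the entries of a matrix over `V × W` along `W`. -/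
def leftFactor [Nonempty W] (z : Matrix (V × W) (V × W) D) : Matrix V V D :=
  Matrix.of fun i j => ∑ b, z (i, Classical.arbitrary W) (j, b)

variable [Fintype V] {z : Matrix (V × W) (V × W) D}

/-- The 0-1 matrix of equal first coordinates commutes with z; these are the (p, q) entries of the
two products. The left side does not involve q.2 and the right side does not involve p.2, so the
common value depends on the first coordinates only. -/
theorem IsMagicUnitary.row_sum_eq_col_sum (hz : IsMagicUnitary z)
    (h1 : Preserves z fun p q => p.1 = q.1) (p q : V × W) :
    ∑ b, z p (q.1, b) = ∑ b, z (p.1, b) q := by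
  classical
  have h : Preserves z fun p q => if p.1 = q.1 then 1 else 0 :=
    h1.of_imp fun i j k l h => by simp only [h]
  have h2 := (hz.preserves_iff _).mp h p q
  simp only [Fintype.sum_prod_type_right, ite_smul, one_smul, zero_smul, Finset.sum_ite_eq,
    Finset.sum_ite_eq', Finset.mem_univ, if_true] at h2
  exact h2.symm

variable [Nonempty W]

/-- The arbitrary base point in `leftFactor` is immaterial: passing from a row sum to a column sum
and back changes it to any a. -/
theorem leftFactor_eq (hz : IsMagicUnitary z) (h1 : Preserves z fun p q => p.1 = q.1) (i j : V)
    (a : W) : leftFactor z i j = ∑ b, z (i, a) (j, b) :=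
  (hz.row_sum_eq_col_sum h1 _ (j, a)).trans (hz.row_sum_eq_col_sum h1 (i, a) (j, a)).symm

theorem leftFactor_eq' (hz : IsMagicUnitary z) (h1 : Preserves z fun p q => p.1 = q.1) (i j : V)
    (b : W) : leftFactor z i j = ∑ a, z (i, a) (j, b) :=
  hz.row_sum_eq_col_sum h1 _ (j, b)

theorem IsMagicUnitary.leftFactor (hz : IsMagicUnitary z)
    (h1 : Preserves z fun p q => p.1 = q.1) : IsMagicUnitary (leftFactor z) where
  isStarProjection i j :=
    { isIdempotentElem := by
        change (∑ b, _) * (∑ b, _) = ∑ b, _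
        rw [Finset.sum_mul_sum]
        refine Finset.sum_congr rfl fun b _ => ?_
        rw [Finset.sum_eq_single b]
        · exact (hz.isStarProjection _ _).isIdempotentElem
        · exact fun c _ hc => hz.row_orthogonal _ _ _ fun h => hc (Prod.ext_iff.mp h).2.symm
        · simp
      isSelfAdjoint := by
        change star (∑ b, _) = ∑ b, _
        rw [star_sum]
        exact Finset.sum_congr rfl fun b _ => (hz.isStarProjection _ _).isSelfAdjoint }
  row_orthogonal i j k h := by
    change (∑ b, _) * (∑ b, _) = 0
    rw [Finset.sum_mul_sum]
    exact Finset.sum_eq_zero fun b _ => Finset.sum_eq_zero fun c _ =>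
      hz.row_orthogonal _ _ _ fun h' => h (Prod.ext_iff.mp h').1
  col_orthogonal i j k h := by
    change (∑ b, _) * (∑ b, _) = 0
    rw [Finset.sum_mul_sum]
    exact Finset.sum_eq_zero fun b _ => Finset.sum_eq_zero fun c _ =>
      h1 _ _ _ _ (by simp [h])
  row_sum i := (Fintype.sum_prod_type _).symm.trans (hz.row_sum _)
  col_sum j := by
    simp_rw [leftFactor_eq' hz h1 _ j (Classical.arbitrary W)]
    exact (Fintype.sum_prod_type _).symm.trans (hz.col_sum _)

omit [Fintype V] in
theorem Preserves.leftFactor {S : Type*} {M : V → V → S}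
    (hM : Preserves z fun p q => M p.1 q.1) : Preserves (leftFactor z) M := by
  intro i j k l h
  change (∑ b, _) * (∑ b, _) = 0
  rw [Finset.sum_mul_sum]
  exact Finset.sum_eq_zero fun b _ => Finset.sum_eq_zero fun c _ => hM _ _ _ _ h

variable [Nonempty V]

/-- The matrix over `W` obtained by summing the entries of a matrix over `V × W` along `V`. -/
def rightFactor (z : Matrix (V × W) (V × W) D) : Matrix W W D :=
  leftFactor (z.submatrix (Equiv.prodComm W V) (Equiv.prodComm W V))

omit [Nonempty W] in
theorem IsMagicUnitary.rightFactor (hz : IsMagicUnitary z)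
    (h2 : Preserves z fun p q => p.2 = q.2) : IsMagicUnitary (rightFactor z) :=
  (hz.submatrix (Equiv.prodComm W V)).leftFactor fun _ _ _ _ h => h2 _ _ _ _ h

omit [Nonempty W] [Fintype W] in
theorem Preserves.rightFactor {S : Type*} {M : W → W → S}
    (hM : Preserves z fun p q => M p.2 q.2) : Preserves (rightFactor z) M :=
  Preserves.leftFactor fun _ _ _ _ h => hM _ _ _ _ h

omit [Nonempty W] in
theorem rightFactor_eq (hz : IsMagicUnitary z) (h2 : Preserves z fun p q => p.2 = q.2) (a b : W)
    (i : V) : rightFactor z a b = ∑ j, z (i, a) (j, b) :=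
  leftFactor_eq (hz.submatrix (Equiv.prodComm W V)) (fun _ _ _ _ h => h2 _ _ _ _ h) a b i

variable (hz : IsMagicUnitary z) (h1 : Preserves z fun p q => p.1 = q.1)
  (h2 : Preserves z fun p q => p.2 = q.2)

include hz h1 h2

/-- Both factors can be written as sums of entries of the one row (i, a). By row orthogonality only
the entry common to the two sums survives in the product. -/
theorem leftFactor_mul_rightFactor (i j : V) (a b : W) :
    leftFactor z i j * rightFactor z a b = z (i, a) (j, b) := by
  rw [leftFactor_eq hz h1 i j a, rightFactor_eq hz h2 a b i, Finset.sum_mul_sum,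
    Finset.sum_eq_single b, Finset.sum_eq_single j]
  · exact (hz.isStarProjection _ _).isIdempotentElem
  · exact fun k _ hk => hz.row_orthogonal _ _ _ fun h => hk (Prod.ext_iff.mp h).1.symm
  · simp
  · exact fun c _ hc => Finset.sum_eq_zero fun k _ =>
      hz.row_orthogonal _ _ _ fun h => hc (Prod.ext_iff.mp h).2
  · simp

/-- Two self-adjoint elements whose product is self-adjoint commute, and here the product is an
entry of z. -/
theorem commute_leftFactor_rightFactor (i j : V) (a b : W) :
    Commute (leftFactor z i j) (rightFactor z a b) := by
  have h := leftFactor_mul_rightFactor hz h1 h2 i j a b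
  have hs := congrArg star h
  rw [star_mul, ((hz.leftFactor h1).isStarProjection i j).isSelfAdjoint.star_eq,
    ((hz.rightFactor h2).isStarProjection a b).isSelfAdjoint.star_eq,
    (hz.isStarProjection _ _).isSelfAdjoint.star_eq] at hs
  exact h.trans hs.symm

end Factors

/-- The condition is closed and stable under the algebra operations. As the generators are
self-adjoint, their noncommutative polynomials are already dense, so nothing is required of the
adjoint of d. -/
theorem MagicAlgebra.commute_hom {V : Type u} [Fintype V] {𝒳 : Set (SimpleGraph V)} {D : Type v}
    [CStarAlgebra D] (f : MagicAlgebra 𝒳 →⋆ₐ[ℂ] D) {d : D}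
    (h : ∀ i j, Commute (f (u 𝒳 i j)) d) (x : MagicAlgebra 𝒳) : Commute (f x) d := by
  have key : ∀ y, Commute (f (of 𝒳 y)) d := fun y => by
    induction y using FreeStarAlgebra.induction with
    | h1 => rw [map_one, map_one]; exact Commute.one_left d
    | hι y x hx => rw [map_mul, map_mul]; exact (h y.1 y.2).mul_left hx
    | hadd x y hx hy => rw [map_add, map_add]; exact hx.add_left hy
    | hsmul c x hx => rw [map_smul, map_smul]; exact hx.smul_left c
  have hf := continuous_hom f
  exact induction (P := fun x => Commute (f x) d) (isClosed_eq (by fun_prop) (by fun_prop)) key x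

/-! ### The quantum automorphism group as a tensor product. -/

section TensorIso

open MaxTensor MagicAlgebra HopfCStarAlgebra

variable {V : Type u} {W : Type v} [Fintype V] [Fintype W] [Nonempty V] [Nonempty W]

/-- If the magic unitary over `V × W` preserves the equality and the graphs in each coordinate,
and these determine the graphs on `V × W`, then the algebra is a tensor product. -/
theorem hopfIsomorphic_maxTensor (𝒵 : Set (SimpleGraph (V × W))) (𝒳 : Set (SimpleGraph V))
    (𝒴 : Set (SimpleGraph W)) (h1 : Preserves (u 𝒵) fun p q => p.1 = q.1)
    (h2 : Preserves (u 𝒵) fun p q => p.2 = q.2)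
    (hX : ∀ X ∈ 𝒳, Preserves (u 𝒵) fun p q => X.Adj p.1 q.1)
    (hY : ∀ Y ∈ 𝒴, Preserves (u 𝒵) fun p q => Y.Adj p.2 q.2)
    (hZ : ∀ Z ∈ 𝒵, ∀ p q r s : V × W, (p.1 = r.1 ↔ q.1 = s.1) → (p.2 = r.2 ↔ q.2 = s.2) →
      (∀ X ∈ 𝒳, X.Adj p.1 r.1 ↔ X.Adj q.1 s.1) → (∀ Y ∈ 𝒴, Y.Adj p.2 r.2 ↔ Y.Adj q.2 s.2) →
      (Z.Adj p r ↔ Z.Adj q s)) :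
    HopfIsomorphic (MagicAlgebra 𝒵) (MaxTensor (MagicAlgebra 𝒳) (MagicAlgebra 𝒴)) := by
  classical
  have hz := isMagicUnitary_u (𝒳 := 𝒵)
  let U : Matrix V V (MaxTensor (MagicAlgebra 𝒳) (MagicAlgebra 𝒴)) := (u 𝒳).map inl
  let T : Matrix W W (MaxTensor (MagicAlgebra 𝒳) (MagicAlgebra 𝒴)) := (u 𝒴).map inr
  have hU : IsMagicUnitary U := isMagicUnitary_u.map inl
  have hT : IsMagicUnitary T := isMagicUnitary_u.map inr
  have hc : ∀ i j k l, Commute (U i j) (T k l) := fun i j k l => commute_inl_inr _ _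
  have hK := hU.kron hT hc
  let f : MagicAlgebra 𝒵 →⋆ₐ[ℂ] MaxTensor (MagicAlgebra 𝒳) (MagicAlgebra 𝒴) :=
    lift _ hK fun Z hZ' => (hK.commute_adjacency_iff Z).mpr <| by
      have p1 := hU.preserves_eq.kron_left hc
      have p2 := hT.preserves_eq.kron_right hc
      have p3 : Preserves (kron U T) fun p q => fun X : 𝒳 => X.1.Adj p.1 q.1 :=
        Preserves.pi fun X => ((hU.commute_adjacency_iff X.1).mp
          (commute_adjacency_map (commute_u X.2) inl)).kron_left hc
      have p4 : Preserves (kron U T) fun p q => fun Y : 𝒴 => Y.1.Adj p.2 q.2 :=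
        Preserves.pi fun Y => ((hT.commute_adjacency_iff Y.1).mp
          (commute_adjacency_map (commute_u Y.2) inr)).kron_right hc
      -- The product matrix preserves equality and all the graphs in each coordinate, and `hZ` says
      -- that these data determine adjacency in Z.
      refine ((p1.prod p2).prod (p3.prod p4)).of_imp fun p q r s h => ?_
      simp only [Prod.mk.injEq, eq_iff_iff, funext_iff, Subtype.forall] at h
      exact propext (hZ Z hZ' p q r s h.1.1 h.1.2 h.2.1 h.2.2)
  let gl : MagicAlgebra 𝒳 →⋆ₐ[ℂ] MagicAlgebra 𝒵 :=
    lift _ (hz.leftFactor h1) fun X hX' =>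
      ((hz.leftFactor h1).commute_adjacency_iff X).mpr (hX X hX').leftFactor
  let gr : MagicAlgebra 𝒴 →⋆ₐ[ℂ] MagicAlgebra 𝒵 :=
    lift _ (hz.rightFactor h2) fun Y hY' =>
      ((hz.rightFactor h2).commute_adjacency_iff Y).mpr (hY Y hY').rightFactor
  have hgl : ∀ i j, gl (u 𝒳 i j) = leftFactor (u 𝒵) i j := lift_u _ _ _
  have hgr : ∀ i j, gr (u 𝒴 i j) = rightFactor (u 𝒵) i j := lift_u _ _ _
  have hf : ∀ p q, f (u 𝒵 p q) = inl (u 𝒳 p.1 q.1) * inr (u 𝒴 p.2 q.2) := lift_u _ _ _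
  have hg : ∀ x y, Commute (gl x) (gr y) := by
    refine fun x y => MagicAlgebra.commute_hom gl (fun i j => ?_) x
    refine (MagicAlgebra.commute_hom gr (fun a b => ?_) y).symm
    rw [hgl, hgr]
    exact (commute_leftFactor_rightFactor hz h1 h2 _ _ _ _).symm
  let g : MaxTensor (MagicAlgebra 𝒳) (MagicAlgebra 𝒴) →⋆ₐ[ℂ] MagicAlgebra 𝒵 :=
    MaxTensor.lift gl gr hg
  -- Summing the product matrix along W leaves a row sum of the second magic unitary, which is 1.
  have hfl : ∀ i j, f (leftFactor (u 𝒵) i j) = inl (u 𝒳 i j) := fun i j => by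
    change f (∑ b, _) = _
    simp_rw [map_sum, hf, ← Finset.mul_sum, ← map_sum, isMagicUnitary_u.row_sum, map_one, mul_one]
  have hfr : ∀ i j, f (rightFactor (u 𝒵) i j) = inr (u 𝒴 i j) := fun i j => by
    change f (∑ b, u 𝒵 (Classical.arbitrary V, i) (b, j)) = _
    simp_rw [map_sum, hf, ← Finset.sum_mul, ← map_sum, isMagicUnitary_u.row_sum, map_one, one_mul]
  refine hopfIsomorphic_of_magic f g (fun p q => ?_)
    (eq_of_inl_inr (f.comp g) (.id ℂ _)
      (DFunLike.congr_fun (f := (f.comp g).comp inl) (g := inl) (MagicAlgebra.hom_ext fun i j => ?_))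
      (DFunLike.congr_fun (f := (f.comp g).comp inr) (g := inr)
        (MagicAlgebra.hom_ext fun i j => ?_)))
    (fun p q => ?_) (fun p q => ?_) (fun p q => ?_)
  · rw [hf, map_mul]
    change MaxTensor.lift gl gr hg _ * MaxTensor.lift gl gr hg _ = _
    rw [lift_inl, lift_inr, hgl, hgr, leftFactor_mul_rightFactor hz h1 h2]
  · change f (MaxTensor.lift gl gr hg (inl _)) = _
    rw [lift_inl, hgl, hfl]
  · change f (MaxTensor.lift gl gr hg (inr _)) = _
    rw [lift_inr, hgr, hfr]
  · rw [hf]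
    change comul' _ _ _ = _
    rw [map_mul, comul'_inl, comul'_inr]
    change map inl inl (MagicAlgebra.comul 𝒳 _) * map inr inr (MagicAlgebra.comul 𝒴 _) = _
    rw [comul_u, comul_u, map_sum, map_sum, Finset.sum_mul_sum, Fintype.sum_prod_type]
    simp_rw [hf, map_mul, map_inl, map_inr]
    refine Finset.sum_congr rfl fun i _ => Finset.sum_congr rfl fun j _ => ?_
    exact (commute_inl_inr _ _).symm.mul_mul_mul_comm _ _
  · rw [hf]
    change counit' _ _ _ = _
    rw [map_mul, counit'_inl, counit'_inr]
    change MagicAlgebra.counit 𝒳 _ * MagicAlgebra.counit 𝒴 _ = _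
    rw [counit_u, counit_u, Prod.ext_iff]
    split_ifs <;> simp_all
  · rw [hf, hf]
    change (antipode' _ _ _).unop = _
    rw [map_mul, MulOpposite.unop_mul, antipode'_inl, antipode'_inr]
    change inr (MagicAlgebra.antipode 𝒴 _).unop * inl (MagicAlgebra.antipode 𝒳 _).unop = _
    rw [antipode_u, antipode_u]
    exact (commute_inl_inr _ _).symm

end TensorIso

/-! ### Commutative quantum automorphism groups -/

section Commutative

variable {V : Type u} [Fintype V]

/-- Take e s to be the product over j of u (s j) j, the indicator of the event that u is the matrix
of the map s. Expanding the product of all the column sums shows that these add up to 1, and column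
orthogonality separates distinct maps. Since e s absorbs u (s i) i and u (s k) k, it vanishes when s
violates a preserved relation. -/
theorem IsMagicUnitary.exists_partition_of_commRing [DecidableEq V] {A : Type v} [CommRing A] [StarRing A]
    {u : Matrix V V A} (hu : IsMagicUnitary u) : ∃ e : (V → V) → A, (∀ s, star (e s) = e s) ∧
      (∀ s, e s * e s = e s) ∧ (∀ s t, s ≠ t → e s * e t = 0) ∧ ∑ s, e s = 1 ∧
      (∀ s j, u (s j) j * e s = e s) ∧
      (∀ M : V → V → Prop, Preserves u M → ∀ s i k, M (s i) (s k) ≠ M i k → e s = 0) := by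
  have h1 : ∀ (s : V → V) (j : V), u (s j) j * ∏ k, u (s k) k = ∏ k, u (s k) k := fun s j => by
    rw [← Finset.mul_prod_erase _ _ (Finset.mem_univ j), ← mul_assoc,
      (hu.isStarProjection _ _).isIdempotentElem.eq]
  refine ⟨fun s => ∏ j, u (s j) j, fun s => ?_, fun s => ?_, fun s t hst => ?_, ?_, h1,
    fun M hM s i k h => ?_⟩
  · rw [star_prod]
    exact Finset.prod_congr rfl fun j _ => (hu.isStarProjection _ _).isSelfAdjoint
  · rw [← Finset.prod_mul_distrib]
    exact Finset.prod_congr rfl fun j _ => (hu.isStarProjection _ _).isIdempotentElem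
  · obtain ⟨j, hj⟩ := Function.ne_iff.mp hst
    rw [← Finset.prod_mul_distrib]
    exact Finset.prod_eq_zero (Finset.mem_univ j) (hu.col_orthogonal _ _ _ hj)
  · have h := Finset.prod_univ_sum (fun _ : V => (Finset.univ : Finset V)) fun j i => u i j
    simp only [hu.col_sum, Finset.prod_const_one, Fintype.piFinset_univ] at h
    exact h.symm
  · change ∏ j, u (s j) j = 0
    rw [← h1 s k, ← h1 s i, ← mul_assoc, mul_comm (u (s k) k), hM _ _ _ _ h, zero_mul]

/-- Commutativity of a universal algebra is only available as a proposition, so the commutative ring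
structure is assembled on the spot. -/
theorem IsMagicUnitary.exists_partition [DecidableEq V] {A : Type v} [Ring A] [StarRing A]
    (hA : ∀ x y : A, x * y = y * x) {u : Matrix V V A} (hu : IsMagicUnitary u) :
    ∃ e : (V → V) → A, (∀ s, star (e s) = e s) ∧
      (∀ s, e s * e s = e s) ∧ (∀ s t, s ≠ t → e s * e t = 0) ∧ ∑ s, e s = 1 ∧
      (∀ s j, u (s j) j * e s = e s) ∧
      (∀ M : V → V → Prop, Preserves u M → ∀ s i k, M (s i) (s k) ≠ M i k → e s = 0) :=
  letI : CommRing A := { (inferInstance : Ring A) with mul_comm := hA }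
  IsMagicUnitary.exists_partition_of_commRing (A := A) hu

variable {G : Type v} [Group G]

open Classical in
/-- The magic unitary of an action of a group on a finite set. -/
def actionMatrix (φ : G →* Equiv.Perm V) : Matrix V V (G → ℂ) :=
  Matrix.of fun i j g => if φ g j = i then 1 else 0

open Classical in
omit [Fintype V] in
theorem actionMatrix_apply (φ : G →* Equiv.Perm V) (i j : V) (g : G) :
    actionMatrix φ i j g = if φ g j = i then 1 else 0 := rfl

theorem isMagicUnitary_actionMatrix (φ : G →* Equiv.Perm V) :
    IsMagicUnitary (actionMatrix φ) where
  isStarProjection i j :=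
    { isIdempotentElem := funext fun g => by simp [actionMatrix_apply]
      isSelfAdjoint := funext fun g => by simp [actionMatrix_apply, apply_ite] }
  row_orthogonal i j k h := funext fun g => by
    by_cases h1 : φ g j = i
    · have h2 : φ g k ≠ i := fun h2 => h ((φ g).injective (h1.trans h2.symm))
      simp [actionMatrix_apply, h2]
    · simp [actionMatrix_apply, h1]
  col_orthogonal i j k h := funext fun g => by
    by_cases h1 : φ g i = j
    · simp [actionMatrix_apply, h1, h]
    · simp [actionMatrix_apply, h1]
  row_sum i := funext fun g => by
    rw [Finset.sum_apply, Finset.sum_eq_single ((φ g).symm i)]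
    · simp [actionMatrix_apply]
    · exact fun j _ hj => if_neg fun h => hj ((Equiv.eq_symm_apply _).mpr h)
    · simp
  col_sum j := funext fun g => by
    rw [Finset.sum_apply, Finset.sum_eq_single (φ g j)]
    · simp [actionMatrix_apply]
    · exact fun i _ hi => if_neg hi.symm
    · simp

omit [Fintype V] in
theorem preserves_actionMatrix (φ : G →* Equiv.Perm V) {S : Type*} {M : V → V → S}
    (hM : ∀ g i k, M (φ g i) (φ g k) = M i k) : Preserves (actionMatrix φ) M := by
  intro i j k l h
  funext g
  by_cases h1 : φ g j = i
  · have h2 : φ g l ≠ k := fun h2 => h (by rw [← h1, ← h2, hM])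
    simp [actionMatrix_apply, h2]
  · simp [actionMatrix_apply, h1]

variable [Fintype G]

open MaxTensor MagicAlgebra HopfCStarAlgebra

/-- A commutative quantum automorphism group is the algebra of functions on the automorphism
group. -/
theorem hopfIsomorphic_functions (𝒳 : Set (SimpleGraph V))
    (hc : ∀ i j k l, Commute (u 𝒳 i j) (u 𝒳 k l)) (φ : G →* Equiv.Perm V)
    (hφ : Function.Injective φ) (hφX : ∀ X ∈ 𝒳, ∀ g i k, X.Adj (φ g i) (φ g k) ↔ X.Adj i k)
    (hφs : ∀ s : V → V, (∀ M : V → V → Prop, Preserves (u 𝒳) M → ∀ i k, M (s i) (s k) = M i k) →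
      ∃ g, ∀ i, φ g i = s i) :
    HopfIsomorphic (MagicAlgebra 𝒳) (G → ℂ) := by
  classical
  have hcomm : ∀ x y : MagicAlgebra 𝒳, x * y = y * x := fun x y =>
    MagicAlgebra.commute_hom (.id ℂ _) (fun i j =>
      (MagicAlgebra.commute_hom (.id ℂ _) (fun k l => hc k l i j) y).symm) x
  obtain ⟨e, e1, e2, e3, e4, e5, e6⟩ := isMagicUnitary_u.exists_partition hcomm
  have hinj : Function.Injective fun g => (φ g : V → V) :=
    fun g h hgh => hφ (DFunLike.coe_injective hgh)
  -- The maps that do not come from G contribute nothing: by `hφs` they violate some preserved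
  -- relation, and `e6` then makes their projection vanish.
  have e7 : ∑ g : G, e (φ g) = 1 := by
    rw [← e4]
    refine Fintype.sum_of_injective _ hinj _ _ (fun s hs => ?_) fun g => rfl
    by_contra hes
    refine hs ?_
    obtain ⟨g, hg⟩ := hφs s fun M hM i k => by
      by_contra h
      exact hes (e6 M hM s i k h)
    exact ⟨g, funext hg⟩
  have e8 : ∀ i j (g : G), u 𝒳 i j * e (φ g) = if φ g j = i then e (φ g) else 0 := fun i j g => by
    split_ifs with h
    · rw [← h, e5]
    · rw [← e5 (φ g) j, ← mul_assoc, isMagicUnitary_u.col_orthogonal _ _ _ (Ne.symm h), zero_mul]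
  have hm := isMagicUnitary_actionMatrix φ
  let f : MagicAlgebra 𝒳 →⋆ₐ[ℂ] (G → ℂ) := MagicAlgebra.lift _ hm fun X hX =>
    (hm.commute_adjacency_iff X).mpr
      (preserves_actionMatrix φ fun g i k => propext (hφX X hX g i k))
  have hf : ∀ i j, f (u 𝒳 i j) = actionMatrix φ i j := lift_u _ _ _
  let k : (G → ℂ) →⋆ₐ[ℂ] MagicAlgebra 𝒳 := partitionHom (fun g => e (φ g)) (fun g => e1 _)
    (fun g => e2 _) (fun g h hgh => e3 _ _ (hinj.ne hgh)) e7
  have hk : ∀ a, k a = ∑ g, a g • e (φ g) := fun a => rfl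
  -- Choose j where φ g and φ x differ. The entry at (φ g j, j) annihilates e (φ x), while its image
  -- under f takes the value 1 at g.
  have hF : ∀ x g, g ≠ x → f (e (φ x)) g = 0 := fun x g hgx => by
    obtain ⟨j, hj⟩ := Function.ne_iff.mp (hinj.ne hgx)
    have h := congrFun (congrArg f (e8 (φ g j) j x)) g
    rw [if_neg (Ne.symm hj), map_mul, map_zero, hf, Pi.mul_apply, actionMatrix_apply, if_pos rfl,
      one_mul] at h
    exact h
  have hF1 : ∀ g, f (e (φ g)) g = 1 := fun g => by
    have h := congrFun (congrArg f e7) g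
    rw [map_sum, map_one, Finset.sum_apply, Finset.sum_eq_single g] at h
    · exact h
    · exact fun x _ hx => hF x g hx.symm
    · simp
  refine hopfIsomorphic_of_magic f k (fun i j => ?_)
    (functions_hom_ext (f.comp k) (.id ℂ _) fun x => ?_) (fun i j => ?_) (fun i j => ?_)
    (fun i j => ?_)
  · rw [hf, hk]
    calc _ = ∑ g, u 𝒳 i j * e (φ g) :=
          Finset.sum_congr rfl fun g _ => by rw [e8, actionMatrix_apply, ite_smul, one_smul,
            zero_smul]
      _ = _ := by rw [← Finset.mul_sum, e7, mul_one]
  · change f (k (dirac x)) = dirac x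
    rw [hk, Finset.sum_eq_single x]
    · rw [dirac_self, one_smul]
      ext g
      by_cases hg : g = x
      · rw [hg, hF1, dirac_self]
      · rw [hF x g hg, dirac_ne hg]
    · intro g _ hg
      rw [dirac_ne hg, zero_smul]
    · simp
  · change groupComul G _ = _
    simp_rw [hf]
    rw [groupComul_apply]
    have hl : ∀ a : G → ℂ, (inl a : MaxTensor (G → ℂ) (G → ℂ)) = ∑ g, a g • inl (dirac g) :=
      fun a => by conv_lhs => rw [← sum_dirac a, map_sum]; simp only [map_smul]
    have hr : ∀ a : G → ℂ, (inr a : MaxTensor (G → ℂ) (G → ℂ)) = ∑ g, a g • inr (dirac g) :=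
      fun a => by conv_lhs => rw [← sum_dirac a, map_sum]; simp only [map_smul]
    calc _ = ∑ g, ∑ h, ∑ m, (actionMatrix φ i m g * actionMatrix φ m j h) •
          (inl (dirac g) * inr (dirac h) : MaxTensor (G → ℂ) (G → ℂ)) := by
          refine Finset.sum_congr rfl fun g _ => Finset.sum_congr rfl fun h _ => ?_
          rw [← Finset.sum_smul]
          congr 1
          -- The only m that can contribute is φ h j, and it does so exactly when φ (g * h) j = i,
          -- because φ is a homomorphism.
          simp [actionMatrix_apply]
      _ = ∑ m, ∑ g, ∑ h, (actionMatrix φ i m g * actionMatrix φ m j h) •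
          (inl (dirac g) * inr (dirac h) : MaxTensor (G → ℂ) (G → ℂ)) := by
          rw [Finset.sum_comm]
          simp_rw [Finset.sum_comm (s := (Finset.univ : Finset V))]
          rw [Finset.sum_comm]
      _ = _ := by
          refine Finset.sum_congr rfl fun m _ => ?_
          rw [hl (actionMatrix φ i m), hr (actionMatrix φ m j), Finset.sum_mul_sum]
          simp_rw [smul_mul_smul_comm]
  · rw [hf]
    change actionMatrix φ i j 1 = _
    simp [actionMatrix_apply, eq_comm]
  · rw [hf, hf]
    funext g
    change actionMatrix φ i j g⁻¹ = actionMatrix φ j i g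
    have h : φ g⁻¹ j = i ↔ φ g i = j := by
      rw [map_inv, Equiv.Perm.inv_eq_iff_eq, eq_comm]
    simp only [actionMatrix_apply, h]

/-- The regular action of `ℤ₂`. -/
def addPermHom : Multiplicative (ZMod 2) →* Equiv.Perm (Fin 2) where
  toFun g := (Equiv.addLeft g.toAdd : Equiv.Perm (ZMod 2))
  map_one' := Equiv.ext fun i => zero_add (M := ZMod 2) i
  map_mul' g h := Equiv.ext fun i => add_assoc (G := ZMod 2) g.toAdd h.toAdd i

/-- `A_s(2) = C(ℤ₂)`. -/
theorem hopfIsomorphic_quantumPerm_two :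
    HopfIsomorphic (QuantumPerm 2) (Multiplicative (ZMod 2) → ℂ) := by
  have hm := isMagicUnitary_u (𝒳 := (∅ : Set (SimpleGraph (Fin 2))))
  refine hopfIsomorphic_functions ∅ ?_ addPermHom (fun g h hgh => ?_) (fun X hX => hX.elim)
    fun s hs => ?_
  · have h00 := hm.row_sum 0
    have h10 := hm.col_sum 0
    have h11 := hm.col_sum 1
    rw [Fin.sum_univ_two] at h00 h10 h11
    set p := u (∅ : Set (SimpleGraph (Fin 2))) 0 0 with hp
    -- Row and column sums force the matrix with rows (p, 1 - p) and (1 - p, p).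
    have h : ∀ i j, u (∅ : Set (SimpleGraph (Fin 2))) i j = p ∨
        u (∅ : Set (SimpleGraph (Fin 2))) i j = 1 - p := by
      have h1 := eq_sub_of_add_eq' h00
      have h2 := eq_sub_of_add_eq' h10
      have h3 := eq_sub_of_add_eq' h11
      rw [h1, sub_sub_cancel] at h3
      simp only [Fin.forall_fin_two]
      exact ⟨⟨Or.inl rfl, Or.inr h1⟩, Or.inr h2, Or.inl h3⟩
    intro i j k l
    have hp : Commute p (1 - p) := (Commute.one_right _).sub_right (Commute.refl _)
    rcases h i j with h1 | h1 <;> rcases h k l with h2 | h2 <;> rw [h1, h2]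
    · exact hp
    · exact hp.symm
  · have h0 := congrArg (fun σ => σ (0 : Fin 2)) hgh
    exact add_right_cancel (G := ZMod 2) (a := g.toAdd) (b := 0) (c := h.toAdd) h0
  -- An injective self-map of a two-element set is a translation; injectivity comes from the
  -- preservation of equality.
  · have key : ∀ s : Fin 2 → Fin 2, s 0 ≠ s 1 → ∃ k : Fin 2, ∀ i, k + i = s i := by decide
    obtain ⟨k, hk⟩ := key s fun h => by
      have h1 := hs _ hm.preserves_eq 0 1
      exact zero_ne_one (h1.mp h)
    exact ⟨Multiplicative.ofAdd (k : ZMod 2), hk⟩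

end Commutative

/-! ### Products and prisms of complete graphs -/

section Complete

variable {V : Type u} {W : Type v} [Fintype V] [Fintype W]

open Classical in
/-- The number of coordinates in which two pairs agree. -/
def agreement (p q : V × W) : ℕ := (if p.1 = q.1 then 1 else 0) + if p.2 = q.2 then 1 else 0

-- With J an all-ones matrix, the agreement matrix is I ⊗ J + J ⊗ I. The squares of the two terms
-- are |W| (I ⊗ J) and |V| (J ⊗ I), and each cross term is the all-ones matrix, whence the constant
-- 2.
open Classical in
theorem sum_agreement_mul_agreement (p q : V × W) :
    ∑ r, agreement p r * agreement r q = (if p.1 = q.1 then Fintype.card W else 0) +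
      (if p.2 = q.2 then Fintype.card V else 0) + 2 := by
  simp only [agreement, Fintype.sum_prod_type, mul_add, Finset.sum_add_distrib,
    Finset.sum_ite_eq, Finset.sum_ite_eq', Finset.mem_univ, if_true,
    Finset.sum_const, Finset.card_univ, smul_eq_mul, mul_ite, mul_one, mul_zero,
    Finset.sum_ite_irrel]
  split_ifs <;> simp <;> ring

variable {D : Type w} [CStarAlgebra D] {z : Matrix (V × W) (V × W) D}

/-- Agreement 0 or 2 settles both coordinates. When exactly one coordinate agrees, the square of the
agreement matrix is |W| + 2 if it is the first and |V| + 2 if it is the second, and these differ by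
`hcard`. -/
theorem IsMagicUnitary.preserves_fst_snd (hz : IsMagicUnitary z)
    (hcard : Fintype.card V ≠ Fintype.card W)
    (hR : Preserves z (agreement : V × W → V × W → ℕ)) :
    (Preserves z fun p q => p.1 = q.1) ∧ Preserves z fun p q => p.2 = q.2 := by
  have h := hR.prod (hz.preserves_mul hR hR)
  have key : ∀ p q r s : V × W, (agreement p r, ∑ t, agreement p t * agreement t r) =
      (agreement q s, ∑ t, agreement q t * agreement t s) →
      (p.1 = r.1 ↔ q.1 = s.1) ∧ (p.2 = r.2 ↔ q.2 = s.2) := by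
    intro p q r s h
    have h1 := (Prod.ext_iff.mp h).1
    have h2 := (Prod.ext_iff.mp h).2
    simp only [sum_agreement_mul_agreement] at h2
    simp only [agreement] at h1
    have hV : 0 < Fintype.card V := Fintype.card_pos_iff.mpr ⟨p.1⟩
    have hW : 0 < Fintype.card W := Fintype.card_pos_iff.mpr ⟨p.2⟩
    split_ifs at h1 h2 <;> first | omega | tauto
  exact ⟨h.of_imp fun p q r s h => propext (key p q r s h).1,
    h.of_imp fun p q r s h => propext (key p q r s h).2⟩

variable [Nonempty V] [Nonempty W]

-- The common core of both complete-graph statements: only the partition of pairs by agreement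
-- matters, not which class is adjacency. Every magic unitary commutes with the adjacency matrix of
-- a complete graph, so each factor may be presented with or without that relation, as A(K_n) or as
-- A_s(n).
open MagicAlgebra in
theorem hopfIsomorphic_of_agreement (hcard : Fintype.card V ≠ Fintype.card W)
    (Z : SimpleGraph (V × W))
    (hR : ∀ p q r s : V × W, (p = r ↔ q = s) → (Z.Adj p r ↔ Z.Adj q s) →
      agreement p r = agreement q s)
    (hZ : ∀ p q r s : V × W, agreement p r = agreement q s → (Z.Adj p r ↔ Z.Adj q s))
    (𝒳 : Set (SimpleGraph V)) (𝒴 : Set (SimpleGraph W)) (h𝒳 : ∀ X ∈ 𝒳, X = ⊤)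
    (h𝒴 : ∀ Y ∈ 𝒴, Y = ⊤) :
    HopfIsomorphic (QuantumAut Z) (MaxTensor (MagicAlgebra 𝒳) (MagicAlgebra 𝒴)) := by
  have hz := isMagicUnitary_u (𝒳 := {Z})
  obtain ⟨h1, h2⟩ := hz.preserves_fst_snd hcard <|
    (hz.preserves_eq.prod (preserves_u (Set.mem_singleton Z))).of_imp fun p q r s h => by
      simp only [Prod.mk.injEq, eq_iff_iff] at h
      exact hR p q r s h.1 h.2
  refine hopfIsomorphic_maxTensor {Z} 𝒳 𝒴 h1 h2 (fun X hX => ?_) (fun Y hY => ?_) ?_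
  · rw [h𝒳 X hX]
    exact h1.of_imp fun p q r s h => by simp only [SimpleGraph.top_adj, ne_eq, h]
  · rw [h𝒴 Y hY]
    exact h2.of_imp fun p q r s h => by simp only [SimpleGraph.top_adj, ne_eq, h]
  · rintro _ rfl p q r s h1 h2 - -
    exact hZ p q r s (by simp only [agreement]; split_ifs <;> tauto)

/-- Here adjacency is agreement 0 and equality is agreement 2. -/
theorem hopfIsomorphic_directProd_top (hcard : Fintype.card V ≠ Fintype.card W)
    (𝒳 : Set (SimpleGraph V)) (𝒴 : Set (SimpleGraph W)) (h𝒳 : ∀ X ∈ 𝒳, X = ⊤)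
    (h𝒴 : ∀ Y ∈ 𝒴, Y = ⊤) :
    HopfIsomorphic (QuantumAut (directProd (⊤ : SimpleGraph V) (⊤ : SimpleGraph W)))
      (MaxTensor (MagicAlgebra 𝒳) (MagicAlgebra 𝒴)) := by
  refine hopfIsomorphic_of_agreement hcard _ (fun p q r s h h' => ?_) (fun p q r s h => ?_) 𝒳 𝒴
    h𝒳 h𝒴
  · simp only [directProd, SimpleGraph.top_adj, ne_eq, Prod.ext_iff, agreement] at h h' ⊢
    split_ifs <;> simp_all
  · simp only [directProd, SimpleGraph.top_adj, ne_eq, agreement] at h ⊢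
    split_ifs at h <;> simp_all

/-- Here adjacency is agreement 1, so this graph is the complement of K_2 × K_n and preserves the
same relations. -/
theorem hopfIsomorphic_prism_top (hcard : Fintype.card W ≠ 2) :
    HopfIsomorphic (QuantumAut (prism (⊤ : SimpleGraph W)))
      (MaxTensor (QuantumPerm 2) (MagicAlgebra (∅ : Set (SimpleGraph W)))) := by
  refine hopfIsomorphic_of_agreement (by simpa using hcard.symm) _ (fun p q r s h h' => ?_)
    (fun p q r s h => ?_) ∅ ∅ (fun _ h => h.elim) (fun _ h => h.elim)
  · simp only [prism, SimpleGraph.boxProd_adj, SimpleGraph.top_adj, ne_eq, Prod.ext_iff,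
      agreement] at h h' ⊢
    split_ifs <;> simp_all
  · simp only [prism, SimpleGraph.boxProd_adj, SimpleGraph.top_adj, ne_eq, agreement] at h ⊢
    split_ifs at h <;> simp_all

/-- The cube is the direct product of `K₂` and `K₄`: a bipartition and the four diagonals. -/
def cubeIso : prism (SimpleGraph.cycleGraph 4) ≃g
    directProd (⊤ : SimpleGraph (Fin 2)) (⊤ : SimpleGraph (Fin 4)) where
  -- The first coordinate is the parity of the vertex. The second takes the same value on (ε, x) and
  -- its antipode (ε + 1, x + 2), so it labels the diagonal. Neighbours in the cube are the vertices
  -- of opposite parity that are not antipodal.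
  toFun p := (p.1 + Fin.ofNat 2 p.2, p.2 + 2 * Fin.ofNat 4 p.1)
  invFun p := (p.1 + Fin.ofNat 2 p.2, p.2 + 2 * (Fin.ofNat 4 p.1 + p.2))
  left_inv := by decide
  right_inv := by decide
  map_rel_iff' {p q} := by
    have key : ∀ p q : Fin 2 × Fin 4, (p.1 + Fin.ofNat 2 p.2 ≠ q.1 + Fin.ofNat 2 q.2 ∧
        p.2 + 2 * Fin.ofNat 4 p.1 ≠ q.2 + 2 * Fin.ofNat 4 q.1) ↔
        (p.1 ≠ q.1 ∧ p.2 = q.2) ∨ ((p.2 - q.2 = 1 ∨ q.2 - p.2 = 1) ∧ p.1 = q.1) := by decide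
    refine (key p q).trans ?_
    rw [prism, SimpleGraph.boxProd_adj, SimpleGraph.top_adj, SimpleGraph.cycleGraph_adj]

end Complete

/-! ### Prisms of cycles -/

/-! ### Commutation along cycles p, p + c, p + 2c, ... in a finite abelian group. -/

section Group

variable {G : Type u} [AddCommGroup G] [Fintype G] {D : Type v} [CStarAlgebra D] {z : Matrix G G D}

-- The right-hand side is self-adjoint, hence so is the product of the two projections, and they
-- commute.
omit [AddCommGroup G] in
theorem IsMagicUnitary.commute_of_mul_eq (hz : IsMagicUnitary z) {p q r s : G}
    (h : z p q * z r s = z p q * z r s * z p q) : Commute (z p q) (z r s) := by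
  have h1 := congrArg star h
  simp only [star_mul, (hz.isStarProjection _ _).isSelfAdjoint.star_eq, ← mul_assoc] at h1
  exact h.trans h1.symm

variable (hz : IsMagicUnitary z) {c : G} (hc : c + c ≠ 0)
  (hP : Preserves z fun p q : G => q - p = c ∨ q - p = -c)

include hz hc hP

/-- Insert the row sum of a neighbouring row p'. Only the neighbours q + c and q - c of q survive,
and they are distinct because 2c ≠ 0. Letting b be either sign spares case distinctions later. -/
theorem eq_mul_row_sum {p p' : G} (q : G) (hp : p' - p = c ∨ p' - p = -c) {b : G}
    (hb : b = c ∨ b = -c) : z p q = z p q * (z p' (q + b) + z p' (q - b)) := by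
  classical
  have hne : q + c ≠ q - c := fun h => hc <| by
    rwa [sub_eq_add_neg, add_right_inj, eq_neg_iff_add_eq_zero] at h
  have h : z p q = ∑ q', z p q * z p' q' := by rw [← Finset.mul_sum, hz.row_sum, mul_one]
  have key : z p q = z p q * (z p' (q + c) + z p' (q - c)) := by
    rw [mul_add, ← Finset.sum_pair (f := fun q' => z p q * z p' q') hne]
    refine h.trans (Finset.sum_subset (Finset.subset_univ _) fun q' _ hq' => ?_).symm
    refine hP _ _ _ _ fun h' => hq' ?_
    rw [Finset.mem_insert, Finset.mem_singleton]
    exact (h'.mp hp).imp (fun h => by rw [← h]; abel) (fun h => by rw [sub_eq_add_neg, ← h]; abel)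
  rcases hb with rfl | rfl
  · exact key
  · rwa [add_comm, sub_neg_eq_add, ← sub_eq_add_neg]

theorem eq_mul_col_sum (p : G) {q q' : G} (hq : q' - q = c ∨ q' - q = -c) {a : G}
    (ha : a = c ∨ a = -c) : z p q = z p q * (z (p + a) q' + z (p - a) q') := by
  classical
  have hne : p + c ≠ p - c := fun h => hc <| by
    rwa [sub_eq_add_neg, add_right_inj, eq_neg_iff_add_eq_zero] at h
  have h : z p q = ∑ p', z p q * z p' q' := by rw [← Finset.mul_sum, hz.col_sum, mul_one]
  have key : z p q = z p q * (z (p + c) q' + z (p - c) q') := by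
    rw [mul_add, ← Finset.sum_pair (f := fun p' => z p q * z p' q') hne]
    refine h.trans (Finset.sum_subset (Finset.subset_univ _) fun p' _ hp' => ?_).symm
    refine hP _ _ _ _ fun h' => hp' ?_
    rw [Finset.mem_insert, Finset.mem_singleton]
    exact (h'.mpr hq).imp (fun h => by rw [← h]; abel) (fun h => by rw [sub_eq_add_neg, ← h]; abel)
  rcases ha with rfl | rfl
  · exact key
  · rwa [add_comm, sub_neg_eq_add, ← sub_eq_add_neg]

/-- Expand z p q along column q + b and along row p - a. The two expansions share the term with z (p
- a) (q + b); cancel it. -/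
theorem mul_add_eq_mul_sub (p q : G) {a b : G} (ha : a = c ∨ a = -c) (hb : b = c ∨ b = -c) :
    z p q * z (p + a) (q + b) = z p q * z (p - a) (q - b) := by
  have h1 := eq_mul_row_sum hz hc hP (p := p) (p' := p - a) q (by
    rcases ha with rfl | rfl <;> simp) hb
  have h2 := eq_mul_col_sum hz hc hP p (q := q) (q' := q + b) (by simpa using hb) ha
  have h3 := h2.symm.trans h1
  rw [mul_add, mul_add, add_comm] at h3
  exact add_left_cancel h3

variable (hc4 : c + c + (c + c) ≠ 0)

include hc4

/-- Entries of a magic unitary at adjacent positions of a cycle of length `≠ 4` commute. -/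
theorem commute_of_adjacent (p q : G) {a b : G} (ha : a = c ∨ a = -c) (hb : b = c ∨ b = -c) :
    Commute (z p q) (z (p + a) (q + b)) := by
  refine hz.commute_of_mul_eq ?_
  have h1 := eq_mul_row_sum hz hc hP (p := p + a) (p' := p) (q + b)
    (by rcases ha with rfl | rfl <;> simp) hb
  have h2 : z (p - a) (q - b) * z p (q + b + b) = 0 := by
    refine hP _ _ _ _ fun h => ?_
    have h3 := h.mp (by rcases ha with rfl | rfl <;> simp)
    -- The rows p - a and p are adjacent, but the columns q - b and q + 2b differ by 3b. This equals
    -- b or -b only if 2b = 0 or 4b = 0, and it is here that cycles of length 4 are excluded.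
    have e : q + b + b - (q - b) = b + b + b := by abel
    dsimp only at h3
    rw [e] at h3
    have h4 : b + b = 0 ∨ b + b + (b + b) = 0 := by
      rcases hb with rfl | rfl
      · exact h3.imp (fun h => by simpa using h)
          fun h => by rw [eq_neg_iff_add_eq_zero] at h; rw [← h]; abel
      · refine h3.symm.imp (fun h => by simpa using h) fun h => ?_
        rw [eq_comm, ← sub_eq_zero] at h
        rw [← neg_eq_zero, ← h]; abel
    rcases hb with rfl | rfl
    · exact h4.elim hc hc4
    · refine h4.elim (fun h => hc ?_) fun h => hc4 ?_
      · rw [← neg_eq_zero, ← h]; abel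
      · rw [← neg_eq_zero, ← h]; abel
  -- Expanding the second factor over row p gives one term ending in z p (q + 2b), which vanishes
  -- after the reflection of `mul_add_eq_mul_sub`, and one ending in z p q, which is the form
  -- required by `IsMagicUnitary.commute_of_mul_eq`.
  conv_lhs => rw [h1, mul_add, mul_add, ← mul_assoc, ← mul_assoc,
    mul_add_eq_mul_sub hz hc hP p q ha hb, mul_assoc, h2, mul_zero, zero_add, add_sub_cancel_right]
  rw [mul_add_eq_mul_sub hz hc hP p q ha hb]

/-- If the columns are not adjacent as well, both products are zero. -/
theorem commute_adjacent_rows (p q q' : G) : Commute (z p q) (z (p + c) q') := by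
  by_cases h : q' - q = c ∨ q' - q = -c
  · have := commute_of_adjacent hz hc hP hc4 p q (Or.inl rfl) h
    rwa [add_sub_cancel] at this
  · have h1 : z p q * z (p + c) q' = 0 := hP _ _ _ _ fun h' => h (h'.mp (by simp))
    have h2 : z (p + c) q' * z p q = 0 := hP _ _ _ _ fun h' => h <| by
      have := h'.mp (by simp)
      rw [← neg_sub q q', neg_eq_iff_eq_neg, neg_inj]
      exact this.symm
    exact h1.trans h2.symm

omit hc4 in
/-- Each row along a cycle is determined by the two previous ones. -/
theorem row_eq_of_previous_rows (p q : G) : z (p + c + c) q =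
    z (p + c) (q - c) * z p (q - c - c) + z (p + c) (q + c) * z p (q + c + c) := by
  -- Taking adjoints puts the entries of row p + c in front, so that `mul_add_eq_mul_sub`, centred
  -- at that row, trades row p + 2c for row p.
  have h1 := congrArg star (eq_mul_row_sum hz hc hP (p := p + c + c) (p' := p + c) q (by simp)
    (Or.inl rfl))
  simp only [star_mul, star_add, (hz.isStarProjection _ _).isSelfAdjoint.star_eq, add_mul] at h1
  have h2 := mul_add_eq_mul_sub hz hc hP (p + c) (q - c) (Or.inl rfl) (Or.inl rfl)
  have h3 := mul_add_eq_mul_sub hz hc hP (p + c) (q + c) (Or.inl rfl) (Or.inr rfl)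
  rw [sub_add_cancel, add_sub_cancel_right] at h2
  rw [add_neg_cancel_right, add_sub_cancel_right, sub_neg_eq_add] at h3
  rw [h1, h2, h3, add_comm]

-- Induction along `row_eq_of_previous_rows`; since the recursion has order two, the induction
-- carries two consecutive rows.
omit hc4 in
theorem commute_rows_of_commute (d : D) (p : G) (h0 : ∀ q, Commute (z p q) d)
    (h1 : ∀ q, Commute (z (p + c) q) d) (k : ℕ) : ∀ q, Commute (z (p + k • c) q) d := by
  have key : ∀ k : ℕ, (∀ q, Commute (z (p + k • c) q) d) ∧
      ∀ q, Commute (z (p + k • c + c) q) d := fun k => by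
    induction k with
    | zero => simpa using ⟨h0, h1⟩
    | succ k ih =>
      rw [succ_nsmul, ← add_assoc]
      refine ⟨ih.2, fun q => ?_⟩
      rw [row_eq_of_previous_rows hz hc hP]
      exact ((ih.2 _).mul_left (ih.1 _)).add_left ((ih.2 _).mul_left (ih.1 _))
  exact (key k).1

/-- Propagate in one index, then in the other: an entry of row p or p + c commutes with every row of
the cycle, so an entry of any row commutes with rows p and p + c, hence with all. -/
theorem commute_rows (p : G) (k l : ℕ) (q r : G) :
    Commute (z (p + k • c) q) (z (p + l • c) r) := by
  have h0 : ∀ p q r, Commute (z p q) (z p r) := fun p q r => by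
    by_cases h : q = r
    · rw [h]
    · exact (hz.row_orthogonal p q r h).trans (hz.row_orthogonal p r q (Ne.symm h)).symm
  have h1 : ∀ l q r, Commute (z (p + l • c) q) (z p r) := fun l q r =>
    commute_rows_of_commute hz hc hP _ p (fun q => h0 _ _ _)
      (fun q => (commute_adjacent_rows hz hc hP hc4 _ _ _).symm) l q
  have h2 : ∀ l q r, Commute (z (p + l • c) q) (z (p + c) r) := fun l q r =>
    commute_rows_of_commute hz hc hP _ p (fun q => commute_adjacent_rows hz hc hP hc4 _ _ _)
      (fun q => h0 _ _ _) l q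
  exact commute_rows_of_commute hz hc hP _ p (fun q => (h1 l r q).symm)
    (fun q => (h2 l r q).symm) k q

end Group

/-! ### Distinguishing rungs from cycle edges in a prism. -/

section ZModPrism

variable {n : ℕ} [NeZero n]

/-- The number of edges from the origin to `y` in the prism over a cycle of length `n`. -/
def prismStep (y : ZMod 2 × ZMod n) : ℕ :=
  (if y = (1, 0) then 1 else 0) + (if y = (0, 1) then 1 else 0) + if y = (0, -1) then 1 else 0

theorem sum_prismStep_mul (g : ZMod 2 × ZMod n → ℕ) (p q : ZMod 2 × ZMod n) :
    ∑ r, prismStep (r - p) * g (q - r) =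
      g (q - p - (1, 0)) + g (q - p - (0, 1)) + g (q - p - (0, -1)) := by
  simp only [prismStep, add_mul, ite_mul, one_mul, zero_mul, sub_eq_iff_eq_add,
    Finset.sum_add_distrib, Finset.sum_ite_eq', Finset.mem_univ, if_true, sub_add_eq_sub_sub_swap]

variable {D : Type v} [CStarAlgebra D] {z : Matrix (ZMod 2 × ZMod n) (ZMod 2 × ZMod n) D}

/-- A rung lies on two of the squares between the cycles, a cycle edge on one. These counts come
from products of matrices commuting with z. The hypothesis 4 ≠ 0 rules out the cube, where all edges
look alike. -/
theorem preserves_prism_relations (hz : IsMagicUnitary z) (h2 : (2 : ZMod n) ≠ 0)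
    (h4 : (4 : ZMod n) ≠ 0)
    (h : Preserves z fun p q : ZMod 2 × ZMod n => q - p = (1, 0) ∨ q - p = (0, 1) ∨ q - p = (0, -1)) :
    (Preserves z fun p q : ZMod 2 × ZMod n => q - p = (1, 0)) ∧
      Preserves z fun p q : ZMod 2 × ZMod n => q - p = (0, 1) ∨ q - p = -(0, 1) := by
  have cases2 : ∀ e : ZMod 2, e = 0 ∨ e = 1 := by decide
  have hne : (1 : ZMod n) ≠ -1 := fun h => h2 <| by linear_combination h
  have hs : Preserves z fun p q : ZMod 2 × ZMod n => prismStep (q - p) := by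
    have hv : ∀ y : ZMod 2 × ZMod n, prismStep y =
        if y = (1, 0) ∨ y = (0, 1) ∨ y = (0, -1) then 1 else 0 := by
      rintro ⟨e, x⟩
      rcases cases2 e with rfl | rfl <;> simp [prismStep]
      grind
    exact h.of_imp fun p q r s h => by simp only [hv, h]
  have hs2 := hz.preserves_mul hs hs
  simp only [sum_prismStep_mul] at hs2
  -- Diagonals of squares are the differences reached by exactly two two-step walks: the origin is
  -- reached by three, each (1, ±1) by two and each (0, ±2) by one, the last two being distinct
  -- since 4 ≠ 0.
  let diag (y : ZMod 2 × ZMod n) : ℕ := if y.1 = 1 ∧ (y.2 = 1 ∨ y.2 = -1) then 1 else 0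
  have hd : Preserves z fun p q : ZMod 2 × ZMod n => diag (q - p) := by
    have hv : ∀ y : ZMod 2 × ZMod n, diag y =
        if prismStep (y - (1, 0)) + prismStep (y - (0, 1)) + prismStep (y - (0, -1)) = 2
        then 1 else 0 := by
      rintro ⟨e, x⟩
      rcases cases2 e with rfl | rfl <;> simp [prismStep, diag, sub_eq_iff_eq_add]
      · grind
      · grind
    exact hs2.of_imp fun p q r s h => by simp only [hv, h]
  -- At an edge y, the product counts the ways to write y as an edge plus a diagonal, one for each
  -- square containing y: two for a rung, one for a cycle edge.
  have hsd := hz.preserves_mul hs hd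
  simp only [sum_prismStep_mul] at hsd
  have hv : ∀ y : ZMod 2 × ZMod n, (y = (0, 1) ∨ y = -(0, 1)) ↔ (prismStep y = 1 ∧
      diag (y - (1, 0)) + diag (y - (0, 1)) + diag (y - (0, -1)) = 1) := by
    rintro ⟨e, x⟩
    rcases cases2 e with rfl | rfl <;> simp [prismStep, diag, sub_eq_iff_eq_add]
    · grind
    · grind
  have hv' : ∀ y : ZMod 2 × ZMod n, y = (1, 0) ↔ (prismStep y = 1 ∧
      diag (y - (1, 0)) + diag (y - (0, 1)) + diag (y - (0, -1)) = 2) := by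
    rintro ⟨e, x⟩
    rcases cases2 e with rfl | rfl <;> simp [prismStep, diag, sub_eq_iff_eq_add]
    · grind
    · grind
  refine ⟨(hs.prod hsd).of_imp fun p q r s h => ?_, (hs.prod hsd).of_imp fun p q r s h => ?_⟩
  · simp only [Prod.mk.injEq] at h
    rw [hv', hv', h.1, h.2]
  · simp only [Prod.mk.injEq] at h
    rw [hv, hv, h.1, h.2]

end ZModPrism

/-! ### The dihedral group acting by translations and reflections. -/

section DihedralAction

variable {k : ℕ} {H : Type u} [AddCommGroup H]

/-- The dihedral group acts on the target of a homomorphism from its group of rotations by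
translations and reflections. -/
def dihedralPermHom (κ : ZMod k →+ H) : DihedralGroup k →* Equiv.Perm H where
  toFun
    -- The rotation subtracts κ i so as to match the convention `r i * sr j = sr (j - i)` with the
    -- reflection p ↦ κ i - p.
    | .r i => Equiv.subRight (κ i)
    | .sr i => Equiv.subLeft (κ i)
  map_one' := Equiv.ext fun p => by
    change p - κ 0 = p
    rw [map_zero, sub_zero]
  map_mul' := by
    rintro (i | i) (j | j) <;> ext p
    · change p - κ (i + j) = p - κ j - κ i
      rw [map_add]; abel
    · change κ (j - i) - p = κ j - p - κ i
      rw [map_sub]; abel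
    · change κ (i + j) - p = κ i - (p - κ j)
      rw [map_add]; abel
    · change p - κ (j - i) = κ i - (κ j - p)
      rw [map_sub]; abel

theorem dihedralPermHom_r (κ : ZMod k →+ H) (i : ZMod k) (p : H) :
    dihedralPermHom κ (.r i) p = p - κ i := rfl

theorem dihedralPermHom_sr (κ : ZMod k →+ H) (i : ZMod k) (p : H) :
    dihedralPermHom κ (.sr i) p = κ i - p := rfl

/-- A translation and a reflection that agree at 0 and at c would force c = -c. Within each kind,
the value at 0 determines the parameter. -/
theorem dihedralPermHom_injective {κ : ZMod k →+ H} (hκ : Function.Injective κ) {c : H}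
    (hc : c + c ≠ 0) : Function.Injective (dihedralPermHom κ) := by
  have h1 : ∀ i j, dihedralPermHom κ (.r i) ≠ dihedralPermHom κ (.sr j) := fun i j h => hc <| by
    have h2 := congrArg (fun σ => σ 0) h
    have h3 := congrArg (fun σ => σ c) h
    simp only [dihedralPermHom_r, dihedralPermHom_sr] at h2 h3
    rw [sub_zero, zero_sub] at h2
    rw [← h2, sub_eq_add_neg, add_comm, sub_eq_add_neg, add_right_inj] at h3
    rwa [← eq_neg_iff_add_eq_zero]
  rintro (i | i) (j | j) h
  · have h2 := congrArg (fun σ => σ 0) h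
    simp only [dihedralPermHom_r, sub_right_inj] at h2
    rw [hκ h2]
  · exact (h1 _ _ h).elim
  · exact (h1 _ _ h.symm).elim
  · have h2 := congrArg (fun σ => σ 0) h
    simp only [dihedralPermHom_sr, sub_left_inj] at h2
    rw [hκ h2]

theorem dihedralPermHom_sub (κ : ZMod k →+ H) (g : DihedralGroup k) (p q : H) :
    dihedralPermHom κ g q - dihedralPermHom κ g p = q - p ∨
      dihedralPermHom κ g q - dihedralPermHom κ g p = -(q - p) := by
  rcases g with i | i
  · left; simp only [dihedralPermHom_r]; abel
  · right; simp only [dihedralPermHom_sr]; abel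

end DihedralAction

/-! ### The quantum automorphism group of the prism over an odd cycle. -/

section PrismAlgebra

open MagicAlgebra

variable {n : ℕ} [NeZero n]

/-- The relation of differing by ±(0, 1) consists of two disjoint cycles. Preserved rungs identify
the rows over one with the rows over the other, and `commute_rows` handles a single cycle. -/
theorem commute_of_preserves_prism {D : Type v} [CStarAlgebra D]
    {z : Matrix (ZMod 2 × ZMod n) (ZMod 2 × ZMod n) D} (hz : IsMagicUnitary z)
    (h2 : (2 : ZMod n) ≠ 0) (h4 : (4 : ZMod n) ≠ 0)
    (h1 : Preserves z fun p q : ZMod 2 × ZMod n => q - p = (1, 0))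
    (hc : Preserves z fun p q : ZMod 2 × ZMod n => q - p = (0, 1) ∨ q - p = -(0, 1))
    (p q r s : ZMod 2 × ZMod n) : Commute (z p q) (z r s) := by
  have key : ∀ p q, z p q = z p q * z (p + (1, 0)) (q + (1, 0)) := fun p q => by
    have h : z p q = ∑ q', z p q * z (p + (1, 0)) q' := by
      rw [← Finset.mul_sum, hz.row_sum, mul_one]
    rw [Finset.sum_eq_single (q + (1, 0))] at h
    · exact h
    · intro q' _ hq'
      refine h1 _ _ _ _ fun h' => hq' ?_
      have := h'.mp (by simp)
      rw [← this, add_sub_cancel]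
    · simp
  -- By `key` each of the two projections is dominated by the other, because the shift by (1, 0) is
  -- an involution.
  have hswap : ∀ p q, z p q = z (p + (1, 0)) (q + (1, 0)) := fun p q => by
    have e : ((1, 0) : ZMod 2 × ZMod n) + (1, 0) = 0 := Prod.ext (show (1 : ZMod 2) + 1 = 0 from rfl) (add_zero _)
    have h3 := congrArg star (key (p + (1, 0)) (q + (1, 0)))
    rw [add_assoc, add_assoc, e, add_zero, add_zero, star_mul,
      (hz.isStarProjection _ _).isSelfAdjoint.star_eq,
      (hz.isStarProjection _ _).isSelfAdjoint.star_eq] at h3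
    exact (key p q).trans h3.symm
  have hrow : ∀ p q, ∃ (m : ℕ) (q' : ZMod 2 × ZMod n), z p q = z (0 + m • (0, 1)) q' := by
    rintro ⟨e, x⟩ q
    have hx : ((0, x) : ZMod 2 × ZMod n) = 0 + x.val • (0, 1) := by
      ext <;> simp
    have cases2 : e = 0 ∨ e = 1 := by revert e; decide
    rcases cases2 with rfl | rfl
    · exact ⟨x.val, q, by rw [← hx]⟩
    · refine ⟨x.val, q + (1, 0), ?_⟩
      rw [← hx, hswap]
      congr 1
      exact Prod.ext (show (1 : ZMod 2) + 1 = 0 from rfl) (add_zero _)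
  have hc2 : ((0, 1) : ZMod 2 × ZMod n) + (0, 1) ≠ 0 := fun h => h2 <| by
    rw [← one_add_one_eq_two]; exact congrArg Prod.snd h
  have hc4 : ((0, 1) : ZMod 2 × ZMod n) + (0, 1) + ((0, 1) + (0, 1)) ≠ 0 := fun h => h4 <| by
    rw [← two_add_two_eq_four, ← one_add_one_eq_two]; exact congrArg Prod.snd h
  obtain ⟨k, q', hk⟩ := hrow p q
  obtain ⟨l, s', hl⟩ := hrow r s
  rw [hk, hl]
  exact commute_rows hz hc2 hc hc4 0 k l q' s'

/-- A self-map of the prism that preserves the two kinds of edges is a translation or a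
reflection. -/
theorem eq_add_or_eq_sub_of_preserves_prism (h2 : (2 : ZMod n) ≠ 0)
    {s : ZMod 2 × ZMod n → ZMod 2 × ZMod n} (hs : Function.Injective s)
    (h1 : ∀ p q, q - p = (1, 0) → s q - s p = (1, 0))
    (hc : ∀ p q, q - p = (0, 1) → s q - s p = (0, 1) ∨ s q - s p = -(0, 1)) :
    (∀ p, s p = s 0 + p) ∨ ∀ p, s p = s 0 - p := by
  let c : ZMod 2 × ZMod n := (0, 1)
  have hstep : ∀ p, s (p + c) - s p = c ∨ s (p + c) - s p = -c := fun p =>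
    hc _ _ (add_sub_cancel_left _ _)
  have hcc : ∀ p, p + c + c ≠ p := fun p h => h2 <| by
    have := congrArg Prod.snd h
    simp only [c, Prod.snd_add, add_assoc, one_add_one_eq_two, add_eq_left] at this
    exact this
  -- The first step fixes the direction: a later step in the opposite direction would give s (m • c
  -- + c + c) = s (m • c), against injectivity. The induction therefore carries the direction of the
  -- next step along with the position.
  have hiter : ∀ ε, (ε = c ∨ ε = -c) → s c - s 0 = ε → ∀ m : ℕ,
      s (m • c) = s 0 + m • ε := fun ε hε h m => by
    have key : ∀ m : ℕ, s (m • c) = s 0 + m • ε ∧ s (m • c + c) = s (m • c) + ε := fun m => by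
      induction m with
      | zero =>
        rw [zero_smul, zero_add, zero_smul, add_zero]
        exact ⟨rfl, by rw [← h, add_sub_cancel]⟩
      | succ m ih =>
        refine ⟨by rw [succ_nsmul, ih.2, ih.1, succ_nsmul, add_assoc], ?_⟩
        rw [succ_nsmul]
        by_contra hne
        refine hcc (m • c) (hs ?_)
        have h3 : s (m • c + c + c) - s (m • c + c) = -ε := by
          have h4 : s (m • c + c + c) - s (m • c + c) ≠ ε := fun h => hne (by
            rw [← h, add_sub_cancel])
          rcases hε with rfl | rfl
          · exact (hstep _).resolve_left h4
          · rw [neg_neg]; exact (hstep _).resolve_right h4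
        rw [sub_eq_iff_eq_add, ih.2] at h3
        rw [h3]; abel
    exact (key m).1
  have hall : ∀ p : ZMod 2 × ZMod n, p = p.2.val • c ∨ p = p.2.val • c + (1, 0) := by
    rintro ⟨e, x⟩
    have cases2 : e = 0 ∨ e = 1 := by revert e; decide
    rcases cases2 with rfl | rfl
    · left; ext <;> simp [c]
    · right; ext <;> simp [c]
  have hσ : ∀ p, s (p + (1, 0)) = s p + (1, 0) := fun p => by
    rw [← sub_eq_iff_eq_add', h1 _ _ (add_sub_cancel_left _ _)]
  have hneg : -((1, 0) : ZMod 2 × ZMod n) = (1, 0) := Prod.ext (show -(1 : ZMod 2) = 1 from rfl) neg_zero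
  have h0 := hstep 0
  rw [zero_add] at h0
  rcases h0 with h0 | h0
  · refine Or.inl fun p => ?_
    have h3 := hiter c (Or.inl rfl) h0 p.2.val
    rcases hall p with hp | hp
    · rwa [← hp] at h3
    · rw [← sub_eq_iff_eq_add] at hp
      rw [← hp] at h3
      have h5 := hσ (p - (1, 0))
      rw [sub_add_cancel, h3] at h5
      rw [h5]; abel
  · refine Or.inr fun p => ?_
    have h3 := hiter (-c) (Or.inr rfl) h0 p.2.val
    rw [smul_neg, ← sub_eq_add_neg] at h3
    rcases hall p with hp | hp
    · rwa [← hp] at h3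
    · rw [← sub_eq_iff_eq_add] at hp
      rw [← hp] at h3
      have h5 := hσ (p - (1, 0))
      rw [sub_add_cancel, h3] at h5
      rw [h5]
      -- The rung (1, 0) is its own negative, so the reflection also commutes with adding it.
      nth_rw 2 [← hneg]
      abel

/-- Oddness enters twice: it excludes length 4, and it makes ℤ₂ × ℤ_n cyclic of order 2n, so that
its translations and reflections form the dihedral group of order 4n. -/
theorem hopfIsomorphic_of_prism (hn : Odd n) (h3 : 3 ≤ n) (Z : SimpleGraph (ZMod 2 × ZMod n))
    (hZ : ∀ p q, Z.Adj p q ↔ q - p = (1, 0) ∨ q - p = (0, 1) ∨ q - p = (0, -1)) :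
    HopfIsomorphic (QuantumAut Z) (DihedralGroup (2 * n) → ℂ) := by
  have h2 : (2 : ZMod n) ≠ 0 := fun h => by
    have h' := (ZMod.natCast_eq_zero_iff 2 n).mp (by exact_mod_cast h)
    have := Nat.le_of_dvd two_pos h'
    omega
  have h4 : (4 : ZMod n) ≠ 0 := fun h => by
    have h' := (ZMod.natCast_eq_zero_iff 4 n).mp (by exact_mod_cast h)
    have := Nat.le_of_dvd four_pos h'
    obtain ⟨k, rfl⟩ := hn
    obtain rfl : k = 1 := by omega
    norm_num at h'
  have hz := isMagicUnitary_u (𝒳 := {Z})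
  have hadj : Preserves (u {Z}) fun p q : ZMod 2 × ZMod n =>
      q - p = (1, 0) ∨ q - p = (0, 1) ∨ q - p = (0, -1) :=
    (preserves_u (Set.mem_singleton Z)).of_imp fun p q r s h => by
      simp only [hZ] at h
      exact h
  obtain ⟨h1, hc⟩ := preserves_prism_relations hz h2 h4 hadj
  let κ := ZMod.chineseRemainder (m := 2) (n := n) (Nat.coprime_two_left.mpr hn)
  let κ' : ZMod (2 * n) →+ ZMod 2 × ZMod n := κ.toRingHom.toAddMonoidHom
  have hκ' : ∀ i, κ' i = κ i := fun i => rfl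
  have hc2 : ((0, 1) : ZMod 2 × ZMod n) + (0, 1) ≠ 0 := fun h => h2 <| by
    rw [← one_add_one_eq_two]; exact congrArg Prod.snd h
  have hneg : -((1, 0) : ZMod 2 × ZMod n) = (1, 0) := Prod.ext (show -(1 : ZMod 2) = 1 from rfl) neg_zero
  have hneg' : -((0, 1) : ZMod 2 × ZMod n) = (0, -1) := Prod.ext neg_zero rfl
  refine hopfIsomorphic_functions {Z} (commute_of_preserves_prism hz h2 h4 h1 hc)
    (dihedralPermHom κ') (dihedralPermHom_injective κ.injective hc2) ?_ fun s hs => ?_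
  · rintro _ rfl g p q
    simp only [hZ]
    rcases dihedralPermHom_sub κ' g p q with h | h
    · rw [h]
    · rw [h, neg_eq_iff_eq_neg, neg_eq_iff_eq_neg, neg_eq_iff_eq_neg, hneg, ← hneg', neg_neg,
        or_comm (a := q - p = -(0, 1))]
  · have hinj : Function.Injective s := fun i k h => (hs _ hz.preserves_eq i k).mp h
    rcases eq_add_or_eq_sub_of_preserves_prism h2 hinj (fun p q h => (hs _ h1 p q).mpr h)
      (fun p q h => (hs _ hc p q).mpr (Or.inl h)) with h | h
    -- The sign is needed because rotations act by subtraction.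
    · refine ⟨.r (κ.symm (-s 0)), fun p => ?_⟩
      rw [dihedralPermHom_r, hκ', RingEquiv.apply_symm_apply, h p]
      abel
    · refine ⟨.sr (κ.symm (s 0)), fun p => ?_⟩
      rw [dihedralPermHom_sr, hκ', RingEquiv.apply_symm_apply, h p]

theorem hopfIsomorphic_prism_cycleGraph (hn : Odd n) (h3 : 3 ≤ n) :
    HopfIsomorphic (QuantumAut (prism (SimpleGraph.cycleGraph n)))
      (DihedralGroup (2 * n) → ℂ) := by
  obtain ⟨m, rfl⟩ : ∃ m, n = m + 2 := ⟨n - 2, by omega⟩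
  -- With n written as m + 2, `ZMod n` unfolds to `Fin n`, so the vertices acquire their group
  -- structure by the identity map.
  let σ : ZMod 2 × ZMod (m + 2) ≃ Fin 2 × Fin (m + 2) := Equiv.refl _
  let X : SimpleGraph (ZMod 2 × ZMod (m + 2)) :=
    SimpleGraph.comap σ (prism (SimpleGraph.cycleGraph (m + 2)))
  have hX : X ≃g prism (SimpleGraph.cycleGraph (m + 2)) := SimpleGraph.Iso.comap σ _
  have h : ∀ p q, X.Adj p q ↔
      (p.1 ≠ q.1 ∧ p.2 = q.2) ∨ ((p.2 - q.2 = 1 ∨ q.2 - p.2 = 1) ∧ p.1 = q.1) := fun p q => by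
    refine Iff.trans (SimpleGraph.boxProd_adj (x := σ p) (y := σ q)) ?_
    rw [SimpleGraph.top_adj, SimpleGraph.cycleGraph_adj]
    exact Iff.rfl
  clear_value X
  refine (hopfIsomorphic_of_iso hX.symm).trans (hopfIsomorphic_of_prism hn h3 X fun p q => ?_)
  have cases2 : ∀ a b : ZMod 2, (a ≠ b ↔ b - a = 1) ∧ (a = b ↔ b - a = 0) := by decide
  have e1 : p.2 = q.2 ↔ q.2 - p.2 = 0 := by rw [sub_eq_zero, eq_comm]
  have e2 : p.2 - q.2 = 1 ↔ q.2 - p.2 = -1 := by rw [← neg_sub q.2, neg_eq_iff_eq_neg]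
  rw [h, (cases2 p.1 q.1).1, (cases2 p.1 q.1).2, e1, e2]
  simp only [Prod.ext_iff, Prod.fst_sub, Prod.snd_sub]
  tauto

end PrismAlgebra

end QSym

end

/-! ### Assembling the four isomorphisms. -/

open QSym
theorem corollary4p1 :
    -- `A(K_m × K_n) = A(K_m) ⊗ A(K_n)` for `m ≠ n`
    (∀ m n : ℕ, 1 ≤ m → 1 ≤ n → m ≠ n →
      HopfIsomorphic
        (QuantumAut (directProd (⊤ : SimpleGraph (Fin m)) (⊤ : SimpleGraph (Fin n))))
        (MaxTensor (QuantumAut (⊤ : SimpleGraph (Fin m))) (QuantumAut (⊤ : SimpleGraph (Fin n))))) ∧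
    -- `A(Pr(K_n)) = C(ℤ₂) ⊗ A_s(n)` for `n ≠ 2`
    (∀ n : ℕ, 1 ≤ n → n ≠ 2 →
      HopfIsomorphic
        (QuantumAut (prism (⊤ : SimpleGraph (Fin n))))
        (MaxTensor (Multiplicative (ZMod 2) → ℂ) (QuantumPerm n))) ∧
    -- `A(Pr(C_n)) = C(D_{2n})` for `n` odd, where `D_{2n}` has order `4n`
    (∀ (n : ℕ) [NeZero n], 3 ≤ n → Odd n →
      HopfIsomorphic
        (QuantumAut (prism (SimpleGraph.cycleGraph n)))
        (DihedralGroup (2 * n) → ℂ)) ∧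
    -- `A(Pr(C_4)) = C(ℤ₂) ⊗ A_s(4)`
    HopfIsomorphic
      (QuantumAut (prism (SimpleGraph.cycleGraph 4)))
      (MaxTensor (Multiplicative (ZMod 2) → ℂ) (QuantumPerm 4)) := by
  refine ⟨fun m n hm hn hmn => ?_, fun n hn hn2 => ?_, fun n _ h3 hn => ?_, ?_⟩
  · have : Nonempty (Fin m) := ⟨⟨0, hm⟩⟩
    have : Nonempty (Fin n) := ⟨⟨0, hn⟩⟩
    exact hopfIsomorphic_directProd_top (by simpa using hmn) _ _ (fun _ h => h) (fun _ h => h)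
  · have : Nonempty (Fin n) := ⟨⟨0, hn⟩⟩
    -- The K_2 factor first appears as A_s(2); it is then replaced by C(ℤ₂).
    exact (hopfIsomorphic_prism_top (by simpa using hn2)).trans
      hopfIsomorphic_quantumPerm_two.maxTensor_left
  · exact hopfIsomorphic_prism_cycleGraph hn h3
  -- The cube is treated as K_2 × K_4, with the complete-graph relations omitted so that the factors
  -- are A_s(2) and A_s(4).
  · exact ((hopfIsomorphic_of_iso cubeIso).trans
      (hopfIsomorphic_directProd_top (by simp) ∅ ∅ (fun _ h => h.elim) (fun _ h => h.elim))).trans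
      hopfIsomorphic_quantumPerm_two.maxTensor_left
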